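/- Let $S^1=\mathbb R/\mathbb Z$ (total length $1$), let $D\ge 0$, let $V:S^1\to\mathbb R$ be odd and integrable, and consider the equation $$\partial_t f = D\,\partial_\theta^2 f+\partial_\theta\bigl((V*f)\,f\bigr),\qquad (V*f)(\theta)=\int_{S^1}V(\theta-\psi)f(\psi)\,d\psi. \tag{1}$$ A solution is a function $f:[0,\infty)\times S^1\to\mathbb R$ such that $f$, $\partial_\theta f$, $\partial_\theta^2 f$ exist and are continuous on $(0,\infty)\times S^1$, (1) holds pointwise there, $f(0,\cdot)\in L^1(S^1)$, and $f(t,\cdot)\to f(0,\cdot)$ in $L^1$ as $t\downarrow 0$. For $k\in\mathbb Z$ put $v_k=\int_0^{1/2}V(\theta)\sin(2\pi k\theta)\,d\theta$ and $c_k=4\pi k(-\pi Dk+v_k)$. Let $f_k=\int_{S^1}f(\theta)e^{-2\pi ik\theta}\,d\theta$ and $\|f\|^2=\sum_{k\ge1}\frac1k|f_k|^2$, and let $$\rho=\sqrt{\sup_{l\ge1}\tfrac{l^2(l^2-1)}6v_l^2}.$$ Say that a solution $f$ *converges to $1$ exponentially* if $f(t,\cdot)$ is $C^\infty$ for every $t>0$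 and there is $c>0$ such that for all $n\ge0$ and $t_0>0$ there is a constant $C$ with $\|\partial_\theta^n(f(t,\cdot)-1)\|_\infty\le Ce^{-ct}$ for all $t\ge t_0$. 1. The constant function $1$ is a stationary solution of (1). The linearization at $1$ of the right-hand side of (1) is $h\mapsto Dh''+\partial_\theta\bigl(V*h+(V*1)h\bigr)$, and its eigenvalues (with complex-valued $C^2$ eigenfunctions on $S^1$) are exactly the numbers $c_k$, $k\in\mathbb Z$. 2. If $V$ is $C^1$ and piecewise $C^2$, then $\sum_{l\ge1}l|v_l|<\infty$ and $\rho<\infty$. 3. Assume $\sum_{l\ge1}l|v_l|<\infty$. - (a) If $D>0$ and $c_k<0$ for all $k\ge1$, then $1$ is locally stable: for every $\eta>0$ there is $\varepsilon>0$ such that every solution of mass $\int_{S^1} f(0,\theta)\,d\theta=1$ with $\|f(0,\cdot)\|<\varepsilon$ satisfies $\|f(t,\cdot)\|<\eta$ for all $t\ge0$ and converges to $1$ exponentially. - (b) If moreover $\rho<\infty$ (but without assuming $D>0$ or $c_k<0$), then every solution $f$ of mass $\int_{S^1} f(0,\theta)\,d\theta=1$ with $\|f(0,\cdot)\|<\infty$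 and $$4\pi\rho\,\|f(0,\cdot)\|<\inf_{k\ge1}(-c_k)$$ converges to $1$ exponentially. (For $\rho>0$ the condition reads $\|f(0,\cdot)\|<\inf_{k\ge1}(-c_k)/(4\pi\rho)$.) -/

import Mathlib

open MeasureTheory Filter Topology Set
open scoped ContDiff

namespace CircleTransport

noncomputable section

/-- The circle `ℝ / ℤ` of length one, with Lebesgue measure of total mass one. -/
abbrev Circ : Type := UnitAddCircle

/-- A function on the circle is of class `C^n` if its 1-periodic lift to `ℝ` is. -/
def CircContDiff {E : Type*} [NormedAddCommGroup E] [NormedSpace ℝ E]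
    (n : ℕ∞) (f : Circ → E) : Prop :=
  ContDiff ℝ (n : WithTop ℕ∞) (fun x : ℝ => f (x : Circ))

/-- The `n`-th derivative with respect to the angle, of a function on the circle. -/
def circDeriv {E : Type*} [NormedAddCommGroup E] [NormedSpace ℝ E]
    (n : ℕ) (f : Circ → E) (θ : Circ) : E :=
  iteratedDeriv n (fun x : ℝ => f (θ + (x : Circ))) 0

/-- The convolution `(V * f)(θ) = ∫ V(θ - ψ) f(ψ) dψ` over the circle. -/
def conv {𝕜 : Type*} [RCLike 𝕜] (V : Circ → ℝ) (f : Circ → 𝕜) (θ : Circ) : 𝕜 :=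
  ∫ ψ : Circ, V (θ - ψ) • f ψ

/-- The right-hand side `D f'' + ((V * f) f)'` of the transport-diffusion equation. It is defined
for real- and for complex-valued `f`; the latter are needed for complex eigenfunctions. -/
def rhs {𝕜 : Type*} [RCLike 𝕜] (V : Circ → ℝ) (D : ℝ) (f : Circ → 𝕜) (θ : Circ) : 𝕜 :=
  D • circDeriv 2 f θ + circDeriv 1 (fun ψ => conv V f ψ * f ψ) θ

/-- The linearization of `rhs V D` at the profile `g`, applied to the perturbation `h`:
`D h'' + ((V * g) h + (V * h) g)'`. -/
def linearizedRhs {𝕜 : Type*} [RCLike 𝕜] (V : Circ → ℝ) (D : ℝ) (g h : Circ → 𝕜)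
    (θ : Circ) : 𝕜 :=
  D • circDeriv 2 h θ + circDeriv 1 (fun ψ => conv V g ψ * h ψ + conv V h ψ * g ψ) θ

/-- `f` is a (global, classical) solution of `∂ₜ f = D ∂_θ² f + ∂_θ ((V * f) f)`: for `t > 0` it
is of class `C²` in `θ`, with `f`, `∂_θ f`, `∂_θ² f` jointly continuous, and solves the equation
pointwise; the integrable initial function `f 0` is attained in `L¹` as `t` decreases to `0`.
Only the values `f t` for `t ≥ 0` matter. -/
structure IsSolution (V : Circ → ℝ) (D : ℝ) (f : ℝ → Circ → ℝ) : Prop where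
  integrable_init : Integrable (f 0)
  tendsto_init : Tendsto (fun t => ∫ θ : Circ, |f t θ - f 0 θ|) (𝓝[>] 0) (𝓝 0)
  contDiff : ∀ t : ℝ, 0 < t → CircContDiff 2 (f t)
  continuousOn : ∀ j : ℕ, j ≤ 2 →
    ContinuousOn (fun p : ℝ × Circ => circDeriv j (f p.1) p.2) (Ioi 0 ×ˢ univ)
  equation : ∀ t : ℝ, 0 < t → ∀ θ : Circ, HasDerivAt (fun s => f s θ) (rhs V D (f t) θ) t

/-- `g` is a stationary solution: the time-independent function with profile `g` is a solution. -/
def IsStationarySolution (V : Circ → ℝ) (D : ℝ) (g : Circ → ℝ) : Prop :=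
  IsSolution V D (fun _ => g)

/-- `v_k = ∫_0^{1/2} V(θ) sin(2 π k θ) dθ`. -/
def sineCoeff (V : Circ → ℝ) (k : ℤ) : ℝ :=
  ∫ x in (0 : ℝ)..(1 / 2), V (x : Circ) * Real.sin (2 * Real.pi * k * x)

/-- `c_k = 4 π k (-π D k + v_k)`. -/
def eigenval (V : Circ → ℝ) (D : ℝ) (k : ℤ) : ℝ :=
  4 * Real.pi * k * (-(Real.pi * D * k) + sineCoeff V k)

/-- `l² (l² - 1) v_l² / 6`. -/
def rhoTerm (V : Circ → ℝ) (l : ℕ+) : ℝ :=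
  (l : ℝ) ^ 2 * ((l : ℝ) ^ 2 - 1) / 6 * sineCoeff V ((l : ℕ) : ℤ) ^ 2

/-- `ρ = sqrt (sup_{l ≥ 1} l² (l² - 1) v_l² / 6)`, meaningful when the supremum is finite. -/
def rho (V : Circ → ℝ) : ℝ :=
  Real.sqrt (⨆ l : ℕ+, rhoTerm V l)

/-- `|f_k|² / k`, with `f_k` the `k`-th Fourier coefficient. -/
def normTerm (f : Circ → ℝ) (k : ℕ+) : ℝ :=
  ‖fourierCoeff (fun θ : Circ => (f θ : ℂ)) ((k : ℕ) : ℤ)‖ ^ 2 / (k : ℝ)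

/-- `‖f‖ < ∞`, where `‖f‖² = Σ_{k ≥ 1} |f_k|² / k`. -/
def HasFiniteModeNorm (f : Circ → ℝ) : Prop :=
  Summable (normTerm f)

/-- `‖f‖ = (Σ_{k ≥ 1} |f_k|² / k)^{1/2}`, meaningful when `HasFiniteModeNorm f` holds. -/
def modeNorm (f : Circ → ℝ) : ℝ :=
  Real.sqrt (∑' k : ℕ+, normTerm f k)

/-- `f(t, ·)` is smooth for `t > 0` and converges to the constant `1` exponentially, uniformly
together with all angular derivatives. The rate `c` is the same for all orders `n`. -/
def ConvergesToOne (f : ℝ → Circ → ℝ) : Prop :=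
  (∀ t : ℝ, 0 < t → CircContDiff ⊤ (f t)) ∧
  ∃ c : ℝ, 0 < c ∧ ∀ (n : ℕ) (t₀ : ℝ), 0 < t₀ → ∃ C : ℝ, ∀ t : ℝ, t₀ ≤ t → ∀ θ : Circ,
    |circDeriv n (fun ψ => f t ψ - 1) θ| ≤ C * Real.exp (-(c * t))

/-- Local (asymptotic) stability of the constant `1` among solutions of mass one, with respect to
`‖·‖`: solutions starting close to `1` stay close to `1`, and converge to `1`. -/
def OneIsLocallyStable (V : Circ → ℝ) (D : ℝ) : Prop :=
  ∀ η : ℝ, 0 < η → ∃ ε : ℝ, 0 < ε ∧ ∀ f : ℝ → Circ → ℝ,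
    IsSolution V D f → ∫ θ : Circ, f 0 θ = 1 →
    HasFiniteModeNorm (f 0) → modeNorm (f 0) < ε →
    (∀ t : ℝ, 0 ≤ t → HasFiniteModeNorm (f t) ∧ modeNorm (f t) < η) ∧ ConvergesToOne f

/-- `V` is of class `C²` on each closed interval of some finite subdivision of `[0, 1]`. -/
def PiecewiseC2 (V : Circ → ℝ) : Prop :=
  ∃ (n : ℕ) (a : ℕ → ℝ), a 0 = 0 ∧ a n = 1 ∧ (∀ i < n, a i < a (i + 1)) ∧
    ∀ i < n, ContDiffOn ℝ 2 (fun x : ℝ => V (x : Circ)) (Icc (a i) (a (i + 1)))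

end

end CircleTransport

/-!
The equation is studied through the Fourier coefficients `a_k(t)` of a solution of mass one. For an
odd kernel the `k`-th Fourier coefficient of `V` is `-2 i v_k`, so the equation becomes the system

`a_k' = -4 π² D k² a_k + 4 π k ∑_l v_l a_l a_{k-l} = c_k a_k + 4 π k ∑_{l ≠ k} v_l a_l a_{k-l}`

(`IsSolution.hasDerivAt_fourierCoeff`, `IsModeFlow.hasDerivAt_mode`), the term `l = k` being linear
because `a_0 = 1`. The linearization at `1` is diagonal in the Fourier basis with entries `c_k`,
which gives its eigenvalues. For `V` of class `C¹` and piecewise `C²`, the numbers `k² v_k` are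
bounded by Fourier coefficients of the bounded function `V''`, hence square summable by the Parseval
identity (`PiecewiseC2.exists_square_summable`).

For stability, let `E = ∑_{k ≥ 1} |a_k|² / k`. Because of the weight `1 / k` the nonlinear terms
symmetrize over the resonant triples `(p, q, p + q)` (`hasSum_cubicTerm`), and

`E' = 2 ∑ c_k |a_k|² / k + 8 π ∑_{p, q ≥ 1} v_{p+q} Re (conj a_p conj a_q a_{p+q})`.

The cubic sum is at most `√E · ∑ l |v_l| · ∑ |a_k|²`, which diffusion absorbs when `E` is small
(`abs_cubic_le_of_summable`). It is also at most `ρ E^{3/2}` (`abs_cubic_le_of_bdd`), by the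
Cauchy-Schwarz inequality with weight `p q` and `∑_{p+q=k} p q = k (k² - 1) / 6`; this is below the
linear dissipation when `4 π ρ √E < inf (-c_k)`. In either case a comparison argument yields
exponential decay of `E` (`IsModeFlow.modeEnergy_le`).

The initial function is attained only in `L¹`, so `E` need not a priori be continuous at `t = 0`.
With the energy truncated at mode `N`, which is continuous there, the symmetrized flux through the
mode `N` involves at most `p` triples for each `p`, so it is bounded by `3 sup |a_k|³ ∑ l |v_l|`
independently of `N` (`abs_cubic_truncated_le`). Letting `N → ∞` gives `E(t) ≤ E(0) + C t` for small
`t` (`IsModeFlow.exists_energy_le_near_zero`), which starts the comparison.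

Finally, decay of `E` gives `|a_k| ≤ C √|k| e^{-ct}`. The strict negativity of the `c_k` forces
`c_k ≤ -γ k²` (`exists_modeRate_le`; in the case of a spectral gap, `D > 0` is automatic by
`pos_of_spectral_gap`). The variation of constants formula then gains one power of `k` at a time,
since `|k| ≤ 2 |l| |k - l|` lets the nonlinear term inherit weighted decay
(`IsModeFlow.exists_pow_mul_norm_le`), and summing the Fourier series gives smoothness and
exponential convergence of all derivatives (`IsSolution.convergesToOne`).
-/

namespace CircleTransport

/-! ### Derivatives of functions on the circle -/

section Calculus

variable {E : Type*} [NormedAddCommGroup E] [NormedSpace ℝ E]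

theorem circDeriv_coe (n : ℕ) (f : Circ → E) (y : ℝ) :
    circDeriv n f (y : Circ) = iteratedDeriv n (fun x : ℝ => f (x : Circ)) y := by
  have h : (fun x : ℝ => f ((y : Circ) + (x : Circ)))
      = fun x : ℝ => (fun z : ℝ => f (z : Circ)) (y + x) := by
    funext x; simp
  rw [circDeriv, h]
  refine (congrFun (iteratedDeriv_comp_const_add n (fun z : ℝ => f (z : Circ)) y) 0).trans ?_
  simp

theorem circDeriv_zero (f : Circ → E) : circDeriv 0 f = f := by
  funext θ
  induction θ using QuotientAddGroup.induction_on with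
  | H y => exact (circDeriv_coe 0 f y).trans (by simp)

theorem circDeriv_one_coe (f : Circ → E) (y : ℝ) :
    circDeriv 1 f (y : Circ) = deriv (fun x : ℝ => f (x : Circ)) y := by
  rw [circDeriv_coe, iteratedDeriv_one]

theorem circDeriv_succ (n : ℕ) (f : Circ → E) :
    circDeriv (n + 1) f = circDeriv n (circDeriv 1 f) := by
  funext θ
  induction θ using QuotientAddGroup.induction_on with
  | H y =>
    rw [circDeriv_coe, circDeriv_coe, iteratedDeriv_succ']
    congr 1
    funext x
    exact (circDeriv_one_coe f x).symm

theorem continuous_of_lift {X : Type*} [TopologicalSpace X] {f : Circ → X}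
    (h : Continuous fun x : ℝ => f (x : Circ)) : Continuous f :=
  (QuotientAddGroup.isQuotientMap_mk _).continuous_iff.2 h

theorem CircContDiff.continuous {n : ℕ∞} {f : Circ → E} (h : CircContDiff n f) :
    Continuous f :=
  continuous_of_lift (ContDiff.continuous h)

theorem CircContDiff.of_le {m n : ℕ∞} {f : Circ → E} (h : CircContDiff n f) (hmn : m ≤ n) :
    CircContDiff m f :=
  ContDiff.of_le h (by exact_mod_cast hmn)

theorem CircContDiff.hasDerivAt {f : Circ → E} (h : CircContDiff 1 f) (y : ℝ) :
    HasDerivAt (fun x : ℝ => f (x : Circ)) (circDeriv 1 f (y : Circ)) y := by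
  rw [circDeriv_one_coe]
  exact ((ContDiff.differentiable h (by simp)) y).hasDerivAt

theorem CircContDiff.circDeriv_one {n : ℕ} {f : Circ → E}
    (h : CircContDiff ((n + 1 : ℕ) : ℕ∞) f) : CircContDiff (n : ℕ∞) (circDeriv 1 f) := by
  have h1 : ContDiff ℝ ((n : WithTop ℕ∞) + 1) (fun x : ℝ => f (x : Circ)) := by
    exact_mod_cast h
  have h2 := (contDiff_succ_iff_deriv.1 h1).2.2
  have h3 : (fun x : ℝ => circDeriv 1 f (x : Circ)) = deriv (fun x : ℝ => f (x : Circ)) := by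
    funext x; exact circDeriv_one_coe f x
  unfold CircContDiff
  rw [h3]
  exact_mod_cast h2

theorem circContDiff_one_of_hasDerivAt {f f' : Circ → E} (hf' : Continuous f')
    (h : ∀ y : ℝ, HasDerivAt (fun x : ℝ => f (x : Circ)) (f' (y : Circ)) y) :
    CircContDiff 1 f ∧ circDeriv 1 f = f' := by
  have hd : deriv (fun x : ℝ => f (x : Circ)) = fun x : ℝ => f' (x : Circ) := by
    funext x; exact (h x).deriv
  constructor
  · have : ContDiff ℝ 1 (fun x : ℝ => f (x : Circ)) := by
      rw [contDiff_one_iff_deriv]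
      refine ⟨fun y => (h y).differentiableAt, ?_⟩
      rw [hd]
      exact hf'.comp (AddCircle.continuous_mk' 1)
    exact this
  · funext θ
    induction θ using QuotientAddGroup.induction_on with
    | H y => exact (circDeriv_one_coe f y).trans (h y).deriv

theorem circDeriv_const_add (n : ℕ) (hn : n ≠ 0) (c : E) (f : Circ → E) :
    circDeriv n (fun θ => c + f θ) = circDeriv n f := by
  obtain ⟨m, rfl⟩ := Nat.exists_eq_succ_of_ne_zero hn
  rw [Nat.succ_eq_add_one, circDeriv_succ, circDeriv_succ m f]
  congr 1
  funext θ
  simp only [circDeriv, iteratedDeriv_one]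
  exact deriv_const_add _

end Calculus

theorem exists_norm_le_of_continuous {E : Type*} [NormedAddCommGroup E] {f : Circ → E}
    (hf : Continuous f) :
    ∃ C, 0 ≤ C ∧ ∀ θ, ‖f θ‖ ≤ C := by
  obtain ⟨C, hC⟩ := (isCompact_univ (X := Circ)).exists_bound_of_continuousOn hf.continuousOn
  exact ⟨max C 0, le_max_right _ _, fun θ => (hC θ (mem_univ _)).trans (le_max_left _ _)⟩

/-! ### Fourier coefficients and absolutely convergent Fourier series -/

theorem haarAddCircle_eq_volume :
    (AddCircle.haarAddCircle : Measure Circ) = volume := by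
  rw [AddCircle.volume_eq_smul_haarAddCircle]; simp

theorem fourierCoeff_eq_integral (f : Circ → ℂ) (n : ℤ) :
    fourierCoeff f n = ∫ θ : Circ, fourier (-n) θ * f θ := by
  rw [fourierCoeff, haarAddCircle_eq_volume]; rfl

theorem norm_fourierCoeff_le_integral (f : Circ → ℂ) (n : ℤ) :
    ‖fourierCoeff f n‖ ≤ ∫ θ : Circ, ‖f θ‖ := by
  rw [fourierCoeff_eq_integral]
  refine (norm_integral_le_integral_norm _).trans_eq ?_
  congr 1; funext θ
  rw [norm_mul, fourier_apply, Circle.norm_coe, one_mul]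

theorem norm_fourierCoeff_le {f : Circ → ℂ} {C : ℝ} (h : ∀ θ, ‖f θ‖ ≤ C) (n : ℤ) :
    ‖fourierCoeff f n‖ ≤ C := by
  rw [fourierCoeff_eq_integral]
  refine (norm_integral_le_of_norm_le_const (C := C) (ae_of_all _ fun θ => ?_)).trans_eq ?_
  · rw [norm_mul, fourier_apply, Circle.norm_coe, one_mul]; exact h θ
  · rw [measureReal_def, UnitAddCircle.measure_univ]; simp

theorem fourierCoeff_circDeriv {f : Circ → ℂ} (hf : CircContDiff 1 f) (k : ℤ) :
    fourierCoeff (circDeriv 1 f) k = 2 * Real.pi * Complex.I * k * fourierCoeff f k := by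
  have hf' : Continuous (circDeriv 1 f) :=
    (CircContDiff.circDeriv_one (n := 0) (by simp [hf])).continuous
  rw [fourierCoeff_eq_intervalIntegral _ _ 0, fourierCoeff_eq_intervalIntegral _ _ 0]
  norm_num only [zero_add, one_div, inv_one, one_smul, smul_eq_mul]
  have hu : ∀ x ∈ uIcc (0 : ℝ) 1, HasDerivAt (fun y : ℝ => fourier (-k) (y : Circ))
      (2 * Real.pi * Complex.I * (-k : ℤ) / (1 : ℝ) * fourier (-k) (x : Circ)) x :=
    fun x _ => hasDerivAt_fourier 1 (-k) x
  have hv : ∀ x ∈ uIcc (0 : ℝ) 1, HasDerivAt (fun y : ℝ => f (y : Circ))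
      (circDeriv 1 f (x : Circ)) x := fun x _ => hf.hasDerivAt x
  have hc : Continuous fun y : ℝ => (fourier (-k) (y : Circ) : ℂ) :=
    (ContinuousMap.continuous _).comp (AddCircle.continuous_mk' 1)
  have := intervalIntegral.integral_mul_deriv_eq_deriv_mul hu hv
    ((continuous_const.mul hc).intervalIntegrable _ _)
    ((hf'.comp (AddCircle.continuous_mk' 1)).intervalIntegrable _ _)
  have e1 : (((1 : ℝ) : ℝ) : Circ) = ((0 : ℝ) : Circ) := by
    simp
  rw [this]
  simp only [e1, sub_self, zero_sub, mul_assoc]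
  rw [← intervalIntegral.integral_neg, ← intervalIntegral.integral_const_mul,
    ← intervalIntegral.integral_const_mul, ← intervalIntegral.integral_const_mul,
    ← intervalIntegral.integral_const_mul]
  congr 1; funext x; push_cast; ring

/-- Two derivatives give quadratic decay of the Fourier coefficients. -/
theorem norm_fourierCoeff_le_div_sq {f : Circ → ℂ} (hf : CircContDiff 2 f) {C : ℝ}
    (hC : ∀ θ, ‖circDeriv 2 f θ‖ ≤ C) (k : ℤ) (hk : k ≠ 0) :
    ‖fourierCoeff f k‖ ≤ C / (k : ℝ) ^ 2 := by
  have h1 : CircContDiff 1 (circDeriv 1 f) := hf.circDeriv_one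
  have h2 : fourierCoeff (circDeriv 2 f) k
      = (2 * Real.pi * Complex.I * k) * (2 * Real.pi * Complex.I * k * fourierCoeff f k) := by
    rw [circDeriv_succ, fourierCoeff_circDeriv h1,
      fourierCoeff_circDeriv (hf.of_le (by norm_num))]
  have h3 := norm_fourierCoeff_le hC k
  have hk2 : (0 : ℝ) < (k : ℝ) ^ 2 := by positivity
  rw [le_div_iff₀ hk2]
  refine le_trans ?_ h3
  rw [h2]
  simp only [norm_mul, Complex.norm_I, Complex.norm_intCast, Complex.norm_real, Complex.norm_ofNat,
    Real.norm_eq_abs, abs_of_pos Real.pi_pos]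
  have : (1 : ℝ) ≤ (2 * Real.pi) ^ 2 := by nlinarith [Real.pi_gt_three]
  rw [← sq_abs (k : ℝ)]
  nlinarith [mul_nonneg (norm_nonneg (fourierCoeff f k)) (sq_nonneg (|(k : ℝ)|))]

theorem circDeriv_continuous {E : Type*} [NormedAddCommGroup E] [NormedSpace ℝ E] {n : ℕ}
    {f : Circ → E} (hf : CircContDiff n f) : Continuous (circDeriv n f) := by
  induction n generalizing f with
  | zero => rw [circDeriv_zero]; exact hf.continuous
  | succ n ih => rw [circDeriv_succ]; exact ih hf.circDeriv_one

theorem injective_pnat_int : Function.Injective fun l : ℕ+ => (l : ℤ) := fun _ _ h =>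
  PNat.coe_injective (Int.ofNat_injective h)

theorem summable_inv_int_sq : Summable fun k : ℤ => 1 / (k : ℝ) ^ 2 :=
  Real.summable_one_div_int_pow.2 (by norm_num)

theorem CircContDiff.summable_norm_fourierCoeff {f : Circ → ℂ} (hf : CircContDiff 2 f) :
    Summable fun k => ‖fourierCoeff f k‖ := by
  obtain ⟨C, -, hC⟩ := exists_norm_le_of_continuous (circDeriv_continuous (n := 2) hf)
  have hs : Summable fun k : ℤ => C / (k : ℝ) ^ 2 := by
    simpa [div_eq_mul_inv] using summable_inv_int_sq.mul_left C
  refine Summable.of_norm_bounded_eventually hs ?_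
  rw [Filter.eventually_cofinite]
  refine (Set.finite_singleton (0 : ℤ)).subset fun k hk => ?_
  by_contra h0
  exact hk (by simpa using norm_fourierCoeff_le_div_sq hf hC k h0)

theorem hasSum_fourier_of_summable {f : Circ → ℂ} (hf : Continuous f)
    (hs : Summable fun k => ‖fourierCoeff f k‖) (θ : Circ) :
    HasSum (fun k => fourierCoeff f k * fourier k θ) (f θ) :=
  has_pointwise_sum_fourier_series_of_summable (f := ⟨f, hf⟩) hs.of_norm θ

/-- The Fourier coefficients of a product, one factor of which is an absolutely convergent
trigonometric series. -/
theorem fourierCoeff_mul_of_hasSum {g h : Circ → ℂ} (hg : Integrable g) {a : ℤ → ℂ}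
    (ha : Summable fun k => ‖a k‖) (hh : ∀ θ, HasSum (fun k => a k * fourier k θ) (h θ)) (k : ℤ) :
    HasSum (fun l => a l * fourierCoeff g (k - l)) (fourierCoeff (fun θ => h θ * g θ) k) := by
  have hm : ∀ l : ℤ, Integrable fun θ : Circ => fourier (-(k - l)) θ * g θ := fun l => by
    refine hg.bdd_mul (c := 1) (ContinuousMap.continuous _).aestronglyMeasurable
      (ae_of_all _ fun θ => ?_)
    rw [fourier_apply, Circle.norm_coe]
  have hn : ∀ l : ℤ, ∀ θ : Circ, ‖a l * (fourier (-(k - l)) θ * g θ)‖ = ‖a l‖ * ‖g θ‖ := by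
    intro l θ
    rw [norm_mul, norm_mul, fourier_apply, Circle.norm_coe, one_mul]
  have key := hasSum_integral_of_summable_integral_norm
    (F := fun (l : ℤ) (θ : Circ) => a l * (fourier (-(k - l)) θ * g θ)) (μ := volume)
    (fun l => (hm l).const_mul _) (by
      simp only [hn, integral_const_mul]
      exact ha.mul_right _)
  have e : (fun l : ℤ => ∫ θ : Circ, a l * (fourier (-(k - l)) θ * g θ))
      = fun l => a l * fourierCoeff g (k - l) := by
    funext l
    rw [integral_const_mul, fourierCoeff_eq_integral]
  rw [e] at key
  suffices h0 : fourierCoeff (fun θ => h θ * g θ) k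
      = ∫ θ : Circ, ∑' l : ℤ, a l * (fourier (-(k - l)) θ * g θ) by rw [h0]; exact key
  rw [fourierCoeff_eq_integral]
  congr 1; funext θ
  have h1 := ((hh θ).mul_right (g θ)).mul_left (fourier (-k) θ : ℂ)
  rw [← h1.tsum_eq]
  congr 1; funext l
  have : (-(k - l) : ℤ) = -k + l := by ring
  rw [this, fourier_add]; ring

/-- The Fourier coefficients of an absolutely convergent trigonometric series. -/
theorem fourierCoeff_of_hasSum {h : Circ → ℂ} {a : ℤ → ℂ} (ha : Summable fun k => ‖a k‖)
    (hh : ∀ θ, HasSum (fun k => a k * fourier k θ) (h θ)) (k : ℤ) : fourierCoeff h k = a k := by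
  have h1 := fourierCoeff_mul_of_hasSum (g := fun _ => 1) (integrable_const _) ha hh k
  have h2 : ∀ n : ℤ, fourierCoeff (fun _ : Circ => (1 : ℂ)) n = if n = 0 then 1 else 0 := by
    intro n
    have : (fun _ : Circ => (1 : ℂ)) = fourier 0 := by funext θ; simp
    rw [this, fourierCoeff_fourier, Pi.single_apply]
  simp only [mul_one] at h1
  refine h1.unique ?_
  have h3 := hasSum_ite_eq k (a k)
  convert h3 using 1
  funext l
  rw [h2]
  by_cases hl : l = k
  · simp [hl]
  · have : k - l ≠ 0 := fun h => hl (by linarith)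
    simp [hl, this]

/-! ### Convolution with an integrable kernel -/

section Convolution

variable {𝕜 : Type*} [RCLike 𝕜] {V : Circ → ℝ}

theorem conv_eq_integral_comm (V : Circ → ℝ) (f : Circ → 𝕜) (θ : Circ) :
    conv V f θ = ∫ ψ : Circ, V ψ • f (θ - ψ) := by
  rw [conv, ← integral_sub_left_eq_self _ volume θ]
  congr 1; funext ψ; simp

theorem norm_conv_le (hV : Integrable V) {f : Circ → 𝕜} {C : ℝ} (hC : ∀ θ, ‖f θ‖ ≤ C)
    (θ : Circ) : ‖conv V f θ‖ ≤ (∫ ψ : Circ, |V ψ|) * C := by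
  rw [conv_eq_integral_comm, ← integral_mul_const]
  refine norm_integral_le_of_norm_le (hV.abs.mul_const C) (ae_of_all _ fun ψ => ?_)
  rw [norm_smul]
  exact mul_le_mul_of_nonneg_left (hC _) (abs_nonneg _)

theorem integrable_smul_comp_sub (hV : Integrable V) {f : Circ → 𝕜} (hf : Continuous f)
    (θ : Circ) : Integrable fun ψ : Circ => V ψ • f (θ - ψ) := by
  obtain ⟨C, -, hC⟩ := exists_norm_le_of_continuous hf
  exact hV.smul_bdd C (f := fun ψ => f (θ - ψ)) (Continuous.aestronglyMeasurable (by fun_prop))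
    (ae_of_all _ fun ψ => hC _)

theorem continuous_conv (hV : Integrable V) {f : Circ → 𝕜} (hf : Continuous f) :
    Continuous (conv V f) := by
  obtain ⟨C, -, hC⟩ := exists_norm_le_of_continuous hf
  have : conv V f = fun θ => ∫ ψ : Circ, V ψ • f (θ - ψ) := by
    funext θ; exact conv_eq_integral_comm V f θ
  rw [this]
  refine continuous_of_dominated (bound := fun ψ => |V ψ| * C)
    (fun θ => (integrable_smul_comp_sub hV hf θ).aestronglyMeasurable)
    (fun θ => ae_of_all _ fun ψ => ?_) (hV.abs.mul_const C) (ae_of_all _ fun ψ => by fun_prop)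
  rw [norm_smul]
  exact mul_le_mul_of_nonneg_left (hC _) (abs_nonneg _)

theorem hasDerivAt_conv (hV : Integrable V) {f : Circ → 𝕜} (hf : CircContDiff 1 f) (y : ℝ) :
    HasDerivAt (fun x : ℝ => conv V f (x : Circ)) (conv V (circDeriv 1 f) (y : Circ)) y := by
  have hf' : Continuous (circDeriv 1 f) := circDeriv_continuous (n := 1) hf
  obtain ⟨C, -, hC⟩ := exists_norm_le_of_continuous hf'
  simp only [conv_eq_integral_comm]
  refine (hasDerivAt_integral_of_dominated_loc_of_deriv_le (s := univ)
    (F := fun (x : ℝ) (ψ : Circ) => V ψ • f ((x : Circ) - ψ))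
    (F' := fun (x : ℝ) (ψ : Circ) => V ψ • circDeriv 1 f ((x : Circ) - ψ))
    (bound := fun ψ => |V ψ| * C) univ_mem
    (Eventually.of_forall fun x =>
      (integrable_smul_comp_sub hV hf.continuous x).aestronglyMeasurable)
    (integrable_smul_comp_sub hV hf.continuous y)
    (integrable_smul_comp_sub hV hf' y).aestronglyMeasurable
    (ae_of_all _ fun ψ x _ => ?_) (hV.abs.mul_const C) (ae_of_all _ fun ψ x _ => ?_)).2
  · rw [norm_smul]
    exact mul_le_mul_of_nonneg_left (hC _) (abs_nonneg _)
  · induction ψ using QuotientAddGroup.induction_on with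
    | H z =>
      have h1 := (hf.hasDerivAt (x - z)).comp_sub_const x z
      exact h1.const_smul (V (z : Circ))

theorem circContDiff_conv (hV : Integrable V) {f : Circ → 𝕜} (hf : CircContDiff 1 f) :
    CircContDiff 1 (conv V f) ∧ circDeriv 1 (conv V f) = conv V (circDeriv 1 f) :=
  circContDiff_one_of_hasDerivAt (continuous_conv hV (circDeriv_continuous (n := 1) hf))
    (hasDerivAt_conv hV hf)

theorem CircContDiff.mul_circDeriv {f g : Circ → 𝕜} (hf : CircContDiff 1 f)
    (hg : CircContDiff 1 g) : CircContDiff 1 (fun θ => f θ * g θ) ∧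
      circDeriv 1 (fun θ => f θ * g θ)
        = fun θ => circDeriv 1 f θ * g θ + f θ * circDeriv 1 g θ := by
  refine circContDiff_one_of_hasDerivAt ?_ fun y => (hf.hasDerivAt y).mul (hg.hasDerivAt y)
  have h1 := circDeriv_continuous (n := 1) hf
  have h2 := circDeriv_continuous (n := 1) hg
  have h3 := hf.continuous
  have h4 := hg.continuous
  fun_prop

end Convolution

/-! ### Fourier coefficients of the odd kernel and of the right-hand side -/

theorem sineCoeff_neg (V : Circ → ℝ) (k : ℤ) : sineCoeff V (-k) = -sineCoeff V k := by
  rw [sineCoeff, sineCoeff, ← intervalIntegral.integral_neg]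
  congr 1; funext x
  rw [show 2 * Real.pi * ((-k : ℤ) : ℝ) * x = -(2 * Real.pi * k * x) by push_cast; ring,
    Real.sin_neg]
  ring

theorem sineCoeff_zero (V : Circ → ℝ) : sineCoeff V 0 = 0 := by
  simp [sineCoeff]

theorem fourier_apply_sub (n : ℤ) (x y : Circ) :
    (fourier n (x - y) : ℂ) = fourier n x * fourier (-n) y := by
  simp only [fourier_apply, sub_eq_add_neg, smul_add, smul_neg, neg_smul, AddCircle.toCircle_add,
    Circle.coe_mul]

section Real

/-- The inclusion of real-valued functions on the circle into complex-valued ones. -/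
def toC (f : Circ → ℝ) (θ : Circ) : ℂ := (f θ : ℂ)

theorem circContDiff_toC {n : ℕ∞} {f : Circ → ℝ} (hf : CircContDiff n f) :
    CircContDiff n (toC f) :=
  Complex.ofRealCLM.contDiff.comp hf

theorem circDeriv_one_toC {f : Circ → ℝ} (hf : CircContDiff 1 f) :
    circDeriv 1 (toC f) = toC (circDeriv 1 f) := by
  refine (circContDiff_one_of_hasDerivAt ?_ fun y => ?_).2
  · exact Complex.continuous_ofReal.comp (circDeriv_continuous (n := 1) hf)
  · exact (hf.hasDerivAt y).ofReal_comp

theorem circDeriv_toC {n : ℕ} {f : Circ → ℝ} (hf : CircContDiff n f) :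
    circDeriv n (toC f) = toC (circDeriv n f) := by
  induction n generalizing f with
  | zero => simp [circDeriv_zero]
  | succ n ih =>
    rw [circDeriv_succ, circDeriv_succ n f, circDeriv_one_toC (hf.of_le (by simp)),
      ih hf.circDeriv_one]

theorem conv_toC (V f : Circ → ℝ) : conv V (toC f) = toC (conv V f) := by
  funext θ
  rw [toC, conv, conv, ← integral_complex_ofReal]
  congr 1; funext ψ
  simp [toC]

theorem fourierCoeff_toC_neg (f : Circ → ℝ) (k : ℤ) :
    fourierCoeff (toC f) (-k) = (starRingEnd ℂ) (fourierCoeff (toC f) k) := by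
  rw [fourierCoeff_eq_integral, fourierCoeff_eq_integral, ← integral_conj]
  congr 1; funext θ
  rw [map_mul, fourier_neg, fourier_neg, Complex.conj_conj, toC, Complex.conj_ofReal]

theorem integrable_toC {f : Circ → ℝ} (hf : Integrable f) : Integrable (toC f) :=
  hf.ofReal

end Real

section Coefficients

variable {V : Circ → ℝ}

/-- For an odd function, the Fourier coefficients are given by the half-period sine integrals. -/
theorem fourierCoeff_toC_of_odd (hV : Integrable V) (hodd : ∀ θ : Circ, V (-θ) = -V θ) (k : ℤ) :
    fourierCoeff (toC V) k = -2 * Complex.I * sineCoeff V k := by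
  have hi : Integrable fun θ : Circ => (fourier (-k) θ : ℂ) * toC V θ := by
    refine (integrable_toC hV).bdd_mul (c := 1) (ContinuousMap.continuous _).aestronglyMeasurable
      (ae_of_all _ fun θ => ?_)
    rw [fourier_apply, Circle.norm_coe]
  have hper : Function.Periodic (fun x : ℝ => (fourier (-k) (x : Circ) : ℂ) * toC V (x : Circ))
      1 := by
    intro x; simp
  have hint : ∀ a b : ℝ, IntervalIntegrable
      (fun x : ℝ => (fourier (-k) (x : Circ) : ℂ) * toC V (x : Circ)) volume a b := by
    intro a b
    refine hper.intervalIntegrable (t := 0) one_ne_zero ?_ a b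
    rw [intervalIntegrable_iff_integrableOn_Ioc_of_le (by norm_num)]
    exact (UnitAddCircle.measurePreserving_mk 0).integrable_comp_of_integrable hi
  rw [fourierCoeff_eq_intervalIntegral _ _ (-(1 / 2))]
  norm_num only [one_div, inv_one, one_smul, smul_eq_mul]
  rw [← intervalIntegral.integral_add_adjacent_intervals (hint _ 0) (hint _ _)]
  have h1 : ∫ x in (-(1 / 2) : ℝ)..0, (fourier (-k) (x : Circ) : ℂ) * toC V (x : Circ)
      = ∫ x in (0 : ℝ)..(1 / 2),
        (fourier (-k) ((-x : ℝ) : Circ) : ℂ) * toC V ((-x : ℝ) : Circ) := by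
    rw [intervalIntegral.integral_comp_neg
      (fun x : ℝ => (fourier (-k) (x : Circ) : ℂ) * toC V (x : Circ))]
    norm_num
  have h2 : IntervalIntegrable (fun x : ℝ => (fourier (-k) ((-x : ℝ) : Circ) : ℂ) *
      toC V ((-x : ℝ) : Circ)) volume 0 (1 / 2) := by
    have := (hint 0 (-(1 / 2)))
    simpa only [neg_zero, neg_neg] using (IntervalIntegrable.iff_comp_neg enorm_ne_top).1 this
  rw [h1, ← intervalIntegral.integral_add h2 (hint _ _), sineCoeff,
    ← intervalIntegral.integral_ofReal, ← intervalIntegral.integral_const_mul]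
  congr 1; funext x
  have e : toC V ((-x : ℝ) : Circ) = - toC V (x : Circ) := by
    have := hodd (x : Circ)
    simp only [toC, AddCircle.coe_neg, this, Complex.ofReal_neg]
  have f1 : ∀ y : ℝ, (fourier (-k) ((y : ℝ) : Circ) : ℂ)
      = Complex.cos (2 * Real.pi * k * y) - Complex.I * Complex.sin (2 * Real.pi * k * y) := by
    intro y
    rw [fourier_coe_apply]
    have : 2 * (Real.pi : ℂ) * Complex.I * ((-k : ℤ) : ℂ) * (y : ℂ) / ((1 : ℝ) : ℂ)
        = -(2 * Real.pi * k * y) * Complex.I := by push_cast; ring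
    rw [this, Complex.exp_mul_I, Complex.cos_neg, Complex.sin_neg]; ring
  rw [e, f1, f1]
  simp only [toC]
  push_cast
  rw [show 2 * (Real.pi : ℂ) * k * -x = -(2 * Real.pi * k * x) by ring, Complex.cos_neg,
    Complex.sin_neg]
  ring

theorem conv_const {𝕜 : Type*} [RCLike 𝕜] (hodd : ∀ θ : Circ, V (-θ) = -V θ) (c : 𝕜)
    (θ : Circ) : conv V (fun _ => c) θ = 0 := by
  have h0 : ∫ ψ : Circ, V ψ = 0 := by
    have h1 := integral_neg_eq_self V volume
    simp only [hodd, integral_neg] at h1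
    linarith
  rw [conv_eq_integral_comm, integral_smul_const, h0, zero_smul]

/-- Convolution acts diagonally on absolutely convergent trigonometric series. -/
theorem hasSum_conv (hV : Integrable V) {h : Circ → ℂ} {a : ℤ → ℂ} (ha : Summable fun k => ‖a k‖)
    (hh : ∀ θ, HasSum (fun k => a k * fourier k θ) (h θ)) (θ : Circ) :
    HasSum (fun k => fourierCoeff (toC V) k * a k * fourier k θ) (conv V h θ) := by
  have h1 := fourierCoeff_mul_of_hasSum (g := toC V) (integrable_toC hV)
    (a := fun m => a (-m) * fourier (-m) θ) (h := fun ψ => h (θ - ψ)) (by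
      simp only [norm_mul, fourier_apply, Circle.norm_coe, mul_one]
      exact (Equiv.neg ℤ).summable_iff.2 ha) (fun ψ =>
        ((Equiv.neg ℤ).hasSum_iff.2 (hh (θ - ψ))).congr_fun fun l => by
          simp only [Function.comp_apply, Equiv.neg_apply, fourier_apply_sub, mul_assoc, neg_neg]) 0
  have h2 : fourierCoeff (fun ψ => h (θ - ψ) * toC V ψ) 0 = conv V h θ := by
    rw [conv_eq_integral_comm, fourierCoeff_eq_integral]
    congr 1; funext ψ
    simp [toC, mul_comm]
  rw [h2] at h1
  refine ((Equiv.neg ℤ).hasSum_iff.2 h1).congr_fun fun l => ?_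
  simp only [Function.comp_apply, Equiv.neg_apply, neg_neg, zero_sub]
  ring

/-- The Fourier coefficients of a convolution. -/
theorem fourierCoeff_conv (hV : Integrable V) {h : Circ → ℂ} (hh : CircContDiff 2 h) (k : ℤ) :
    fourierCoeff (conv V h) k = fourierCoeff (toC V) k * fourierCoeff h k := by
  have hs := hh.summable_norm_fourierCoeff
  refine fourierCoeff_of_hasSum ?_
    (hasSum_conv hV hs (hasSum_fourier_of_summable hh.continuous hs)) k
  have hb := norm_fourierCoeff_le_integral (toC V)
  refine Summable.of_nonneg_of_le (fun _ => norm_nonneg _) (fun k => ?_)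
    (hs.mul_left (∫ θ : Circ, ‖toC V θ‖))
  rw [norm_mul]
  exact mul_le_mul_of_nonneg_right (hb k) (norm_nonneg _)

/-- The Fourier coefficients of the right-hand side of the equation. -/
theorem fourierCoeff_rhs {D : ℝ} (hV : Integrable V) (hodd : ∀ θ : Circ, V (-θ) = -V θ)
    {h : Circ → ℂ} (hh : CircContDiff 2 h) (k : ℤ) :
    fourierCoeff (rhs V D h) k = -(4 * Real.pi ^ 2 * D * k ^ 2 : ℝ) * fourierCoeff h k
      + 4 * Real.pi * k *
        ∑' l : ℤ, sineCoeff V l * fourierCoeff h l * fourierCoeff h (k - l) := by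
  have h1 : CircContDiff 1 h := hh.of_le (by norm_num)
  have h1' : CircContDiff 1 (circDeriv 1 h) := hh.circDeriv_one
  have hp := (circContDiff_conv hV h1).1.mul_circDeriv h1
  have hs := hh.summable_norm_fourierCoeff
  have hc2 : Integrable (circDeriv 2 h) (AddCircle.haarAddCircle (T := 1)) :=
    (circDeriv_continuous (n := 2) hh).integrable_of_hasCompactSupport
      (HasCompactSupport.of_compactSpace _)
  have hcp : Integrable (circDeriv 1 fun ψ => conv V h ψ * h ψ)
      (AddCircle.haarAddCircle (T := 1)) :=
    (circDeriv_continuous (n := 1) hp.1).integrable_of_hasCompactSupport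
      (HasCompactSupport.of_compactSpace _)
  have e : rhs V D h = ((D : ℂ) • circDeriv 2 h) + circDeriv 1 fun ψ => conv V h ψ * h ψ := by
    funext θ; simp [rhs]
  have hprod : fourierCoeff (fun ψ => conv V h ψ * h ψ) k
      = -2 * Complex.I * ∑' l : ℤ, sineCoeff V l * fourierCoeff h l * fourierCoeff h (k - l) := by
    have hb := norm_fourierCoeff_le_integral (toC V)
    have hs2 : Summable fun l => ‖fourierCoeff (toC V) l * fourierCoeff h l‖ := by
      refine Summable.of_nonneg_of_le (fun _ => norm_nonneg _) (fun k => ?_)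
        (hs.mul_left (∫ θ : Circ, ‖toC V θ‖))
      rw [norm_mul]
      exact mul_le_mul_of_nonneg_right (hb k) (norm_nonneg _)
    have := fourierCoeff_mul_of_hasSum (g := h)
      (hh.continuous.integrable_of_hasCompactSupport (HasCompactSupport.of_compactSpace _)) hs2
      (hasSum_conv hV hs (hasSum_fourier_of_summable hh.continuous hs)) k
    rw [← this.tsum_eq, ← tsum_mul_left]
    congr 1; funext l
    rw [fourierCoeff_toC_of_odd hV hodd]; ring
  rw [e, fourierCoeff.add (hc2.smul (D : ℂ)) hcp, Pi.add_apply, fourierCoeff.const_smul,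
    fourierCoeff_circDeriv hp.1, circDeriv_succ, fourierCoeff_circDeriv h1',
    fourierCoeff_circDeriv h1, hprod]
  push_cast
  simp only [smul_eq_mul]
  linear_combination (4 * (Real.pi : ℂ) ^ 2 * D * k ^ 2 * fourierCoeff h k
    - 4 * Real.pi * k * ∑' l : ℤ, sineCoeff V l * fourierCoeff h l * fourierCoeff h (k - l))
    * Complex.I_sq

/-- The right-hand side commutes with the inclusion of real into complex functions, so that the
equation for the real solution can be tested against complex exponentials. -/
theorem rhs_toC {D : ℝ} (hV : Integrable V) {f : Circ → ℝ} (hf : CircContDiff 2 f) :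
    rhs V D (toC f) = toC (rhs V D f) := by
  have h1 : CircContDiff 1 f := hf.of_le (by norm_num)
  have hp := (circContDiff_conv hV h1).1.mul_circDeriv h1
  have e : (fun ψ => conv V (toC f) ψ * toC f ψ) = toC fun ψ => conv V f ψ * f ψ := by
    funext ψ
    rw [conv_toC]; simp [toC]
  funext θ
  rw [rhs, e, circDeriv_one_toC hp.1, circDeriv_toC (n := 2) hf]
  simp [rhs, toC]

theorem continuous_rhs {D : ℝ} (hV : Integrable V) {f : Circ → ℝ} (hf : CircContDiff 2 f) :
    Continuous (rhs V D f) := by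
  have h1 : CircContDiff 1 f := hf.of_le (by norm_num)
  have hp := (circContDiff_conv hV h1).1.mul_circDeriv h1
  exact ((circDeriv_continuous (n := 2) hf).const_smul D).add (circDeriv_continuous (n := 1) hp.1)

/-- A bound on the right-hand side in terms of bounds on `f`, `f'` and `f''`, which dominates the
time derivative when the Fourier integral is differentiated. -/
theorem abs_rhs_le {D : ℝ} (hV : Integrable V) {f : Circ → ℝ} (hf : CircContDiff 2 f)
    {B₀ B₁ B₂ : ℝ} (h0 : ∀ θ, |f θ| ≤ B₀) (h1 : ∀ θ, |circDeriv 1 f θ| ≤ B₁)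
    (h2 : ∀ θ, |circDeriv 2 f θ| ≤ B₂) (θ : Circ) :
    |rhs V D f θ| ≤ |D| * B₂ + 2 * ((∫ ψ : Circ, |V ψ|) * B₀ * B₁) := by
  have hf1 : CircContDiff 1 f := hf.of_le (by norm_num)
  have hc := circContDiff_conv hV hf1
  have hp := hc.1.mul_circDeriv hf1
  rw [rhs, hp.2, hc.2]
  have e0 := norm_conv_le (𝕜 := ℝ) hV h0 θ
  have e1 := norm_conv_le (𝕜 := ℝ) hV h1 θ
  rw [Real.norm_eq_abs] at e0 e1
  have hI : 0 ≤ ∫ ψ : Circ, |V ψ| := integral_nonneg fun _ => abs_nonneg _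
  have hB0 : 0 ≤ B₀ := (abs_nonneg _).trans (h0 0)
  have hB1 : 0 ≤ B₁ := (abs_nonneg _).trans (h1 0)
  have a1 : |conv V (circDeriv 1 f) θ * f θ| ≤ (∫ ψ : Circ, |V ψ|) * B₁ * B₀ := by
    rw [abs_mul]; exact mul_le_mul e1 (h0 θ) (abs_nonneg _) (by positivity)
  have a2 : |conv V f θ * circDeriv 1 f θ| ≤ (∫ ψ : Circ, |V ψ|) * B₀ * B₁ := by
    rw [abs_mul]; exact mul_le_mul e0 (h1 θ) (abs_nonneg _) (by positivity)
  have a3 : |D • circDeriv 2 f θ| ≤ |D| * B₂ := by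
    rw [smul_eq_mul, abs_mul]; exact mul_le_mul_of_nonneg_left (h2 θ) (abs_nonneg _)
  refine (abs_add_le _ _).trans ?_
  have := abs_add_le (conv V (circDeriv 1 f) θ * f θ) (conv V f θ * circDeriv 1 f θ)
  linarith

end Coefficients

/-! ### The evolution of the Fourier coefficients of a solution -/

section Solution

variable {V : Circ → ℝ} {D : ℝ} {f : ℝ → Circ → ℝ}

theorem IsSolution.exists_bound (hf : IsSolution V D f) {t₁ t₂ : ℝ} (h1 : 0 < t₁) :
    ∃ B, 0 ≤ B ∧ ∀ j ≤ 2, ∀ t ∈ Icc t₁ t₂, ∀ θ, |circDeriv j (f t) θ| ≤ B := by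
  have key : ∀ j ≤ 2, ∃ B, ∀ t ∈ Icc t₁ t₂, ∀ θ, |circDeriv j (f t) θ| ≤ B := by
    intro j hj
    have hK : IsCompact (Icc t₁ t₂ ×ˢ (univ : Set Circ)) := isCompact_Icc.prod isCompact_univ
    obtain ⟨B, hB⟩ := hK.exists_bound_of_continuousOn ((hf.continuousOn j hj).mono
      (prod_mono (fun t ht => h1.trans_le ht.1) Subset.rfl))
    exact ⟨B, fun t ht θ => hB (t, θ) ⟨ht, mem_univ _⟩⟩
  obtain ⟨B0, hB0⟩ := key 0 (by norm_num)
  obtain ⟨B1, hB1⟩ := key 1 (by norm_num)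
  obtain ⟨B2, hB2⟩ := key 2 (by norm_num)
  refine ⟨max 0 (max B0 (max B1 B2)), le_max_left _ _, fun j hj t ht θ => ?_⟩
  interval_cases j
  · exact (hB0 t ht θ).trans (by simp)
  · exact (hB1 t ht θ).trans (by simp)
  · exact (hB2 t ht θ).trans (by simp)

theorem IsSolution.exists_norm_fourierCoeff_le (hf : IsSolution V D f) {t₁ t₂ : ℝ}
    (h1 : 0 < t₁) : ∃ B, 0 ≤ B ∧ ∀ t ∈ Icc t₁ t₂, ∀ k : ℤ, k ≠ 0 →
      ‖fourierCoeff (toC (f t)) k‖ ≤ B / (k : ℝ) ^ 2 := by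
  obtain ⟨B, hB, h⟩ := hf.exists_bound (t₂ := t₂) h1
  refine ⟨B, hB, fun t ht k hk => ?_⟩
  have hc := hf.contDiff t (h1.trans_le ht.1)
  refine norm_fourierCoeff_le_div_sq (circContDiff_toC hc) (fun θ => ?_) k hk
  rw [circDeriv_toC (n := 2) hc, toC, Complex.norm_real]
  exact h 2 le_rfl t ht θ

/-- The evolution equation of the Fourier coefficients. -/
theorem IsSolution.hasDerivAt_fourierCoeff (hV : Integrable V)
    (hodd : ∀ θ : Circ, V (-θ) = -V θ) (hf : IsSolution V D f) {t : ℝ} (ht : 0 < t) (k : ℤ) :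
    HasDerivAt (fun s => fourierCoeff (toC (f s)) k)
      (-(4 * Real.pi ^ 2 * D * k ^ 2 : ℝ) * fourierCoeff (toC (f t)) k
        + 4 * Real.pi * k * ∑' l : ℤ, sineCoeff V l * fourierCoeff (toC (f t)) l
          * fourierCoeff (toC (f t)) (k - l)) t := by
  obtain ⟨B, hB, hbd⟩ := hf.exists_bound (t₁ := t / 2) (t₂ := 2 * t) (by positivity)
  have hpos : ∀ s ∈ Ioo (t / 2) (2 * t), 0 < s := fun s hs => (half_pos ht).trans hs.1
  rw [← fourierCoeff_rhs hV hodd (circContDiff_toC (hf.contDiff t ht)),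
    rhs_toC hV (hf.contDiff t ht)]
  simp only [fourierCoeff_eq_integral]
  have hfc : Continuous fun θ : Circ => (fourier (-k) θ : ℂ) := ContinuousMap.continuous _
  have hcont : ∀ s, 0 < s → Continuous fun θ : Circ => (fourier (-k) θ : ℂ) * toC (f s) θ :=
    fun s hs => hfc.mul (circContDiff_toC (hf.contDiff s hs)).continuous
  refine (hasDerivAt_integral_of_dominated_loc_of_deriv_le (s := Ioo (t / 2) (2 * t))
    (F := fun (s : ℝ) (θ : Circ) => fourier (-k) θ * toC (f s) θ)
    (F' := fun (s : ℝ) (θ : Circ) => fourier (-k) θ * toC (rhs V D (f s)) θ)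
    (bound := fun _ => |D| * B + 2 * ((∫ ψ : Circ, |V ψ|) * B * B))
    (Ioo_mem_nhds (by linarith) (by linarith)) ?_ ?_ ?_ ?_ (integrable_const _) ?_).2
  · filter_upwards [Ioi_mem_nhds ht] with s hs using (hcont s hs).aestronglyMeasurable
  · exact (hcont t ht).integrable_of_hasCompactSupport (HasCompactSupport.of_compactSpace _)
  · exact (hfc.mul (Complex.continuous_ofReal.comp
      (continuous_rhs hV (hf.contDiff t ht)))).aestronglyMeasurable
  · refine ae_of_all _ fun θ s hs => ?_
    rw [norm_mul, fourier_apply, Circle.norm_coe, one_mul, toC, Complex.norm_real]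
    have hs' : s ∈ Icc (t / 2) (2 * t) := Ioo_subset_Icc_self hs
    refine abs_rhs_le hV (hf.contDiff s (hpos s hs)) (fun θ => ?_) (fun θ => ?_) (fun θ => ?_) θ
    · simpa [circDeriv_zero] using hbd 0 (by norm_num) s hs' θ
    · exact hbd 1 (by norm_num) s hs' θ
    · exact hbd 2 (by norm_num) s hs' θ
  · exact ae_of_all _ fun θ s hs =>
      ((hf.equation s (hpos s hs) θ).ofReal_comp).const_mul _

/-- The Fourier coefficients approach their initial values uniformly in `k`. -/
theorem IsSolution.norm_fourierCoeff_sub_le (hf : IsSolution V D f) {t : ℝ} (ht : 0 < t)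
    (k : ℤ) : ‖fourierCoeff (toC (f t)) k - fourierCoeff (toC (f 0)) k‖
      ≤ ∫ θ : Circ, |f t θ - f 0 θ| := by
  have h1 : Integrable (f t) := (hf.contDiff t ht).continuous.integrable_of_hasCompactSupport
    (HasCompactSupport.of_compactSpace _)
  have h2 : Integrable (toC (f t)) (AddCircle.haarAddCircle (T := 1)) := by
    rw [haarAddCircle_eq_volume]; exact integrable_toC h1
  have h3 : Integrable (-toC (f 0)) (AddCircle.haarAddCircle (T := 1)) := by
    rw [haarAddCircle_eq_volume]; exact (integrable_toC hf.integrable_init).neg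
  have e : fourierCoeff (toC (f t)) k - fourierCoeff (toC (f 0)) k
      = fourierCoeff (toC (f t) + -toC (f 0)) k := by
    rw [fourierCoeff.add h2 h3, Pi.add_apply, sub_eq_add_neg, ← neg_one_smul ℂ (toC (f 0)),
      fourierCoeff.const_smul]
    simp
  rw [e]
  refine (norm_fourierCoeff_le_integral _ _).trans_eq ?_
  congr 1; funext θ
  simp only [Pi.add_apply, Pi.neg_apply, toC]
  rw [← sub_eq_add_neg, ← Complex.ofReal_sub, Complex.norm_real, Real.norm_eq_abs]

theorem IsSolution.tendsto_fourierCoeff (hf : IsSolution V D f) (k : ℤ) :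
    Tendsto (fun t => fourierCoeff (toC (f t)) k) (𝓝[>] 0) (𝓝 (fourierCoeff (toC (f 0)) k)) := by
  rw [tendsto_iff_norm_sub_tendsto_zero]
  refine squeeze_zero' (Eventually.of_forall fun _ => norm_nonneg _) ?_ hf.tendsto_init
  filter_upwards [self_mem_nhdsWithin] with t ht using hf.norm_fourierCoeff_sub_le ht k

theorem IsSolution.exists_norm_fourierCoeff_le_near_zero (hf : IsSolution V D f) :
    ∃ M, 0 ≤ M ∧ ∃ τ > 0, ∀ t ∈ Ioc 0 τ, ∀ k : ℤ, ‖fourierCoeff (toC (f t)) k‖ ≤ M := by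
  have h1 : ∀ᶠ t in 𝓝[>] (0 : ℝ), ∫ θ : Circ, |f t θ - f 0 θ| < 1 :=
    hf.tendsto_init.eventually_lt_const one_pos
  obtain ⟨τ, hτ, h⟩ := (mem_nhdsGT_iff_exists_Ioc_subset).1 h1
  refine ⟨(∫ θ : Circ, ‖toC (f 0) θ‖) + 1, add_nonneg (integral_nonneg fun _ => norm_nonneg _)
    zero_le_one, τ, hτ, fun t ht k => ?_⟩
  have a1 := hf.norm_fourierCoeff_sub_le ht.1 k
  have a2 : ∫ θ : Circ, |f t θ - f 0 θ| < 1 := h ht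
  have a3 := norm_fourierCoeff_le_integral (toC (f 0)) k
  have a4 := norm_add_le (fourierCoeff (toC (f t)) k - fourierCoeff (toC (f 0)) k)
    (fourierCoeff (toC (f 0)) k)
  rw [sub_add_cancel] at a4
  linarith

/-- Conservation of mass. -/
theorem IsSolution.fourierCoeff_zero (hV : Integrable V)
    (hodd : ∀ θ : Circ, V (-θ) = -V θ) (hf : IsSolution V D f) (hmass : ∫ θ : Circ, f 0 θ = 1)
    {t : ℝ} (ht : 0 ≤ t) : fourierCoeff (toC (f t)) 0 = 1 := by
  have h0 : fourierCoeff (toC (f 0)) 0 = 1 := by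
    rw [fourierCoeff_eq_integral]
    have : (fun θ : Circ => (fourier (-0) θ : ℂ) * toC (f 0) θ) = fun θ => ((f 0 θ : ℝ) : ℂ) := by
      funext θ; simp [toC]
    rw [this, integral_complex_ofReal, hmass, Complex.ofReal_one]
  rcases ht.eq_or_lt with rfl | ht
  · exact h0
  have hconst : ∀ s ∈ Ioi (0 : ℝ), fourierCoeff (toC (f s)) 0 = fourierCoeff (toC (f t)) 0 := by
    intro s hs
    refine isOpen_Ioi.is_const_of_deriv_eq_zero (f := fun s => fourierCoeff (toC (f s)) 0)
      isPreconnected_Ioi ?_ ?_ hs ht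
    · exact fun x hx =>
        (hf.hasDerivAt_fourierCoeff hV hodd hx 0).differentiableAt.differentiableWithinAt
    · intro x hx
      simpa using (hf.hasDerivAt_fourierCoeff hV hodd hx 0).deriv
  have h1 := hf.tendsto_fourierCoeff 0
  rw [h0] at h1
  refine tendsto_nhds_unique (tendsto_const_nhds.congr' ?_) h1
  filter_upwards [self_mem_nhdsWithin] with s hs using (hconst s hs).symm

end Solution

/-! ### The linearization at the constant solution -/

section Linear

variable {V : Circ → ℝ} {D : ℝ}

theorem integrable_of_continuous {E : Type*} [NormedAddCommGroup E] {f : Circ → E}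
    (hf : Continuous f) : Integrable f :=
  hf.integrable_of_hasCompactSupport (HasCompactSupport.of_compactSpace _)

theorem circDeriv_const {E : Type*} [NormedAddCommGroup E] [NormedSpace ℝ E] {n : ℕ} (hn : n ≠ 0)
    (c : E) : circDeriv n (fun _ : Circ => c) = 0 := by
  funext θ
  simp [circDeriv, iteratedDeriv_const, hn]

theorem circDeriv_const_mul (n : ℕ) (s : ℂ) (f : Circ → ℂ) :
    circDeriv n (fun θ => s * f θ) = fun θ => s * circDeriv n f θ := by
  funext θ
  exact iteratedDeriv_const_mul_field _ _

theorem isStationarySolution_one (hodd : ∀ θ : Circ, V (-θ) = -V θ) :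
    IsStationarySolution V D fun _ => 1 where
  integrable_init := integrable_const _
  tendsto_init := by simp
  contDiff _ _ := contDiff_const
  continuousOn j _ := by
    rcases eq_or_ne j 0 with rfl | hj
    · simp only [circDeriv_zero]; exact continuousOn_const
    · simp only [circDeriv_const hj]; exact continuousOn_const
  equation t _ θ := by
    have : rhs V D (fun _ => (1 : ℝ)) θ = 0 := by
      simp only [rhs, conv_const hodd, zero_mul, circDeriv_const two_ne_zero,
        circDeriv_const one_ne_zero, Pi.zero_apply, smul_zero, add_zero]
    rw [this]
    exact hasDerivAt_const _ _

theorem linearizedRhs_one (hodd : ∀ θ : Circ, V (-θ) = -V θ) (h : Circ → ℂ) :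
    linearizedRhs V D (fun _ => 1) h = fun θ => D * circDeriv 2 h θ + circDeriv 1 (conv V h) θ := by
  funext θ
  simp only [linearizedRhs, conv_const hodd, zero_mul, zero_add, mul_one, Complex.real_smul]

theorem conv_const_add_mul (hV : Integrable V) (hodd : ∀ θ : Circ, V (-θ) = -V θ) {h : Circ → ℂ}
    (hh : Continuous h) (c s : ℂ) (θ : Circ) :
    conv V (fun ψ => c + s * h ψ) θ = s * conv V h θ := by
  have e := conv_const hodd c θ
  rw [conv_eq_integral_comm] at e
  rw [conv_eq_integral_comm, conv_eq_integral_comm, ← integral_const_mul]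
  simp only [smul_add]
  rw [integral_add (hV.smul_const c)
    (integrable_smul_comp_sub hV (f := fun ψ => s * h ψ) (by fun_prop) θ), e, zero_add]
  congr 1; funext ψ
  simp only [Complex.real_smul]; ring

/-- The right-hand side at `1 + s h` is a quadratic polynomial in `s` without constant term, whose
linear coefficient is the linearization. -/
theorem hasDerivAt_rhs_one_add_mul (hV : Integrable V) (hodd : ∀ θ : Circ, V (-θ) = -V θ)
    {h : Circ → ℂ} (hh : CircContDiff 2 h) (θ : Circ) :
    HasDerivAt (fun s : ℂ => rhs V D (fun ψ => 1 + s * h ψ) θ)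
      (linearizedRhs V D (fun _ => 1) h θ) 0 := by
  have h1 : CircContDiff 1 h := hh.of_le (by norm_num)
  have hc := (circContDiff_conv hV h1).1
  have hp := hc.mul_circDeriv h1
  have key : ∀ s : ℂ, rhs V D (fun ψ => 1 + s * h ψ) θ
      = s * (D * circDeriv 2 h θ + circDeriv 1 (conv V h) θ)
        + s ^ 2 * circDeriv 1 (fun ψ => conv V h ψ * h ψ) θ := by
    intro s
    have e2 : circDeriv 1 (fun ψ => conv V (fun ψ => 1 + s * h ψ) ψ * (1 + s * h ψ))
        = fun ψ => s * circDeriv 1 (conv V h) ψ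
          + s ^ 2 * circDeriv 1 (fun ψ => conv V h ψ * h ψ) ψ := by
      refine (circContDiff_one_of_hasDerivAt ?_ fun y => ?_).2
      · have c1 := circDeriv_continuous (n := 1) hc
        have c2 := circDeriv_continuous (n := 1) hp.1
        fun_prop
      · have d1 := ((hc.hasDerivAt y).const_mul s).add ((hp.1.hasDerivAt y).const_mul (s ^ 2))
        refine d1.congr_of_eventuallyEq (Eventually.of_forall fun x => ?_)
        simp only [conv_const_add_mul hV hodd h1.continuous, Pi.add_apply]
        ring
    rw [rhs, e2, circDeriv_const_add 2 two_ne_zero 1 fun ψ => s * h ψ, circDeriv_const_mul]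
    simp only [Complex.real_smul]
    ring
  simp only [key, linearizedRhs_one hodd]
  have d1 := ((hasDerivAt_id (0 : ℂ)).mul_const (D * circDeriv 2 h θ + circDeriv 1 (conv V h) θ))
  have d2 := ((hasDerivAt_id (0 : ℂ)).pow 2).mul_const (circDeriv 1 (fun ψ => conv V h ψ * h ψ) θ)
  exact (d1.add d2).congr_deriv (by simp)

theorem eq_of_fourierCoeff_eq {f g : Circ → ℂ} (hf : Continuous f) (hg : Continuous g)
    (h : ∀ k, fourierCoeff f k = fourierCoeff g k) : f = g := by
  have h0 : ∀ k, fourierCoeff (fun θ => f θ - g θ) k = 0 := by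
    intro k
    have := fourierCoeff.add (T := 1) (f := f) (g := (-1 : ℂ) • g)
      (by rw [haarAddCircle_eq_volume]; exact integrable_of_continuous hf)
      (by rw [haarAddCircle_eq_volume]; exact integrable_of_continuous (hg.const_smul _))
    have e : (fun θ => f θ - g θ) = f + (-1 : ℂ) • g := by
      funext θ; simp [sub_eq_add_neg]
    rw [e, this, Pi.add_apply, fourierCoeff.const_smul, h k]
    simp
  funext θ
  have hz : Summable fun k => ‖fourierCoeff (fun θ => f θ - g θ) k‖ := by
    simp only [h0, norm_zero]; exact summable_zero
  have h1 := hasSum_fourier_of_summable (f := fun θ => f θ - g θ) (hf.sub hg) hz θ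
  simp only [h0, zero_mul] at h1
  exact sub_eq_zero.1 (h1.unique hasSum_zero)

/-- The linearization at `1` is diagonal in the Fourier basis. -/
theorem fourierCoeff_linearizedRhs_one (hV : Integrable V) (hodd : ∀ θ : Circ, V (-θ) = -V θ)
    {h : Circ → ℂ} (hh : CircContDiff 2 h) (k : ℤ) :
    fourierCoeff (linearizedRhs V D (fun _ => 1) h) k = eigenval V D k * fourierCoeff h k := by
  have h1 : CircContDiff 1 h := hh.of_le (by norm_num)
  have h1' : CircContDiff 1 (circDeriv 1 h) := hh.circDeriv_one
  have hc := (circContDiff_conv hV h1).1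
  have e : linearizedRhs V D (fun _ => 1) h
      = (D : ℂ) • circDeriv 2 h + circDeriv 1 (conv V h) := by
    rw [linearizedRhs_one hodd]; rfl
  have i1 : Integrable ((D : ℂ) • circDeriv 2 h) (AddCircle.haarAddCircle (T := 1)) := by
    rw [haarAddCircle_eq_volume]
    exact integrable_of_continuous ((circDeriv_continuous (n := 2) hh).const_smul _)
  have i2 : Integrable (circDeriv 1 (conv V h)) (AddCircle.haarAddCircle (T := 1)) := by
    rw [haarAddCircle_eq_volume]
    exact integrable_of_continuous (circDeriv_continuous (n := 1) hc)
  rw [e, fourierCoeff.add i1 i2, Pi.add_apply, fourierCoeff.const_smul, circDeriv_succ,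
    fourierCoeff_circDeriv h1', fourierCoeff_circDeriv h1, fourierCoeff_circDeriv hc,
    fourierCoeff_conv hV hh, fourierCoeff_toC_of_odd hV hodd, eigenval]
  push_cast
  simp only [smul_eq_mul]
  linear_combination (4 * (Real.pi : ℂ) ^ 2 * D * k ^ 2 - 4 * Real.pi * k * sineCoeff V k)
    * fourierCoeff h k * Complex.I_sq

theorem circContDiff_fourier (n : ℕ∞) (k : ℤ) : CircContDiff n fun θ => (fourier k θ : ℂ) := by
  unfold CircContDiff
  simp only [fourier_coe_apply]
  have : ContDiff ℝ n fun x : ℝ => (x : ℂ) := Complex.ofRealCLM.contDiff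
  exact ((contDiff_const.mul this).div_const _).cexp

theorem eigenvalues_linearizedRhs_one (hV : Integrable V) (hodd : ∀ θ : Circ, V (-θ) = -V θ)
    (μ : ℂ) :
    (∃ h : Circ → ℂ, CircContDiff 2 h ∧ h ≠ 0 ∧
      ∀ θ : Circ, linearizedRhs V D (fun _ => 1) h θ = μ * h θ) ↔
    ∃ k : ℤ, μ = (eigenval V D k : ℂ) := by
  constructor
  · rintro ⟨h, hh, h0, heq⟩
    obtain ⟨k, hk⟩ : ∃ k, fourierCoeff h k ≠ 0 := by
      by_contra! hall
      refine h0 (eq_of_fourierCoeff_eq hh.continuous continuous_const fun k => ?_)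
      rw [hall k]; simp [fourierCoeff]
    refine ⟨k, ?_⟩
    have e1 := fourierCoeff_linearizedRhs_one (D := D) hV hodd hh k
    rw [show linearizedRhs V D (fun _ => 1) h = fun θ => μ * h θ from funext heq,
      fourierCoeff.const_mul] at e1
    exact mul_right_cancel₀ hk e1
  · rintro ⟨k, rfl⟩
    have hc := circContDiff_fourier 2 k
    refine ⟨fun θ => fourier k θ, hc, fun h => ?_, fun θ => ?_⟩
    · have := congrFun h 0
      simp at this
    · have h1 : CircContDiff 1 (fun θ => (fourier k θ : ℂ)) := circContDiff_fourier 1 k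
      refine congrFun (eq_of_fourierCoeff_eq (g := fun θ => (eigenval V D k : ℂ) * fourier k θ)
        ?_ (hc.continuous.const_mul _) fun j => ?_) θ
      · rw [linearizedRhs_one hodd]
        have c1 := circDeriv_continuous (n := 2) hc
        have c2 := circDeriv_continuous (n := 1) (circContDiff_conv hV h1).1
        fun_prop
      · rw [fourierCoeff_linearizedRhs_one hV hodd hc, fourierCoeff.const_mul]
        rw [show (fun θ => (fourier k θ : ℂ)) = fourier k from rfl, fourierCoeff_fourier]
        rcases eq_or_ne j k with rfl | hjk
        · rfl
        · simp [hjk]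

end Linear

/-! ### Piecewise regular kernels -/

section Regularity

variable {V : Circ → ℝ}

theorem exists_mem_Ico_of_partition {n : ℕ} {a : ℕ → ℝ} {x : ℝ} (h0 : a 0 ≤ x) (hn : x < a n) :
    ∃ i < n, x ∈ Ico (a i) (a (i + 1)) := by
  induction n with
  | zero => exact absurd h0 (not_le.2 hn)
  | succ n ih =>
    rcases lt_or_ge x (a n) with h | h
    · obtain ⟨i, hi, hx⟩ := ih h
      exact ⟨i, hi.trans (Nat.lt_succ_self n), hx⟩
    · exact ⟨n, Nat.lt_succ_self n, h, hn⟩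

/-- The derivative of a `C¹`, piecewise `C²` function has bounded right derivatives. -/
theorem PiecewiseC2.exists_bound_right_deriv (hV : CircContDiff 1 V) (hp : PiecewiseC2 V) :
    ∃ B, ∀ x ∈ Ico (0 : ℝ) 1,
      DifferentiableWithinAt ℝ (deriv fun y : ℝ => V (y : Circ)) (Ioi x) x ∧
      |derivWithin (deriv fun y : ℝ => V (y : Circ)) (Ioi x) x| ≤ B := by
  obtain ⟨n, a, ha0, han, hlt, hC⟩ := hp
  set F : ℝ → ℝ := fun y => V (y : Circ) with hF
  have hpiece : ∀ i, ∃ B, i < n → ∀ x ∈ Ico (a i) (a (i + 1)),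
      DifferentiableWithinAt ℝ (deriv F) (Ioi x) x ∧ |derivWithin (deriv F) (Ioi x) x| ≤ B := by
    intro i
    by_cases hi : i < n
    swap
    · exact ⟨0, fun h => absurd h hi⟩
    have hu := uniqueDiffOn_Icc (hlt i hi)
    have hd : ContDiffOn ℝ 1 (deriv F) (Icc (a i) (a (i + 1))) := by
      refine ((hC i hi).derivWithin (m := 1) hu (by norm_num)).congr fun x hx => ?_
      exact (((hV.hasDerivAt x).differentiableAt).derivWithin (hu x hx)).symm
    obtain ⟨B, hB⟩ := isCompact_Icc.exists_bound_of_continuousOn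
      (hd.continuousOn_derivWithin hu le_rfl)
    refine ⟨B, fun _ x hx => ?_⟩
    have hx' : x ∈ Icc (a i) (a (i + 1)) := Ico_subset_Icc_self hx
    have h1 := (hd.differentiableOn one_ne_zero x hx').hasDerivWithinAt
    have h2 := h1.mono_of_mem_nhdsWithin (Icc_mem_nhdsGT_of_mem hx)
    refine ⟨h2.differentiableWithinAt, ?_⟩
    rw [h2.derivWithin (uniqueDiffWithinAt_Ioi x)]
    exact hB x hx'
  choose B hB using hpiece
  refine ⟨∑ i ∈ Finset.range n, |B i|, fun x hx => ?_⟩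
  obtain ⟨i, hi, hxi⟩ := exists_mem_Ico_of_partition (n := n) (a := a) (x := x)
    (by rw [ha0]; exact hx.1) (by rw [han]; exact hx.2)
  refine ⟨(hB i hi x hxi).1, ((hB i hi x hxi).2.trans (le_abs_self _)).trans ?_⟩
  exact Finset.single_le_sum (f := fun i => |B i|) (fun _ _ => abs_nonneg _)
    (Finset.mem_range.2 hi)

/-- For a `C¹`, piecewise `C²` odd function, `k² v_k` is square summable: up to a constant it is a
Fourier coefficient of the bounded second derivative. -/
theorem PiecewiseC2.exists_square_summable (hV : CircContDiff 1 V) (hp : PiecewiseC2 V)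
    (hodd : ∀ θ : Circ, V (-θ) = -V θ) :
    ∃ b : ℤ → ℝ, (∀ k, 0 ≤ b k) ∧ Summable (fun k => b k ^ 2) ∧
      ∀ k : ℤ, k ≠ 0 → |sineCoeff V k| ≤ b k / (k : ℝ) ^ 2 := by
  obtain ⟨B, hB⟩ := hp.exists_bound_right_deriv hV
  set W : ℝ → ℝ := deriv fun y : ℝ => V (y : Circ) with hW
  set g : ℝ → ℂ := fun x => ((derivWithin W (Ioi x) x : ℝ) : ℂ) with hg
  have hgm : Measurable g := Complex.measurable_ofReal.comp (measurable_derivWithin_Ioi W)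
  have hgb : ∀ᵐ x ∂(volume.restrict (Ioc (0 : ℝ) 1)), ‖g x‖ ≤ B := by
    have h1 : ∀ᵐ x : ℝ, x ≠ 1 := by simp [ae_iff]
    filter_upwards [ae_restrict_mem measurableSet_Ioc, ae_restrict_of_ae h1] with x hx hx1
    rw [hg, Complex.norm_real]
    exact (hB x ⟨hx.1.le, lt_of_le_of_ne hx.2 hx1⟩).2
  have hgL : MemLp g 2 (volume.restrict (Ioc (0 : ℝ) 1)) :=
    MemLp.of_bound hgm.aestronglyMeasurable B hgb
  have hgi : IntervalIntegrable g volume 0 1 := by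
    rw [intervalIntegrable_iff_integrableOn_Ioc_of_le zero_le_one]
    exact hgL.integrable (by norm_num)
  have hsum := (hasSum_sq_fourierCoeffOn zero_lt_one hgL).summable
  refine ⟨fun k => ‖fourierCoeffOn zero_lt_one g k‖, fun k => norm_nonneg _, hsum, fun k hk => ?_⟩
  have hVW : ∀ x : ℝ, W x = circDeriv 1 V (x : Circ) := fun x => (circDeriv_one_coe V x).symm
  have hWc : Continuous W := by
    have : W = fun x : ℝ => circDeriv 1 V (x : Circ) := funext hVW
    rw [this]
    exact (circDeriv_continuous (n := 1) hV).comp (AddCircle.continuous_mk' 1)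
  have hW01 : W 1 = W 0 := by
    rw [hVW, hVW, show ((1 : ℝ) : Circ) = ((0 : ℝ) : Circ) by simp]
  have h1 := fourierCoeffOn_of_hasDeriv_right zero_lt_one (f := fun x => ((W x : ℝ) : ℂ)) (f' := g)
    (n := k) hk (Complex.continuous_ofReal.comp hWc).continuousOn (fun x hx => by
      have hx' : x ∈ Ico (0 : ℝ) 1 := by
        rw [min_eq_left zero_le_one, max_eq_right zero_le_one] at hx
        exact Ioo_subset_Ico_self hx
      exact (hB x hx').1.hasDerivWithinAt.ofReal_comp) hgi
  have h2 : fourierCoeffOn zero_lt_one (fun x => ((W x : ℝ) : ℂ)) k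
      = fourierCoeff (toC (circDeriv 1 V)) k := by
    rw [fourierCoeffOn_eq_integral, fourierCoeff_eq_intervalIntegral _ _ 0]
    norm_num only [one_div, inv_one, one_smul, smul_eq_mul, zero_add, sub_zero]
    congr 1; funext x
    rw [hVW, fourier_coe_apply, fourier_coe_apply]
    simp [toC]
  rw [h2, hW01, sub_self, mul_zero, zero_sub, ← circDeriv_one_toC hV,
    fourierCoeff_circDeriv (circContDiff_toC hV),
    fourierCoeff_toC_of_odd (integrable_of_continuous hV.continuous) hodd] at h1
  have hk' : (k : ℂ) ≠ 0 := by exact_mod_cast hk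
  have hpi : (Real.pi : ℂ) ≠ 0 := by exact_mod_cast Real.pi_ne_zero
  have h3 : ((8 * Real.pi ^ 2 * sineCoeff V k * k ^ 2 : ℝ) : ℂ) * Complex.I
      = fourierCoeffOn zero_lt_one g k := by
    generalize fourierCoeffOn zero_lt_one g k = G at h1 ⊢
    have h5 : 1 / (-2 * (Real.pi : ℂ) * Complex.I * k) * -((((1 : ℝ) : ℂ) - ((0 : ℝ) : ℂ)) * G)
        = G / (2 * Real.pi * Complex.I * k) := by
      push_cast
      field_simp
      ring
    rw [h5, eq_div_iff (by simp [hk', hpi])] at h1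
    rw [← h1]
    push_cast
    linear_combination (-(8 * (Real.pi : ℂ) ^ 2 * sineCoeff V k * k ^ 2 * Complex.I))
      * -Complex.I_sq
  have h4 := congrArg norm h3
  rw [norm_mul, Complex.norm_real, Complex.norm_I, mul_one,
    Real.norm_eq_abs, abs_mul, abs_mul, abs_mul] at h4
  have hk2 : (0 : ℝ) < (k : ℝ) ^ 2 := by positivity
  change _ ≤ ‖fourierCoeffOn zero_lt_one g k‖ / _
  rw [le_div_iff₀ hk2, ← h4, abs_of_pos hk2, abs_of_pos (by positivity : (0:ℝ) < 8),
    abs_of_pos (by positivity : (0:ℝ) < Real.pi ^ 2)]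
  have : (1 : ℝ) ≤ 8 * Real.pi ^ 2 := by nlinarith [Real.pi_gt_three]
  nlinarith [mul_nonneg (abs_nonneg (sineCoeff V k)) hk2.le]

/-- With `k² v_k` square summable, `∑ l |v_l|` converges by the Cauchy-Schwarz inequality, and
`l⁴ v_l²` is bounded. -/
theorem summable_and_bddAbove_of_piecewiseC2 (hV : CircContDiff 1 V) (hp : PiecewiseC2 V)
    (hodd : ∀ θ : Circ, V (-θ) = -V θ) :
    Summable (fun l : ℕ+ => (l : ℝ) * |sineCoeff V ((l : ℕ) : ℤ)|) ∧
      BddAbove (range (rhoTerm V)) := by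
  obtain ⟨b, hb0, hbs, hb⟩ := hp.exists_square_summable hV hodd
  have hle : ∀ l : ℕ+, (l : ℝ) ^ 2 * |sineCoeff V ((l : ℕ) : ℤ)| ≤ b ((l : ℕ) : ℤ) := by
    intro l
    have hl : (0 : ℝ) < (l : ℝ) ^ 2 := by have := l.pos; positivity
    have := hb ((l : ℕ) : ℤ) (by exact_mod_cast l.ne_zero)
    rw [Int.cast_natCast, le_div_iff₀ hl] at this
    linarith
  constructor
  · have h2 : Summable fun l : ℕ+ => 1 / (l : ℝ) ^ 2 := by
      exact (summable_inv_int_sq.comp_injective injective_pnat_int).congr fun l => by simp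
    refine Summable.of_nonneg_of_le (fun l => by positivity) (fun l => ?_)
      ((hbs.comp_injective injective_pnat_int).add h2)
    have hl : (0 : ℝ) < (l : ℝ) := by exact_mod_cast l.pos
    have h3 : (l : ℝ) * |sineCoeff V ((l : ℕ) : ℤ)| ≤ b ((l : ℕ) : ℤ) * (1 / l) := by
      rw [mul_one_div, le_div_iff₀ hl]
      calc _ = (l : ℝ) ^ 2 * |sineCoeff V ((l : ℕ) : ℤ)| := by ring
        _ ≤ _ := hle l
    have h4 : (1 : ℝ) / (l : ℝ) ^ 2 = (1 / l) ^ 2 := by rw [div_pow, one_pow]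
    simp only [Function.comp_apply, h4]
    nlinarith [sq_nonneg (b ((l : ℕ) : ℤ) - 1 / l), sq_nonneg (b ((l : ℕ) : ℤ)),
      sq_nonneg (1 / (l : ℝ))]
  · refine ⟨∑' k, b k ^ 2, ?_⟩
    rintro _ ⟨l, rfl⟩
    have h1 := hbs.le_tsum ((l : ℕ) : ℤ) fun _ _ => sq_nonneg _
    refine le_trans ?_ h1
    have h2 := pow_le_pow_left₀ (by positivity) (hle l) 2
    rw [mul_pow, sq_abs] at h2
    refine le_trans ?_ h2
    rw [rhoTerm]
    refine mul_le_mul_of_nonneg_right ?_ (sq_nonneg _)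
    nlinarith [sq_nonneg ((l : ℝ)), sq_nonneg ((l : ℝ) ^ 2)]

end Regularity

/-! ### The cubic form of resonant triples -/

section Trilinear

/-- The symmetric cubic monomial `Re (conj a_p · conj a_q · a_{p+q})` in the Fourier modes. -/
def cubicTerm (a : ℤ → ℂ) (x : ℕ+ × ℕ+) : ℝ :=
  ((starRingEnd ℂ) (a x.1) * (starRingEnd ℂ) (a x.2) * a (x.1 + x.2)).re

theorem abs_cubicTerm_le (a : ℤ → ℂ) (x : ℕ+ × ℕ+) :
    |cubicTerm a x| ≤ ‖a x.1‖ * ‖a x.2‖ * ‖a (x.1 + x.2)‖ := by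
  refine (Complex.abs_re_le_norm _).trans_eq ?_
  simp

theorem tsum_indicator_range {α β : Type*} {e : β → α} (he : Function.Injective e) (T : α → ℝ) :
    ∑' x, (range e).indicator T x = ∑' y, T (e y) := by
  rw [← tsum_subtype, tsum_range T he]

/-- Any weighted sum of the nonlinear terms of the mode equations reduces, after symmetrization
over resonant triples `(p, q, p + q)`, to a sum in which the terms where the weight is locally
constant cancel. -/
theorem hasSum_cubicTerm {a : ℤ → ℂ} (ha : Summable fun k => ‖a k‖)
    (hconj : ∀ k, a (-k) = (starRingEnd ℂ) (a k)) (h0 : a 0 = 1) {v : ℤ → ℝ}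
    (hv : ∀ k, v (-k) = -v k) {B : ℝ} (hvB : ∀ k, |v k| ≤ B) {φ : ℕ+ → ℝ}
    (hφ : ∀ k, |φ k| ≤ 1) :
    HasSum (fun x : ℕ+ × ℕ+ => cubicTerm a x *
        (v (x.1 + x.2) * φ x.2 - v x.1 * (φ x.2 - φ (x.1 + x.2))))
      (∑' k : ℕ+, φ k * ((starRingEnd ℂ) (a k) * ∑' l : ℤ, v l * a l * a (k - l)).re
        - ∑' k : ℕ+, φ k * (v k * ‖a k‖ ^ 2)) := by
  have hB : 0 ≤ B := (abs_nonneg _).trans (hvB 0)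
  have hv0 : v 0 = 0 := by have := hv 0; simp at this; linarith
  obtain ⟨A, hA⟩ : ∃ A, ∀ k, ‖a k‖ ≤ A :=
    ⟨∑' k, ‖a k‖, fun k => ha.le_tsum k fun _ _ => norm_nonneg _⟩
  have hA0 : 0 ≤ A := (norm_nonneg _).trans (hA 0)
  set T : ℕ+ × ℤ → ℝ := fun x =>
    φ x.1 * (v x.2 * ((starRingEnd ℂ) (a x.1) * a x.2 * a (x.1 - x.2)).re) with hT
  have hTb : ∀ x : ℕ+ × ℤ, ‖T x‖ ≤ B * A * (‖a x.1‖ * ‖a x.2‖) := by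
    intro x
    have h1 : |((starRingEnd ℂ) (a x.1) * a x.2 * a (x.1 - x.2)).re| ≤ ‖a x.1‖ * ‖a x.2‖ * A := by
      refine (Complex.abs_re_le_norm _).trans ?_
      rw [norm_mul, norm_mul, RCLike.norm_conj]
      exact mul_le_mul_of_nonneg_left (hA _) (by positivity)
    rw [hT, Real.norm_eq_abs, abs_mul, abs_mul]
    calc _ ≤ 1 * (B * (‖a x.1‖ * ‖a x.2‖ * A)) := by
          gcongr
          · exact hφ _
          · exact hvB _
      _ = _ := by ring
  have hTs : Summable T := by
    refine Summable.of_norm_bounded (Summable.mul_left _ ?_) hTb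
    exact (ha.comp_injective injective_pnat_int).mul_of_nonneg ha
      (fun _ => norm_nonneg _) fun _ => norm_nonneg _
  -- summation over `l` first
  have hsum1 : ∑' x, T x
      = ∑' k : ℕ+, φ k * ((starRingEnd ℂ) (a k) * ∑' l : ℤ, v l * a l * a (k - l)).re := by
    rw [hTs.tsum_prod]
    congr 1; funext k
    have hs : Summable fun l : ℤ => (v l : ℂ) * a l * a (k - l) := by
      refine Summable.of_norm_bounded (ha.mul_left (B * A)) fun l => ?_
      rw [norm_mul, norm_mul, Complex.norm_real, Real.norm_eq_abs]
      calc _ ≤ B * ‖a l‖ * A := by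
            gcongr
            · exact hvB _
            · exact hA _
        _ = _ := by ring
    rw [← tsum_mul_left, Complex.re_tsum (hs.mul_left _), ← tsum_mul_left]
    congr 1; funext l
    simp only [hT]
    rw [show (starRingEnd ℂ) (a k) * ((v l : ℂ) * a l * a (k - l))
      = (v l : ℂ) * ((starRingEnd ℂ) (a k) * a l * a (k - l)) by ring, Complex.re_ofReal_mul]
  -- split the terms into `l < 0`, `0 < l < k` and `l > k`, each parametrized by the two smaller
  -- members of the resonant triple, and the quadratic terms `l = k`; those with `l = 0` vanish
  let e₁ : ℕ+ × ℕ+ → ℕ+ × ℤ := fun x => (x.2, -(x.1 : ℤ))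
  let e₂ : ℕ+ × ℕ+ → ℕ+ × ℤ := fun x => (x.1 + x.2, (x.1 : ℤ))
  let e₃ : ℕ+ × ℕ+ → ℕ+ × ℤ := fun x => (x.2, (x.1 : ℤ) + x.2)
  let e₄ : ℕ+ → ℕ+ × ℤ := fun k => (k, (k : ℤ))
  have i₁ : Function.Injective e₁ := by
    rintro ⟨p, q⟩ ⟨p', q'⟩ h
    simp only [e₁, Prod.mk.injEq, neg_inj] at h
    exact Prod.ext (injective_pnat_int h.2) h.1
  have i₂ : Function.Injective e₂ := by
    rintro ⟨p, q⟩ ⟨p', q'⟩ h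
    simp only [e₂, Prod.mk.injEq] at h
    have h2 : p = p' := injective_pnat_int h.2
    subst h2
    exact Prod.ext rfl (add_left_cancel h.1)
  have i₃ : Function.Injective e₃ := by
    rintro ⟨p, q⟩ ⟨p', q'⟩ h
    simp only [e₃, Prod.mk.injEq] at h
    obtain ⟨h1, h2⟩ := h
    subst h1
    exact Prod.ext (injective_pnat_int (add_right_cancel h2)) rfl
  have i₄ : Function.Injective e₄ := fun x y h => (Prod.ext_iff.1 h).1
  have r₁ : ∀ (k : ℕ+) (l : ℤ), (k, l) ∈ range e₁ ↔ l < 0 := by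
    intro k l
    constructor
    · rintro ⟨⟨p, q⟩, h⟩
      have hp := p.pos
      simp only [e₁, Prod.mk.injEq] at h
      omega
    · intro h
      refine ⟨(⟨(-l).toNat, by omega⟩, k), ?_⟩
      simp only [e₁, Prod.mk.injEq, PNat.mk_coe, true_and]
      omega
  have r₂ : ∀ (k : ℕ+) (l : ℤ), (k, l) ∈ range e₂ ↔ 0 < l ∧ l < k := by
    intro k l
    constructor
    · rintro ⟨⟨p, q⟩, h⟩
      have hp := p.pos
      have hq := q.pos
      simp only [e₂, Prod.mk.injEq] at h
      rw [← h.1, ← h.2]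
      push_cast
      omega
    · intro h
      refine ⟨(⟨l.toNat, by omega⟩, ⟨((k : ℤ) - l).toNat, by omega⟩), ?_⟩
      simp only [e₂, Prod.mk.injEq, PNat.mk_coe]
      refine ⟨PNat.coe_injective ?_, by omega⟩
      change l.toNat + ((k : ℤ) - l).toNat = (k : ℕ)
      omega
  have r₃ : ∀ (k : ℕ+) (l : ℤ), (k, l) ∈ range e₃ ↔ (k : ℤ) < l := by
    intro k l
    constructor
    · rintro ⟨⟨p, q⟩, h⟩
      have hp := p.pos
      simp only [e₃, Prod.mk.injEq] at h
      rw [← h.1, ← h.2]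
      omega
    · intro h
      refine ⟨(⟨(l - k).toNat, by omega⟩, k), ?_⟩
      simp only [e₃, Prod.mk.injEq, PNat.mk_coe, true_and]
      omega
  have r₄ : ∀ (k : ℕ+) (l : ℤ), (k, l) ∈ range e₄ ↔ l = k := by
    intro k l
    constructor
    · rintro ⟨p, h⟩
      simp only [e₄, Prod.mk.injEq] at h
      rw [← h.1, ← h.2]
    · rintro rfl
      exact ⟨k, rfl⟩
  have hdec : ∀ x, T x = (range e₁).indicator T x + (range e₂).indicator T x
      + (range e₃).indicator T x + (range e₄).indicator T x := by
    classical
    rintro ⟨k, l⟩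
    have hk := k.pos
    have hT0 : T (k, 0) = 0 := by simp [hT, hv0]
    simp only [indicator_apply, r₁, r₂, r₃, r₄]
    rcases lt_trichotomy l 0 with h | rfl | h
    · rw [if_pos h, if_neg (by omega), if_neg (by omega), if_neg (by omega)]; ring
    · rw [if_neg (by omega), if_neg (by omega), if_neg (by omega), if_neg (by omega), hT0]; ring
    · rcases lt_trichotomy l k with h' | h' | h'
      · rw [if_neg (by omega), if_pos ⟨h, h'⟩, if_neg (by omega), if_neg (by omega)]; ring
      · rw [if_neg (by omega), if_neg (by omega), if_neg (by omega), if_pos h']; ring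
      · rw [if_neg (by omega), if_neg (by omega), if_pos h', if_neg (by omega)]; ring
  have hsum2 : ∑' x, T x = ∑' x, T (e₁ x) + ∑' x, T (e₂ x) + ∑' x, T (e₃ x) + ∑' k, T (e₄ k) := by
    rw [← tsum_indicator_range i₁, ← tsum_indicator_range i₂, ← tsum_indicator_range i₃,
      ← tsum_indicator_range i₄, ← (hTs.indicator _).tsum_add (hTs.indicator _),
      ← ((hTs.indicator _).add (hTs.indicator _)).tsum_add (hTs.indicator _),
      ← (((hTs.indicator _).add (hTs.indicator _)).add (hTs.indicator _)).tsum_add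
        (hTs.indicator _)]
    exact tsum_congr hdec
  have hsum4 : ∑' k, T (e₄ k) = ∑' k : ℕ+, φ k * (v k * ‖a k‖ ^ 2) := by
    congr 1; funext k
    simp only [hT, e₄, sub_self, h0, mul_one]
    rw [mul_comm ((starRingEnd ℂ) _), Complex.mul_conj, Complex.ofReal_re,
      Complex.normSq_eq_norm_sq]
  have key := (((hTs.comp_injective i₁).hasSum.add (hTs.comp_injective i₂).hasSum).add
    (hTs.comp_injective i₃).hasSum)
  rw [← hsum1, hsum2, hsum4, add_sub_cancel_right]
  refine key.congr_fun fun x => ?_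
  obtain ⟨p, q⟩ := x
  simp only [Function.comp_apply, hT, e₁, e₂, e₃, cubicTerm, hv, hconj, PNat.add_coe, Nat.cast_add]
  have c1 : ((starRingEnd ℂ) (a q) * (starRingEnd ℂ) (a p) * a ((q : ℤ) - -p)).re
      = ((starRingEnd ℂ) (a p) * (starRingEnd ℂ) (a q) * a (p + q)).re := by
    rw [sub_neg_eq_add, add_comm (q : ℤ)]; congr 1; ring
  have c2 : ((starRingEnd ℂ) (a (p + q)) * a p * a ((p : ℤ) + q - p)).re
      = ((starRingEnd ℂ) (a p) * (starRingEnd ℂ) (a q) * a (p + q)).re := by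
    rw [add_sub_cancel_left, ← Complex.conj_re]
    simp only [map_mul, Complex.conj_conj]
    congr 1; ring
  have c3 : ((starRingEnd ℂ) (a q) * a (p + q) * a ((q : ℤ) - (p + q))).re
      = ((starRingEnd ℂ) (a p) * (starRingEnd ℂ) (a q) * a (p + q)).re := by
    rw [show (q : ℤ) - (p + q) = -p by ring, hconj]; congr 1; ring
  rw [c1, c2, c3]
  ring

theorem abs_le_of_hasSum {α : Type*} {f : α → ℝ} {S B : ℝ} (hf : HasSum f S)
    (h : ∀ s : Finset α, ∑ x ∈ s, |f x| ≤ B) : |S| ≤ B :=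
  le_of_tendsto hf.abs (Eventually.of_forall fun s =>
    (Finset.abs_sum_le_sum_abs _ _).trans (h s))

/-- A sum over pairs of positive integers of a weight `u (p, q)` times a function of `p + q` is
computed by grouping the pairs with equal sum. -/
theorem sum_mul_comp_add_le {u : ℕ × ℕ → ℝ} (hu : ∀ x, 0 ≤ u x) {H : ℕ+ → ℝ} (hH : ∀ k, 0 ≤ H k)
    (hs : Summable fun k : ℕ+ => (∑ x ∈ Finset.HasAntidiagonal.antidiagonal (k : ℕ), u x) * H k)
    (s : Finset (ℕ+ × ℕ+)) :
    ∑ x ∈ s, u (x.1, x.2) * H (x.1 + x.2)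
      ≤ ∑' k : ℕ+, (∑ x ∈ Finset.HasAntidiagonal.antidiagonal (k : ℕ), u x) * H k := by
  classical
  rw [← Finset.sum_fiberwise_of_maps_to (t := s.image fun x => x.1 + x.2)
    (g := fun x => x.1 + x.2) fun x hx => Finset.mem_image_of_mem _ hx]
  refine (Finset.sum_le_sum fun k _ => ?_).trans
    (hs.sum_le_tsum _ fun k _ => mul_nonneg (Finset.sum_nonneg fun x _ => hu x) (hH k))
  have e : ∑ x ∈ s with x.1 + x.2 = k, u (x.1, x.2) * H (x.1 + x.2)
      = (∑ x ∈ s with x.1 + x.2 = k, u (x.1, x.2)) * H k := by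
    rw [Finset.sum_mul]
    refine Finset.sum_congr rfl fun x hx => ?_
    rw [(Finset.mem_filter.1 hx).2]
  rw [e]
  refine mul_le_mul_of_nonneg_right ?_ (hH k)
  have hi : Set.InjOn (fun x : ℕ+ × ℕ+ => ((x.1 : ℕ), (x.2 : ℕ)))
      (s.filter fun x => x.1 + x.2 = k) := by
    intro x _ y _ h
    rw [Prod.mk.injEq] at h
    exact Prod.ext (PNat.coe_injective h.1) (PNat.coe_injective h.2)
  rw [← Finset.sum_image (g := fun x : ℕ+ × ℕ+ => ((x.1 : ℕ), (x.2 : ℕ))) (f := u) hi]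
  refine Finset.sum_le_sum_of_subset_of_nonneg (fun y hy => ?_) fun x _ _ => hu x
  obtain ⟨x, hx, rfl⟩ := Finset.mem_image.1 hy
  rw [Finset.HasAntidiagonal.mem_antidiagonal, ← (Finset.mem_filter.1 hx).2]
  rfl

theorem sum_antidiagonal_mul (k : ℕ) :
    ∑ x ∈ Finset.HasAntidiagonal.antidiagonal k, (x.1 : ℝ) * x.2 = k * ((k : ℝ) ^ 2 - 1) / 6 := by
  rw [Finset.Nat.sum_antidiagonal_eq_sum_range_succ (fun i j : ℕ => (i : ℝ) * j)]
  have h1 : ∀ n : ℕ, ∑ i ∈ Finset.range n, (i : ℝ) * ((k : ℝ) - i)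
      = k * (n * (n - 1) / 2) - (n - 1) * n * (2 * n - 1) / 6 := by
    intro n
    induction n with
    | zero => simp
    | succ n ih => rw [Finset.sum_range_succ, ih]; push_cast; ring
  have h2 : ∑ i ∈ Finset.range (k + 1), (i : ℝ) * ((k - i : ℕ) : ℝ)
      = ∑ i ∈ Finset.range (k + 1), (i : ℝ) * ((k : ℝ) - i) := by
    refine Finset.sum_congr rfl fun i hi => ?_
    rw [Nat.cast_sub (by simpa [Nat.lt_succ_iff] using hi)]
  rw [show k.succ = k + 1 from rfl, h2, h1]
  push_cast; ring

theorem sum_le_sum_product {α β : Type*} {s : Finset (α × β)} {f : α × β → ℝ}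
    (hf : ∀ x, 0 ≤ f x) : ∃ (s₁ : Finset α) (s₂ : Finset β),
      ∑ x ∈ s, f x ≤ ∑ p ∈ s₁, ∑ q ∈ s₂, f (p, q) := by
  classical
  refine ⟨s.image Prod.fst, s.image Prod.snd, ?_⟩
  rw [← Finset.sum_product']
  refine Finset.sum_le_sum_of_subset_of_nonneg (fun x hx => ?_) fun x _ _ => hf x
  exact Finset.mem_product.2 ⟨Finset.mem_image_of_mem _ hx, Finset.mem_image_of_mem _ hx⟩

end Trilinear

/-! ### Estimates of the cubic form -/

section Estimates

theorem sum_add_left_le_tsum {w : ℕ+ → ℝ} (hw : ∀ k, 0 ≤ w k) (hs : Summable w) (p : ℕ+)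
    (t : Finset ℕ+) : ∑ q ∈ t, w (p + q) ≤ ∑' k, w k := by
  have hi : Function.Injective fun q : ℕ+ => p + q := add_right_injective p
  exact ((hs.comp_injective hi).sum_le_tsum t fun _ _ => hw _).trans
    (tsum_comp_le_tsum_of_inj hs hw hi)

theorem sum_mul_add_le {w c : ℕ+ → ℝ} (hw : ∀ k, 0 ≤ w k) (hws : Summable w) (hc : ∀ k, 0 ≤ c k)
    (hcs : Summable c) (s : Finset (ℕ+ × ℕ+)) :
    ∑ x ∈ s, c x.1 * w (x.1 + x.2) ≤ (∑' k, c k) * ∑' k, w k := by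
  obtain ⟨s₁, s₂, h⟩ := sum_le_sum_product (s := s) (f := fun x => c x.1 * w (x.1 + x.2))
    fun x => mul_nonneg (hc _) (hw _)
  refine h.trans ?_
  calc _ = ∑ p ∈ s₁, c p * ∑ q ∈ s₂, w (p + q) := by simp only [Finset.mul_sum]
    _ ≤ ∑ p ∈ s₁, c p * ∑' k, w k := Finset.sum_le_sum fun p _ =>
        mul_le_mul_of_nonneg_left (sum_add_left_le_tsum hw hws p s₂) (hc p)
    _ = (∑ p ∈ s₁, c p) * ∑' k, w k := by rw [Finset.sum_mul]
    _ ≤ _ := mul_le_mul_of_nonneg_right (hcs.sum_le_tsum _ fun k _ => hc k) (tsum_nonneg hw)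

theorem sum_mul_add_le_right {w c : ℕ+ → ℝ} (hw : ∀ k, 0 ≤ w k) (hws : Summable w)
    (hc : ∀ k, 0 ≤ c k)
    (hcs : Summable c) (s : Finset (ℕ+ × ℕ+)) :
    ∑ x ∈ s, c x.2 * w (x.1 + x.2) ≤ (∑' k, c k) * ∑' k, w k := by
  have h := sum_mul_add_le hw hws hc hcs (s.map (Equiv.prodComm ℕ+ ℕ+).toEmbedding)
  rw [Finset.sum_map] at h
  simpa [add_comm] using h

variable {a : ℤ → ℂ} {v : ℤ → ℝ}

/-- The cubic form is dominated by the dissipation once the norm is small. -/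
theorem abs_cubic_le_of_summable {S : ℝ}
    (hS : HasSum (fun x : ℕ+ × ℕ+ => cubicTerm a x * v (x.1 + x.2)) S)
    (hW : Summable fun k : ℕ+ => (k : ℝ) * |v k|)
    (hE : Summable fun k : ℕ+ => ‖a k‖ ^ 2 / (k : ℝ)) (hF : Summable fun k : ℕ+ => ‖a k‖ ^ 2) :
    |S| ≤ √(∑' k : ℕ+, ‖a k‖ ^ 2 / (k : ℝ)) * ((∑' k : ℕ+, (k : ℝ) * |v k|)
      * ∑' k : ℕ+, ‖a k‖ ^ 2) := by
  set E := ∑' k : ℕ+, ‖a k‖ ^ 2 / (k : ℝ) with hEdef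
  have hpos : ∀ k : ℕ+, (1 : ℝ) ≤ k := fun k => by exact_mod_cast k.pos
  have hE0 : ∀ k : ℕ+, 0 ≤ ‖a k‖ ^ 2 / (k : ℝ) := fun k => by positivity
  have hak : ∀ k : ℕ+, ‖a k‖ ≤ k * √E := by
    intro k
    have h1 : ‖a k‖ ^ 2 / (k : ℝ) ≤ E := hE.le_tsum k fun j _ => hE0 j
    have hk := hpos k
    rw [div_le_iff₀ (by linarith)] at h1
    have hEn : 0 ≤ E := tsum_nonneg hE0
    refine abs_le_of_sq_le_sq' ?_ (by positivity) |>.2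
    rw [mul_pow, Real.sq_sqrt hEn]
    nlinarith
  have hc : ∀ k : ℕ+, 0 ≤ ‖a k‖ ^ 2 := fun k => by positivity
  have hw : ∀ k : ℕ+, 0 ≤ (k : ℝ) * |v k| := fun k => by positivity
  refine abs_le_of_hasSum hS fun s => ?_
  have h1 : ∀ x : ℕ+ × ℕ+, |cubicTerm a x * v (x.1 + x.2)| ≤
      √E / 2 * (‖a x.1‖ ^ 2 * (((x.1 + x.2 : ℕ+) : ℝ) * |v ((x.1 + x.2 : ℕ+) : ℤ)|)
        + ‖a x.2‖ ^ 2 * (((x.1 + x.2 : ℕ+) : ℝ) * |v ((x.1 + x.2 : ℕ+) : ℤ)|)) := by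
    intro x
    have e : ((x.1 : ℤ) + x.2) = ((x.1 + x.2 : ℕ+) : ℤ) := by push_cast; rfl
    have h2 := abs_cubicTerm_le a x
    have h3 := hak (x.1 + x.2)
    rw [← e] at h3 ⊢
    rw [abs_mul]
    have h4 : ‖a x.1‖ * ‖a x.2‖ ≤ (‖a x.1‖ ^ 2 + ‖a x.2‖ ^ 2) / 2 := by
      nlinarith [sq_nonneg (‖a x.1‖ - ‖a x.2‖)]
    calc _ ≤ (‖a x.1‖ ^ 2 + ‖a x.2‖ ^ 2) / 2 * (((x.1 + x.2 : ℕ+) : ℝ) * √E)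
          * |v (x.1 + x.2)| := by
          refine mul_le_mul_of_nonneg_right (h2.trans ?_) (abs_nonneg _)
          exact mul_le_mul h4 h3 (norm_nonneg _) (by positivity)
      _ = _ := by ring
  refine (Finset.sum_le_sum fun x _ => h1 x).trans ?_
  rw [← Finset.mul_sum, Finset.sum_add_distrib]
  have h5 := sum_mul_add_le hw hW hc hF s
  have h6 := sum_mul_add_le_right hw hW hc hF s
  have h7 : 0 ≤ √E / 2 := by positivity
  calc _ ≤ √E / 2 * ((∑' k : ℕ+, ‖a k‖ ^ 2) * (∑' k : ℕ+, (k : ℝ) * |v k|)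
        + (∑' k : ℕ+, ‖a k‖ ^ 2) * (∑' k : ℕ+, (k : ℝ) * |v k|)) :=
        mul_le_mul_of_nonneg_left (add_le_add h5 h6) h7
    _ = _ := by ring

/-- The sharp bound of the cubic form in terms of the norm alone: the Cauchy-Schwarz inequality
over pairs, with weight `p q`, and `∑_{p + q = k} p q = k (k² - 1) / 6`. -/
theorem abs_cubic_le_of_bdd {S R : ℝ} (hR : 0 ≤ R)
    (hS : HasSum (fun x : ℕ+ × ℕ+ => cubicTerm a x * v (x.1 + x.2)) S)
    (hb : ∀ k : ℕ+, (k : ℝ) ^ 2 * ((k : ℝ) ^ 2 - 1) / 6 * v k ^ 2 ≤ R ^ 2)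
    (hE : Summable fun k : ℕ+ => ‖a k‖ ^ 2 / (k : ℝ)) :
    |S| ≤ R * √(∑' k : ℕ+, ‖a k‖ ^ 2 / (k : ℝ)) * ∑' k : ℕ+, ‖a k‖ ^ 2 / (k : ℝ) := by
  set E := ∑' k : ℕ+, ‖a k‖ ^ 2 / (k : ℝ) with hEdef
  have hpos : ∀ k : ℕ+, (1 : ℝ) ≤ k := fun k => by exact_mod_cast k.pos
  have hE0 : ∀ k : ℕ+, 0 ≤ ‖a k‖ ^ 2 / (k : ℝ) := fun k => by positivity
  have hEn : 0 ≤ E := tsum_nonneg hE0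
  refine abs_le_of_hasSum hS fun s => ?_
  set X : ℕ+ × ℕ+ → ℝ := fun x => √((x.1 : ℝ) * x.2) * (|v (x.1 + x.2)| * ‖a (x.1 + x.2)‖) with hX
  set Y : ℕ+ × ℕ+ → ℝ := fun x => ‖a x.1‖ * ‖a x.2‖ / √((x.1 : ℝ) * x.2) with hY
  have h1 : ∀ x ∈ s, |cubicTerm a x * v (x.1 + x.2)| ≤ X x * Y x := by
    intro x _
    have h2 := abs_cubicTerm_le a x
    have h3 : √((x.1 : ℝ) * x.2) ≠ 0 := by
      have := hpos x.1
      have := hpos x.2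
      positivity
    have h4 : X x * Y x = ‖a x.1‖ * ‖a x.2‖ * ‖a (x.1 + x.2)‖ * |v (x.1 + x.2)| := by
      simp only [hX, hY]; field_simp
    rw [abs_mul, h4]
    exact mul_le_mul_of_nonneg_right h2 (abs_nonneg _)
  have hXs : ∑ x ∈ s, X x ^ 2 ≤ R ^ 2 * E := by
    have hb' : ∀ k : ℕ+, (∑ x ∈ Finset.HasAntidiagonal.antidiagonal (k : ℕ), (x.1 : ℝ) * x.2)
        * (v k ^ 2 * ‖a k‖ ^ 2) ≤ R ^ 2 * (‖a k‖ ^ 2 / (k : ℝ)) := by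
      intro k
      have hk := hpos k
      rw [sum_antidiagonal_mul]
      calc _ = (k : ℝ) ^ 2 * ((k : ℝ) ^ 2 - 1) / 6 * v k ^ 2 * (‖a k‖ ^ 2 / (k : ℝ)) := by
            field_simp
        _ ≤ _ := mul_le_mul_of_nonneg_right (hb k) (hE0 k)
    have hsm : Summable fun k : ℕ+ =>
        (∑ x ∈ Finset.HasAntidiagonal.antidiagonal (k : ℕ), (x.1 : ℝ) * x.2)
          * (v k ^ 2 * ‖a k‖ ^ 2) :=
      Summable.of_nonneg_of_le (fun k => mul_nonneg
        (Finset.sum_nonneg fun _ _ => by positivity) (by positivity)) hb' (hE.mul_left _)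
    have h5 := sum_mul_comp_add_le (u := fun x : ℕ × ℕ => (x.1 : ℝ) * x.2) (fun _ => by positivity)
      (H := fun k : ℕ+ => v k ^ 2 * ‖a k‖ ^ 2) (fun _ => by positivity) hsm s
    refine le_trans (le_of_eq ?_) (h5.trans ((hsm.tsum_le_tsum hb' (hE.mul_left _)).trans_eq ?_))
    · refine Finset.sum_congr rfl fun x _ => ?_
      have e : ((x.1 : ℤ) + x.2) = ((x.1 + x.2 : ℕ+) : ℤ) := by push_cast; rfl
      simp only [hX, ← e]
      rw [mul_pow, Real.sq_sqrt (by positivity), mul_pow, sq_abs]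
    · rw [tsum_mul_left]
  have hYs : ∑ x ∈ s, Y x ^ 2 ≤ E * E := by
    have h6 : Summable fun x : ℕ+ × ℕ+ => ‖a x.1‖ ^ 2 / (x.1 : ℝ) * (‖a x.2‖ ^ 2 / (x.2 : ℝ)) :=
      hE.mul_of_nonneg hE hE0 hE0
    rw [hEdef, hE.tsum_mul_tsum hE h6]
    refine le_trans (le_of_eq ?_) (h6.sum_le_tsum s fun x _ => mul_nonneg (hE0 _) (hE0 _))
    refine Finset.sum_congr rfl fun x _ => ?_
    have := hpos x.1
    have := hpos x.2
    simp only [hY]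
    rw [div_pow, Real.sq_sqrt (by positivity)]
    field_simp
  refine (Finset.sum_le_sum h1).trans ?_
  have hcs := Finset.sum_mul_sq_le_sq_mul_sq s X Y
  refine abs_le_of_sq_le_sq' ?_ (by positivity) |>.2
  calc _ ≤ _ := hcs
    _ ≤ (R ^ 2 * E) * (E * E) := mul_le_mul hXs hYs
        (Finset.sum_nonneg fun _ _ => sq_nonneg _) (by positivity)
    _ = (R * √E * E) ^ 2 := by rw [mul_pow, mul_pow, Real.sq_sqrt hEn]; ring

/-- The cubic form truncated at mode `N` is bounded uniformly in `N`, by the supremum of the modes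
alone: the flux through the mode `N` involves at most `p` resonant triples for each `p`. -/
theorem abs_cubic_truncated_le {S M : ℝ} {N : ℕ}
    (hS : HasSum (fun x : ℕ+ × ℕ+ => cubicTerm a x *
      (v (x.1 + x.2) * (if (x.2 : ℕ) ≤ N then 1 else 0) - v x.1 *
        ((if (x.2 : ℕ) ≤ N then 1 else 0) - (if ((x.1 + x.2 : ℕ+) : ℕ) ≤ N then 1 else 0)))) S)
    (hM : ∀ k, ‖a k‖ ≤ M) (hW : Summable fun k : ℕ+ => (k : ℝ) * |v k|) :
    |S| ≤ 3 * M ^ 3 * ∑' k : ℕ+, (k : ℝ) * |v k| := by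
  set W := ∑' k : ℕ+, (k : ℝ) * |v k| with hWdef
  have hM0 : 0 ≤ M := (norm_nonneg _).trans (hM 0)
  have hpos : ∀ k : ℕ+, (1 : ℝ) ≤ k := fun k => by exact_mod_cast k.pos
  have hw : ∀ k : ℕ+, 0 ≤ (k : ℝ) * |v k| := fun k => by positivity
  refine abs_le_of_hasSum hS fun s => ?_
  set χ : ℕ+ → ℝ := fun k => if (k : ℕ) ≤ N then 1 else 0 with hχ
  have hχ1 : ∀ k, |χ k| ≤ 1 := fun k => by simp only [hχ]; split_ifs <;> simp
  have hχp : ∀ k : ℕ+, (k : ℕ) ≤ N → χ k = 1 := fun k hk => if_pos hk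
  have hχn : ∀ k : ℕ+, ¬(k : ℕ) ≤ N → χ k = 0 := fun k hk => if_neg hk
  have hmono : ∀ p q : ℕ+, 0 ≤ χ q - χ (p + q) := by
    intro p q
    have h := PNat.add_coe p q
    by_cases h1 : (q : ℕ) ≤ N
    · rw [hχp q h1]; linarith [(abs_le.1 (hχ1 (p + q))).2]
    · rw [hχn q h1, hχn (p + q) (by omega), sub_zero]
  have hcub : ∀ x, |cubicTerm a x| ≤ M ^ 3 := by
    intro x
    refine (abs_cubicTerm_le a x).trans ?_
    calc _ ≤ M * M * M := by gcongr <;> exact hM _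
      _ = _ := by ring
  have hle : ∀ x : ℕ+ × ℕ+, |cubicTerm a x *
      (v (x.1 + x.2) * χ x.2 - v x.1 * (χ x.2 - χ (x.1 + x.2)))|
      ≤ M ^ 3 * |v ((x.1 + x.2 : ℕ+) : ℤ)| + M ^ 3 * (|v x.1| * (χ x.2 - χ (x.1 + x.2))) := by
    intro x
    have e : ((x.1 : ℤ) + x.2) = ((x.1 + x.2 : ℕ+) : ℤ) := by push_cast; rfl
    rw [abs_mul, ← mul_add, ← e]
    refine mul_le_mul (hcub x) ((abs_sub _ _).trans ?_) (abs_nonneg _) (by positivity)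
    refine add_le_add ?_ ?_
    · rw [abs_mul]
      exact mul_le_of_le_one_right (abs_nonneg _) (hχ1 _)
    · rw [abs_mul, abs_of_nonneg (hmono _ _)]
  refine (Finset.sum_le_sum fun x _ => hle x).trans ?_
  rw [Finset.sum_add_distrib, ← Finset.mul_sum, ← Finset.mul_sum]
  have hc1 : ∀ k : ℕ+, (∑ x ∈ Finset.HasAntidiagonal.antidiagonal (k : ℕ), (1 : ℝ)) * |v k|
      ≤ 2 * ((k : ℝ) * |v k|) := by
    intro k
    have hk := hpos k
    rw [Finset.sum_const, Finset.Nat.card_antidiagonal, nsmul_eq_mul]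
    push_cast
    nlinarith [abs_nonneg (v k)]
  have hsm : Summable fun k : ℕ+ =>
      (∑ x ∈ Finset.HasAntidiagonal.antidiagonal (k : ℕ), (1 : ℝ)) * |v k| :=
    Summable.of_nonneg_of_le (fun k => by positivity) hc1 (hW.mul_left 2)
  have h1 : ∑ x ∈ s, |v ((x.1 + x.2 : ℕ+) : ℤ)| ≤ 2 * W := by
    have h5 := sum_mul_comp_add_le (u := fun _ : ℕ × ℕ => (1 : ℝ)) (fun _ => zero_le_one)
      (H := fun k : ℕ+ => |v k|) (fun _ => abs_nonneg _) hsm s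
    simp only [one_mul] at h5
    refine h5.trans ((hsm.tsum_le_tsum hc1 (hW.mul_left 2)).trans_eq ?_)
    rw [tsum_mul_left]
  have h2 : ∑ x ∈ s, |v x.1| * (χ x.2 - χ (x.1 + x.2)) ≤ W := by
    obtain ⟨s₁, s₂, h⟩ := sum_le_sum_product (s := s)
      (f := fun x => |v x.1| * (χ x.2 - χ (x.1 + x.2)))
      fun x => mul_nonneg (abs_nonneg _) (hmono _ _)
    refine h.trans ?_
    have hcard : ∀ p : ℕ+, ∑ q ∈ s₂, (χ q - χ (p + q)) ≤ p := by
      intro p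
      have e1 : ∀ q : ℕ+, χ q - χ (p + q) = if ((q : ℕ) ∈ Finset.Ioc (N - p) N) then 1 else 0 := by
        intro q
        have := q.pos
        have h := PNat.add_coe p q
        by_cases h1 : (q : ℕ) ≤ N
        · by_cases h2 : ((p + q : ℕ+) : ℕ) ≤ N
          · rw [hχp q h1, hχp _ h2, sub_self, if_neg (by rw [Finset.mem_Ioc]; omega)]
          · rw [hχp q h1, hχn _ h2, sub_zero, if_pos (by rw [Finset.mem_Ioc]; omega)]
        · rw [hχn q h1, hχn (p + q) (by omega), sub_zero, if_neg (by rw [Finset.mem_Ioc]; omega)]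
      rw [Finset.sum_congr rfl fun q _ => e1 q, Finset.sum_boole]
      have e2 : (s₂.filter fun q : ℕ+ => (q : ℕ) ∈ Finset.Ioc (N - p) N).card
          ≤ (Finset.Ioc (N - (p : ℕ)) N).card :=
        Finset.card_le_card_of_injOn (fun q : ℕ+ => (q : ℕ))
          (fun q hq => (Finset.mem_filter.1 hq).2) fun _ _ _ _ h => PNat.coe_injective h
      rw [Nat.card_Ioc] at e2
      have e3 : (s₂.filter fun q : ℕ+ => (q : ℕ) ∈ Finset.Ioc (N - p) N).card ≤ (p : ℕ) :=
        e2.trans (by omega)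
      exact_mod_cast e3
    calc _ = ∑ p ∈ s₁, |v p| * ∑ q ∈ s₂, (χ q - χ (p + q)) := by simp only [Finset.mul_sum]
      _ ≤ ∑ p ∈ s₁, (p : ℝ) * |v p| := Finset.sum_le_sum fun p _ => by
          rw [mul_comm (p : ℝ)]
          exact mul_le_mul_of_nonneg_left (hcard p) (abs_nonneg _)
      _ ≤ W := hW.sum_le_tsum _ fun k _ => hw k
  have hM3 : 0 ≤ M ^ 3 := by positivity
  nlinarith [mul_le_mul_of_nonneg_left h1 hM3, mul_le_mul_of_nonneg_left h2 hM3]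

end Estimates

/-! ### The energy of the Fourier modes -/

section Energy

/-- The growth rate `4 π k (-π D k + v_k)` of the `k`-th mode in the linearized equation. -/
noncomputable def modeRate (v : ℤ → ℝ) (D : ℝ) (k : ℤ) : ℝ :=
  4 * Real.pi * k * (-(Real.pi * D * k) + v k)

/-- The squared norm `∑_{k ≥ 1} |a_k|² / k` of a sequence of Fourier modes. -/
noncomputable def modeEnergy (a : ℤ → ℂ) : ℝ := ∑' k : ℕ+, ‖a k‖ ^ 2 / (k : ℝ)

/-- The cubic form governing the nonlinear change of `modeEnergy`. -/
noncomputable def cubicForm (v : ℤ → ℝ) (a : ℤ → ℂ) : ℝ :=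
  ∑' x : ℕ+ × ℕ+, cubicTerm a x * v (x.1 + x.2)

/-- `a t k` behaves like the `k`-th Fourier coefficient at time `t` of a solution of mass one: it
solves the mode equations for `t > 0`, decays in `k` quadratically and locally uniformly in
`t > 0`, and attains its initial value with a bound that is uniform in `k`. -/
structure IsModeFlow (v : ℤ → ℝ) (D : ℝ) (a : ℝ → ℤ → ℂ) : Prop where
  conj : ∀ t k, a t (-k) = (starRingEnd ℂ) (a t k)
  mass : ∀ t, 0 ≤ t → a t 0 = 1
  decay : ∀ t₁ t₂ : ℝ, 0 < t₁ → ∃ B, 0 ≤ B ∧ ∀ t ∈ Icc t₁ t₂, ∀ k : ℤ, k ≠ 0 →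
    ‖a t k‖ ≤ B / (k : ℝ) ^ 2
  equation : ∀ t, 0 < t → ∀ k : ℤ, HasDerivAt (fun s => a s k)
    (-(4 * Real.pi ^ 2 * D * k ^ 2 : ℝ) * a t k
      + 4 * Real.pi * k * ∑' l : ℤ, v l * a t l * a t (k - l)) t
  tendsto : ∀ k, Tendsto (fun t => a t k) (𝓝[>] 0) (𝓝 (a 0 k))
  bound : ∃ M, 0 ≤ M ∧ ∃ τ > 0, ∀ t ∈ Ioc 0 τ, ∀ k : ℤ, ‖a t k‖ ≤ M

/-- All that the stability argument uses of a solution of mass one. -/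
theorem IsSolution.isModeFlow {V : Circ → ℝ} {D : ℝ} {f : ℝ → Circ → ℝ} (hV : Integrable V)
    (hodd : ∀ θ : Circ, V (-θ) = -V θ) (hf : IsSolution V D f) (hmass : ∫ θ : Circ, f 0 θ = 1) :
    IsModeFlow (sineCoeff V) D fun t k => fourierCoeff (toC (f t)) k where
  conj t k := fourierCoeff_toC_neg (f t) k
  mass _ ht := hf.fourierCoeff_zero hV hodd hmass ht
  decay _ _ h := hf.exists_norm_fourierCoeff_le h
  equation _ ht k := hf.hasDerivAt_fourierCoeff hV hodd ht k
  tendsto k := hf.tendsto_fourierCoeff k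
  bound := hf.exists_norm_fourierCoeff_le_near_zero

theorem modeRate_neg {v : ℤ → ℝ} (hv : ∀ k, v (-k) = -v k) (D : ℝ) (k : ℤ) :
    modeRate v D (-k) = modeRate v D k := by
  simp only [modeRate, hv]; push_cast; ring

variable {v : ℤ → ℝ} {D : ℝ} {a : ℝ → ℤ → ℂ}

/-- A summable majorant of the modes, locally uniform in `t > 0`. -/
theorem IsModeFlow.exists_majorant (h : IsModeFlow v D a) {t₁ t₂ : ℝ} (h1 : 0 < t₁) :
    ∃ (B : ℝ) (α : ℤ → ℝ), 0 ≤ B ∧ Summable α ∧ (∀ k, 0 ≤ α k) ∧ (∀ k, α k ≤ 1 + B) ∧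
      (∀ k, k ≠ 0 → α k = B / (k : ℝ) ^ 2) ∧ ∀ t ∈ Icc t₁ t₂, ∀ k, ‖a t k‖ ≤ α k := by
  obtain ⟨B, hB, hdec⟩ := h.decay t₁ t₂ h1
  refine ⟨B, fun k => if k = 0 then 1 else B / (k : ℝ) ^ 2, hB, ?_, fun k => ?_, fun k => ?_,
    fun k hk => if_neg hk, fun t ht k => ?_⟩
  · have hs : Summable fun k : ℤ => B / (k : ℝ) ^ 2 := by
      simpa [div_eq_mul_inv] using summable_inv_int_sq.mul_left B
    refine (hs.add (summable_of_hasFiniteSupport (f := fun k : ℤ => if k = 0 then (1 : ℝ) else 0)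
      ((Set.finite_singleton (0 : ℤ)).subset fun k hk => by simpa using hk))).congr fun k => ?_
    split_ifs with h0
    · simp [h0]
    · simp
  · dsimp only; split_ifs <;> positivity
  · dsimp only
    split_ifs with h0
    · linarith
    · have : (1 : ℝ) ≤ (k : ℝ) ^ 2 := by
        have : (1 : ℤ) ≤ k ^ 2 := by have := sq_pos_of_ne_zero h0 (R := ℤ); omega
        exact_mod_cast this
      exact (div_le_self hB this).trans (by linarith)
  · dsimp only
    split_ifs with h0
    · rw [h0, h.mass t (h1.le.trans ht.1)]; simp
    · exact hdec t ht k h0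

/-- The nonlinear term of the mode equations is bounded uniformly in `k`. -/
theorem norm_tsum_conv_le {b : ℤ → ℂ} {α : ℤ → ℝ} {K A : ℝ} (hα : Summable α)
    (hb : ∀ k, ‖b k‖ ≤ α k) (hA : ∀ k, α k ≤ A) (hv : ∀ k, |v k| ≤ K) (k : ℤ) :
    ‖∑' l : ℤ, (v l : ℂ) * b l * b (k - l)‖ ≤ K * A * ∑' l, α l := by
  have hK : 0 ≤ K := (abs_nonneg _).trans (hv 0)
  rw [← tsum_mul_left]
  refine tsum_of_norm_bounded (hα.mul_left _).hasSum fun l => ?_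
  rw [norm_mul, norm_mul, Complex.norm_real, Real.norm_eq_abs]
  have h0 : 0 ≤ α l := (norm_nonneg _).trans (hb l)
  calc _ ≤ K * α l * A := by
        gcongr
        · exact hv _
        · exact hb _
        · exact (hb _).trans (hA _)
    _ = _ := by ring

theorem IsModeFlow.summable_norm (h : IsModeFlow v D a) {t : ℝ} (ht : 0 < t) :
    Summable fun k => ‖a t k‖ := by
  obtain ⟨B, α, -, hα, -, -, -, hb⟩ := h.exists_majorant (t₂ := t) ht
  exact Summable.of_nonneg_of_le (fun _ => norm_nonneg _) (hb t ⟨le_rfl, le_rfl⟩) hα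

theorem IsModeFlow.summable_mul_sq (h : IsModeFlow v D a) {t : ℝ} (ht : 0 < t) :
    Summable fun k : ℕ+ => (k : ℝ) * ‖a t k‖ ^ 2 := by
  obtain ⟨B, hB, hdec⟩ := h.decay t t ht
  have h2 : Summable fun l : ℕ+ => B ^ 2 * (1 / (l : ℝ) ^ 2) :=
    ((summable_inv_int_sq.comp_injective injective_pnat_int).congr fun l => by simp).mul_left _
  refine Summable.of_nonneg_of_le (fun k => by positivity) (fun k => ?_) h2
  have hk : (1 : ℝ) ≤ k := by exact_mod_cast k.pos
  have h3 := hdec t ⟨le_rfl, le_rfl⟩ k (by exact_mod_cast k.ne_zero)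
  rw [Int.cast_natCast] at h3
  calc (k : ℝ) * ‖a t k‖ ^ 2 ≤ k * (B / (k : ℝ) ^ 2) ^ 2 := by gcongr
    _ = B ^ 2 * (1 / (k : ℝ) ^ 2) * (1 / k) := by field_simp
    _ ≤ B ^ 2 * (1 / (k : ℝ) ^ 2) * 1 := by
        gcongr
        rw [div_le_one (by linarith)]; exact hk
    _ = _ := mul_one _

theorem summable_sq_of_summable_mul_sq {b : ℤ → ℂ}
    (h : Summable fun k : ℕ+ => (k : ℝ) * ‖b k‖ ^ 2) : Summable fun k : ℕ+ => ‖b k‖ ^ 2 := by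
  refine Summable.of_nonneg_of_le (fun k => by positivity) (fun k => ?_) h
  have hk : (1 : ℝ) ≤ k := by exact_mod_cast k.pos
  nlinarith [sq_nonneg ‖b k‖]

theorem summable_sq_div_of_summable_sq {b : ℤ → ℂ}
    (h : Summable fun k : ℕ+ => ‖b k‖ ^ 2) : Summable fun k : ℕ+ => ‖b k‖ ^ 2 / (k : ℝ) := by
  refine Summable.of_nonneg_of_le (fun k => by positivity) (fun k => ?_) h
  exact div_le_self (by positivity) (by exact_mod_cast k.pos)

/-- The evolution of the weighted energy `∑ φ_k |a_k|² / k`. -/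
theorem IsModeFlow.hasDerivAt_weighted (h : IsModeFlow v D a) (hv : ∀ k, v (-k) = -v k) {K : ℝ}
    (hvK : ∀ k, |v k| ≤ K) {φ : ℕ+ → ℝ} (hφ : ∀ k, |φ k| ≤ 1) {t : ℝ} (ht : 0 < t) :
    ∃ S, HasSum (fun x : ℕ+ × ℕ+ => cubicTerm (a t) x *
        (v (x.1 + x.2) * φ x.2 - v x.1 * (φ x.2 - φ (x.1 + x.2)))) S ∧
      HasDerivAt (fun s => ∑' k : ℕ+, φ k * (‖a s k‖ ^ 2 / (k : ℝ)))
        (2 * (∑' k : ℕ+, φ k * (modeRate v D k * (‖a t k‖ ^ 2 / (k : ℝ))))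
          + 8 * Real.pi * S) t := by
  have hS := hasSum_cubicTerm (h.summable_norm ht) (h.conj t) (h.mass t ht.le) hv hvK hφ
  refine ⟨_, hS, ?_⟩
  obtain ⟨B, α, hB, hα, hα0, hαB, hαk, hb⟩ :=
    h.exists_majorant (t₁ := t / 2) (t₂ := 2 * t) (by positivity)
  have hK : 0 ≤ K := (abs_nonneg _).trans (hvK 0)
  set N : ℝ → ℤ → ℂ := fun s k => ∑' l : ℤ, v l * a s l * a s (k - l) with hN
  set G : ℝ := K * (1 + B) * ∑' l, α l with hG
  have hG0 : 0 ≤ G := mul_nonneg (mul_nonneg hK (by linarith)) (tsum_nonneg hα0)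
  have hNG : ∀ s ∈ Ioo (t / 2) (2 * t), ∀ k, ‖N s k‖ ≤ G := fun s hs k =>
    norm_tsum_conv_le hα (hb s (Ioo_subset_Icc_self hs)) hαB hvK k
  have hpos : ∀ s ∈ Ioo (t / 2) (2 * t), 0 < s := fun s hs => (half_pos ht).trans hs.1
  have hk1 : ∀ k : ℕ+, (1 : ℝ) ≤ k := fun k => by exact_mod_cast k.pos
  set g' : ℕ+ → ℝ → ℝ := fun k s => φ k * (-(8 * Real.pi ^ 2 * D * (k * ‖a s k‖ ^ 2))
    + 8 * Real.pi * ((starRingEnd ℂ) (a s k) * N s k).re) with hg'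
  have hterm : ∀ (k : ℕ+) (s : ℝ), s ∈ Ioo (t / 2) (2 * t) →
      HasDerivAt (fun s => φ k * (‖a s k‖ ^ 2 / (k : ℝ))) (g' k s) s := by
    intro k s hs
    have d1 := (((h.equation s (hpos s hs) k).norm_sq).div_const (k : ℝ)).const_mul (φ k)
    refine d1.congr_deriv ?_
    have hk0 : (k : ℝ) ≠ 0 := by have := hk1 k; positivity
    have eN : (∑' l : ℤ, (v l : ℂ) * a s l * a s (k - l)) = N s k := rfl
    rw [Complex.inner, mul_comm _ ((starRingEnd ℂ) _), mul_add, Complex.add_re, eN]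
    have e1 : ((starRingEnd ℂ) (a s k) *
          (-(4 * Real.pi ^ 2 * D * ((k : ℤ) : ℝ) ^ 2 : ℝ) * a s k)).re
        = -(4 * Real.pi ^ 2 * D * (k : ℝ) ^ 2) * ‖a s k‖ ^ 2 := by
      rw [show (starRingEnd ℂ) (a s k) * (-((4 * Real.pi ^ 2 * D * ((k : ℤ) : ℝ) ^ 2 : ℝ) : ℂ)
        * a s k) = ((-(4 * Real.pi ^ 2 * D * ((k : ℤ) : ℝ) ^ 2) : ℝ) : ℂ)
          * (a s k * (starRingEnd ℂ) (a s k)) by push_cast; ring,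
        Complex.mul_conj, Complex.re_ofReal_mul, Complex.ofReal_re, Complex.normSq_eq_norm_sq]
      simp
    have e2 : ((starRingEnd ℂ) (a s k) * (4 * Real.pi * ((k : ℤ) : ℂ) * N s k)).re
        = 4 * Real.pi * k * ((starRingEnd ℂ) (a s k) * N s k).re := by
      rw [show (starRingEnd ℂ) (a s k) * (4 * Real.pi * ((k : ℤ) : ℂ) * N s k)
        = ((4 * Real.pi * k : ℝ) : ℂ) * ((starRingEnd ℂ) (a s k) * N s k) by push_cast; ring,
        Complex.re_ofReal_mul]
    rw [e1, e2]
    simp only [hg']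
    field_simp
    ring
  have hak : ∀ s ∈ Ioo (t / 2) (2 * t), ∀ k : ℕ+, ‖a s k‖ ≤ B / (k : ℝ) ^ 2 := by
    intro s hs k
    have := hb s (Ioo_subset_Icc_self hs) k
    rwa [hαk k (by exact_mod_cast k.ne_zero), Int.cast_natCast] at this
  have hbound : ∀ (k : ℕ+) (s : ℝ), s ∈ Ioo (t / 2) (2 * t) →
      ‖g' k s‖ ≤ (8 * Real.pi ^ 2 * |D| * B ^ 2 + 8 * Real.pi * B * G) * (1 / (k : ℝ) ^ 2) := by
    intro k s hs
    have hk := hk1 k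
    have h1 := hak s hs k
    have h2 : |((starRingEnd ℂ) (a s k) * N s k).re| ≤ B / (k : ℝ) ^ 2 * G := by
      refine (Complex.abs_re_le_norm _).trans ?_
      rw [norm_mul, RCLike.norm_conj]
      exact mul_le_mul h1 (hNG s hs k) (norm_nonneg _) (by positivity)
    have h3 : (k : ℝ) * ‖a s k‖ ^ 2 ≤ B ^ 2 * (1 / (k : ℝ) ^ 2) := by
      calc (k : ℝ) * ‖a s k‖ ^ 2 ≤ k * (B / (k : ℝ) ^ 2) ^ 2 := by gcongr
        _ = B ^ 2 * (1 / (k : ℝ) ^ 2) * (1 / k) := by field_simp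
        _ ≤ B ^ 2 * (1 / (k : ℝ) ^ 2) * 1 := by
            gcongr
            rw [div_le_one (by linarith)]; exact hk
        _ = _ := mul_one _
    rw [hg', Real.norm_eq_abs, abs_mul]
    refine (mul_le_of_le_one_left (abs_nonneg _) (hφ k)).trans ((abs_add_le _ _).trans ?_)
    rw [abs_neg, abs_mul, abs_mul (8 * Real.pi), abs_mul, abs_of_nonneg (by positivity :
      0 ≤ (k : ℝ) * ‖a s k‖ ^ 2), abs_of_pos (by positivity : 0 < 8 * Real.pi ^ 2),
      abs_of_pos (by positivity : 0 < 8 * Real.pi)]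
    calc _ ≤ 8 * Real.pi ^ 2 * |D| * (B ^ 2 * (1 / (k : ℝ) ^ 2))
          + 8 * Real.pi * (B / (k : ℝ) ^ 2 * G) := by gcongr
      _ = _ := by ring
  have hu : Summable fun k : ℕ+ =>
      (8 * Real.pi ^ 2 * |D| * B ^ 2 + 8 * Real.pi * B * G) * (1 / (k : ℝ) ^ 2) :=
    ((summable_inv_int_sq.comp_injective injective_pnat_int).congr fun l => by simp).mul_left _
  have htm : t ∈ Ioo (t / 2) (2 * t) := ⟨by linarith, by linarith⟩
  have hF := h.summable_mul_sq ht
  have hF2 := summable_sq_of_summable_mul_sq hF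
  have hsum0 : Summable fun k : ℕ+ => φ k * (‖a t k‖ ^ 2 / (k : ℝ)) := by
    refine Summable.of_norm_bounded (summable_sq_div_of_summable_sq hF2) fun k => ?_
    rw [norm_mul, Real.norm_eq_abs, Real.norm_eq_abs, abs_of_nonneg (by positivity :
      0 ≤ ‖a t k‖ ^ 2 / (k : ℝ))]
    exact mul_le_of_le_one_left (by positivity) (hφ k)
  have main := hasDerivAt_tsum_of_isPreconnected hu isOpen_Ioo isPreconnected_Ioo hterm hbound htm
    hsum0 htm
  refine main.congr_deriv ?_
  have hφs : ∀ {u : ℕ+ → ℝ}, Summable u → (∀ k, 0 ≤ u k) → Summable fun k => φ k * u k := by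
    intro u hu hu0
    refine Summable.of_norm_bounded hu fun k => ?_
    rw [norm_mul, Real.norm_eq_abs, Real.norm_eq_abs, abs_of_nonneg (hu0 k)]
    exact mul_le_of_le_one_left (hu0 k) (hφ k)
  have s1 : Summable fun k : ℕ+ => φ k * (k * ‖a t k‖ ^ 2) := hφs hF fun k => by positivity
  have s2 : Summable fun k : ℕ+ => φ k * (v k * ‖a t k‖ ^ 2) := by
    refine Summable.of_norm_bounded (hF2.mul_left K) fun k => ?_
    rw [norm_mul, norm_mul, Real.norm_eq_abs, Real.norm_eq_abs, Real.norm_eq_abs,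
      abs_of_nonneg (sq_nonneg ‖a t k‖)]
    refine (mul_le_of_le_one_left (by positivity) (hφ k)).trans ?_
    exact mul_le_mul_of_nonneg_right (hvK _) (sq_nonneg _)
  have s4 : Summable fun k => g' k t := Summable.of_norm_bounded hu fun k => hbound k t htm
  have s3 : Summable fun k : ℕ+ => φ k * ((starRingEnd ℂ) (a t k) * N t k).re := by
    refine ((s4.add (s1.mul_left (8 * Real.pi ^ 2 * D))).mul_left (1 / (8 * Real.pi))).congr
      fun k => ?_
    simp only [hg']
    have := Real.pi_ne_zero
    field_simp
    ring
  have e1 : ∑' k : ℕ+, g' k t = -(8 * Real.pi ^ 2 * D) * (∑' k : ℕ+, φ k * (k * ‖a t k‖ ^ 2))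
      + 8 * Real.pi * ∑' k : ℕ+, φ k * ((starRingEnd ℂ) (a t k) * N t k).re := by
    rw [← tsum_mul_left, ← tsum_mul_left, ← (s1.mul_left _).tsum_add (s3.mul_left _)]
    congr 1; funext k
    simp only [hg']; ring
  have e2 : ∑' k : ℕ+, φ k * (modeRate v D k * (‖a t k‖ ^ 2 / (k : ℝ)))
      = -(4 * Real.pi ^ 2 * D) * (∑' k : ℕ+, φ k * (k * ‖a t k‖ ^ 2))
      + 4 * Real.pi * ∑' k : ℕ+, φ k * (v k * ‖a t k‖ ^ 2) := by
    rw [← tsum_mul_left, ← tsum_mul_left, ← (s1.mul_left _).tsum_add (s2.mul_left _)]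
    congr 1; funext k
    have hk0 : (k : ℝ) ≠ 0 := by have := hk1 k; positivity
    simp only [modeRate, Int.cast_natCast]
    field_simp
  rw [e1, e2]
  ring

end Energy

/-! ### Decay of the energy -/

section Decay

variable {v : ℤ → ℝ} {D : ℝ} {a : ℝ → ℤ → ℂ}

/-- Almost monotonicity of the energy up to the initial time: the truncated energies are
continuous at `0`, and the flux through the truncation is bounded uniformly. -/
theorem IsModeFlow.exists_energy_le_near_zero (h : IsModeFlow v D a) (hv : ∀ k, v (-k) = -v k)
    {K : ℝ} (hvK : ∀ k, |v k| ≤ K) (hW : Summable fun k : ℕ+ => (k : ℝ) * |v k|)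
    (hrate : ∀ k : ℕ+, modeRate v D k ≤ 0) (h0 : Summable fun k : ℕ+ => ‖a 0 k‖ ^ 2 / (k : ℝ)) :
    ∃ C, ∃ τ > 0, ∀ t ∈ Ioc 0 τ, modeEnergy (a t) ≤ modeEnergy (a 0) + C * t := by
  obtain ⟨M, hM0, τ, hτ, hM⟩ := h.bound
  set C : ℝ := 8 * Real.pi * (3 * M ^ 3 * ∑' k : ℕ+, (k : ℝ) * |v k|) with hC
  refine ⟨C, τ, hτ, fun t ht => ?_⟩
  -- `χ N` truncates to the modes up to `N`, all of which lie in the finite set `s N`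
  let χ : ℕ → ℕ+ → ℝ := fun N k => if (k : ℕ) ≤ N then 1 else 0
  let s : ℕ → Finset ℕ+ := fun N => Finset.Icc 1 ⟨N + 1, N.succ_pos⟩
  have hχ : ∀ N (k : ℕ+), k ∉ s N → χ N k = 0 := by
    intro N k hk
    refine if_neg fun hle => hk (Finset.mem_Icc.2 ⟨one_le, ?_⟩)
    exact PNat.coe_le_coe _ _ |>.1 (by simpa using hle.trans (Nat.le_succ N))
  have hE0 : ∀ (b : ℤ → ℂ) (k : ℕ+), 0 ≤ ‖b k‖ ^ 2 / (k : ℝ) := fun b k => by positivity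
  have hχ0 : ∀ N k, 0 ≤ χ N k := fun N k => by simp only [χ]; split_ifs <;> norm_num
  have hχ1 : ∀ N k, χ N k ≤ 1 := fun N k => by simp only [χ]; split_ifs <;> norm_num
  have hsum : ∀ N u, ∑' k : ℕ+, χ N k * (‖a u k‖ ^ 2 / (k : ℝ))
      = ∑ k ∈ s N, χ N k * (‖a u k‖ ^ 2 / (k : ℝ)) := fun N u =>
    tsum_eq_sum fun k hk => by rw [hχ N k hk, zero_mul]
  have key : ∀ N, ∑' k : ℕ+, χ N k * (‖a t k‖ ^ 2 / (k : ℝ))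
      ≤ ∑' k : ℕ+, χ N k * (‖a 0 k‖ ^ 2 / (k : ℝ)) + C * t := by
    intro N
    have hder : ∀ u ∈ Ioc 0 τ, ∃ d ≤ C,
        HasDerivAt (fun s => ∑' k : ℕ+, χ N k * (‖a s k‖ ^ 2 / (k : ℝ))) d u := by
      intro u hu
      obtain ⟨S, hS, hd⟩ := h.hasDerivAt_weighted hv hvK (φ := χ N)
        (fun k => abs_le.2 ⟨by linarith [hχ0 N k], hχ1 N k⟩) hu.1
      refine ⟨_, ?_, hd⟩
      have h1 := abs_cubic_truncated_le hS (hM u hu) hW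
      have h2 : ∑' k : ℕ+, χ N k * (modeRate v D k * (‖a u k‖ ^ 2 / (k : ℝ))) ≤ 0 :=
        tsum_nonpos fun k => mul_nonpos_of_nonneg_of_nonpos (hχ0 N k)
          (mul_nonpos_of_nonpos_of_nonneg (hrate k) (hE0 _ k))
      have h3 := mul_le_mul_of_nonneg_left ((le_abs_self S).trans h1)
        (by positivity : 0 ≤ 8 * Real.pi)
      rw [hC]; linarith
    have hcont0 : Tendsto (fun s => ∑' k : ℕ+, χ N k * (‖a s k‖ ^ 2 / (k : ℝ))) (𝓝[>] 0)
        (𝓝 (∑' k : ℕ+, χ N k * (‖a 0 k‖ ^ 2 / (k : ℝ)))) := by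
      simp only [hsum]
      exact tendsto_finsetSum _ fun k _ =>
        ((((h.tendsto k).norm.pow 2).div_const _).const_mul _)
    have hle : ∀ᶠ u in 𝓝[>] (0 : ℝ), ∑' k : ℕ+, χ N k * (‖a t k‖ ^ 2 / (k : ℝ))
        ≤ ∑' k : ℕ+, χ N k * (‖a u k‖ ^ 2 / (k : ℝ)) + C * (t - u) := by
      filter_upwards [Ioo_mem_nhdsGT ht.1] with u hu
      have hmem : ∀ x ∈ Icc u t, x ∈ Ioc 0 τ := fun x hx => ⟨hu.1.trans_le hx.1, hx.2.trans ht.2⟩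
      have := (convex_Icc u t).image_sub_le_mul_sub_of_deriv_le
        (f := fun s => ∑' k : ℕ+, χ N k * (‖a s k‖ ^ 2 / (k : ℝ))) (C := C)
        (fun x hx => by
          obtain ⟨d, -, hd⟩ := hder x (hmem x hx)
          exact hd.continuousAt.continuousWithinAt)
        (fun x hx => by
          obtain ⟨d, -, hd⟩ := hder x (hmem x (interior_subset hx))
          exact hd.differentiableAt.differentiableWithinAt)
        (fun x hx => by
          obtain ⟨d, hdC, hd⟩ := hder x (hmem x (interior_subset hx))
          rw [hd.deriv]; exact hdC)
        u ⟨le_rfl, hu.2.le⟩ t ⟨hu.2.le, le_rfl⟩ hu.2.le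
      linarith
    have hlim := hcont0.add ((tendsto_const_nhds (x := C)).mul
      ((tendsto_const_nhds (x := t)).sub (tendsto_id.mono_left nhdsWithin_le_nhds)))
    simpa using ge_of_tendsto hlim hle
  have hconv : ∀ N, ∑' k : ℕ+, χ N k * (‖a t k‖ ^ 2 / (k : ℝ)) ≤ modeEnergy (a 0) + C * t := by
    intro N
    refine (key N).trans (add_le_add_left ?_ _)
    have hle : ∀ k : ℕ+, χ N k * (‖a 0 k‖ ^ 2 / (k : ℝ)) ≤ ‖a 0 k‖ ^ 2 / (k : ℝ) := fun k =>
      mul_le_of_le_one_left (hE0 _ k) (hχ1 N k)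
    exact Summable.tsum_le_tsum hle (Summable.of_nonneg_of_le
      (fun k => mul_nonneg (hχ0 N k) (hE0 _ k)) hle h0) h0
  have hs := summable_sq_div_of_summable_sq
    (summable_sq_of_summable_mul_sq (h.summable_mul_sq ht.1))
  refine hs.tsum_le_of_sum_le fun F => ?_
  obtain ⟨N, hN⟩ := F.bddAbove
  refine le_trans ?_ (hconv N)
  have hsm : Summable fun k : ℕ+ => χ N k * (‖a t k‖ ^ 2 / (k : ℝ)) :=
    Summable.of_nonneg_of_le (fun k => mul_nonneg (hχ0 N k) (hE0 _ k))
      (fun k => mul_le_of_le_one_left (hE0 _ k) (hχ1 N k)) hs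
  refine le_trans (le_of_eq ?_)
    (hsm.sum_le_tsum F fun k _ => mul_nonneg (hχ0 N k) (hE0 _ k))
  refine Finset.sum_congr rfl fun k hk => ?_
  have : χ N k = 1 := if_pos (PNat.coe_le_coe _ _ |>.2 (hN hk))
  rw [this, one_mul]

/-- The evolution of the energy. -/
theorem IsModeFlow.hasDerivAt_modeEnergy (h : IsModeFlow v D a) (hv : ∀ k, v (-k) = -v k) {K : ℝ}
    (hvK : ∀ k, |v k| ≤ K) {t : ℝ} (ht : 0 < t) :
    HasSum (fun x : ℕ+ × ℕ+ => cubicTerm (a t) x * v (x.1 + x.2)) (cubicForm v (a t)) ∧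
    HasDerivAt (fun s => modeEnergy (a s))
        (2 * (∑' k : ℕ+, modeRate v D k * (‖a t k‖ ^ 2 / (k : ℝ)))
          + 8 * Real.pi * cubicForm v (a t)) t := by
  obtain ⟨S, hS, hd⟩ := h.hasDerivAt_weighted hv hvK (φ := fun _ => 1) (fun k => by simp) ht
  simp only [mul_one, sub_self, mul_zero, sub_zero, one_mul] at hS hd
  have : cubicForm v (a t) = S := hS.tsum_eq
  rw [this]
  exact ⟨hS, hd⟩

/-- If the energy strictly dissipates at rate `κ` below the level `r`, then it decays
exponentially, as soon as it is initially below this level. -/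
theorem IsModeFlow.modeEnergy_le (h : IsModeFlow v D a) (hv : ∀ k, v (-k) = -v k)
    {K : ℝ} (hvK : ∀ k, |v k| ≤ K) (hW : Summable fun k : ℕ+ => (k : ℝ) * |v k|)
    (hrate : ∀ k : ℕ+, modeRate v D k ≤ 0) (h0 : Summable fun k : ℕ+ => ‖a 0 k‖ ^ 2 / (k : ℝ))
    {r κ : ℝ} (hr : modeEnergy (a 0) < r) (hκ : 0 ≤ κ)
    (hdiss : ∀ t, 0 < t → 0 < modeEnergy (a t) → modeEnergy (a t) ≤ r →
      2 * (∑' k : ℕ+, modeRate v D k * (‖a t k‖ ^ 2 / (k : ℝ)))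
        + 8 * Real.pi * cubicForm v (a t) < -(κ * modeEnergy (a t)))
    {t : ℝ} (ht : 0 < t) : modeEnergy (a t) ≤ r * Real.exp (-(κ * t)) := by
  obtain ⟨C, τ, hτ, hC⟩ := h.exists_energy_le_near_zero hv hvK hW hrate h0
  have hr0 : 0 < r := (tsum_nonneg fun k => by positivity).trans_lt hr
  have hsmall : ∀ᶠ s in 𝓝[>] (0 : ℝ), modeEnergy (a s) < r := by
    have h1 : Tendsto (fun s : ℝ => modeEnergy (a 0) + C * s) (𝓝[>] 0)
        (𝓝 (modeEnergy (a 0) + C * 0)) :=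
      (tendsto_const_nhds.add (tendsto_const_nhds.mul tendsto_id)).mono_left nhdsWithin_le_nhds
    rw [mul_zero, add_zero] at h1
    filter_upwards [h1.eventually_lt_const hr, Ioc_mem_nhdsGT hτ] with s hs hs'
    exact (hC s hs').trans_lt hs
  have hcomp : ∀ᶠ s in 𝓝[>] (0 : ℝ), modeEnergy (a t) ≤ r * Real.exp (-(κ * (t - s))) := by
    filter_upwards [hsmall, Ioo_mem_nhdsGT ht] with s hs hst
    have hd : ∀ x ∈ Icc s t, _ := fun x hx =>
      (h.hasDerivAt_modeEnergy hv hvK (hst.1.trans_le hx.1)).2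
    have hB : ∀ x, HasDerivAt (fun x => r * Real.exp (-(κ * (x - s))))
        (-(κ * (r * Real.exp (-(κ * (x - s)))))) x := by
      intro x
      have d1 := ((((hasDerivAt_id x).sub_const s).const_mul κ).neg.exp).const_mul r
      refine d1.congr_deriv ?_
      simp only [id, Pi.neg_apply]; ring
    refine image_le_of_deriv_right_lt_deriv_boundary (a := s) (b := t)
      (fun x hx => (hd x hx).continuousAt.continuousWithinAt)
      (fun x hx => (hd x (Ico_subset_Icc_self hx)).hasDerivWithinAt) ?_ hB ?_ ⟨hst.2.le, le_rfl⟩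
    · simpa using hs.le
    · intro x hx heq
      have hxs : 0 < x := hst.1.trans_le hx.1
      have hpos : 0 < r * Real.exp (-(κ * (x - s))) := mul_pos hr0 (Real.exp_pos _)
      have hle : r * Real.exp (-(κ * (x - s))) ≤ r := by
        refine mul_le_of_le_one_right hr0.le (Real.exp_le_one_iff.2 ?_)
        have := mul_nonneg hκ (sub_nonneg.2 hx.1)
        linarith
      have := hdiss x hxs (by rw [heq]; exact hpos) (by rw [heq]; exact hle)
      rwa [heq] at this
  have hlim : Tendsto (fun s : ℝ => r * Real.exp (-(κ * (t - s)))) (𝓝[>] 0)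
      (𝓝 (r * Real.exp (-(κ * (t - 0))))) := by
    refine Tendsto.mono_left ?_ nhdsWithin_le_nhds
    exact Continuous.tendsto (by fun_prop) 0
  simpa using ge_of_tendsto hlim hcomp

/-- With diffusion, negative rates are automatically of quadratic order. -/
theorem exists_modeRate_le (hD : 0 < D) {K : ℝ} (hvK : ∀ k, |v k| ≤ K)
    (hrate : ∀ k : ℕ+, modeRate v D k < 0) :
    ∃ γ > 0, ∀ k : ℕ+, modeRate v D k ≤ -(γ * (k : ℝ) ^ 2) := by
  have hk1 : ∀ k : ℕ+, (1 : ℝ) ≤ k := fun k => by exact_mod_cast k.pos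
  obtain ⟨N, hN⟩ := exists_nat_gt (K / (Real.pi * D / 2))
  have hpD : 0 < Real.pi * D / 2 := by have := Real.pi_pos; positivity
  have hlarge : ∀ k : ℕ+, N ≤ (k : ℕ) → modeRate v D k ≤ -(2 * Real.pi ^ 2 * D * (k : ℝ) ^ 2) := by
    intro k hk
    have h1 : K < (k : ℝ) * (Real.pi * D / 2) := by
      rw [div_lt_iff₀ hpD] at hN
      refine hN.trans_le (mul_le_mul_of_nonneg_right ?_ hpD.le)
      exact_mod_cast hk
    have h2 := (le_abs_self _).trans (hvK k)
    have h3 : 0 ≤ 4 * Real.pi * (k : ℝ) := by have := Real.pi_pos; positivity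
    simp only [modeRate, Int.cast_natCast]
    calc 4 * Real.pi * (k : ℝ) * (-(Real.pi * D * k) + v k)
        ≤ 4 * Real.pi * (k : ℝ) * (-(Real.pi * D * k) + k * (Real.pi * D / 2)) :=
          mul_le_mul_of_nonneg_left (by linarith) h3
      _ = _ := by ring
  have hsmall : ∀ n : ℕ, ∃ γ > 0, ∀ k : ℕ+, (k : ℕ) ≤ n → modeRate v D k ≤ -(γ * (k : ℝ) ^ 2) := by
    intro n
    induction n with
    | zero => exact ⟨1, one_pos, fun k hk => absurd k.pos (by omega)⟩
    | succ n ih =>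
      obtain ⟨γ, hγ, hk⟩ := ih
      let m : ℕ+ := ⟨n + 1, n.succ_pos⟩
      have hm : (0 : ℝ) < (m : ℝ) ^ 2 := by have := hk1 m; positivity
      refine ⟨min γ (-modeRate v D m / (m : ℝ) ^ 2),
        lt_min hγ (div_pos (neg_pos.2 (hrate m)) hm), fun k hkn => ?_⟩
      rcases Nat.lt_or_ge n k with hlt | hge
      · obtain rfl : k = m := PNat.coe_injective (by change (k : ℕ) = n + 1; omega)
        have := mul_le_mul_of_nonneg_right
          (min_le_right γ (-modeRate v D m / (m : ℝ) ^ 2)) hm.le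
        rw [div_mul_cancel₀ _ hm.ne'] at this
        linarith
      · have := mul_le_mul_of_nonneg_right
          (min_le_left γ (-modeRate v D m / (m : ℝ) ^ 2)) (sq_nonneg (k : ℝ))
        linarith [hk k hge]
  obtain ⟨γ, hγ, hk⟩ := hsmall N
  refine ⟨min γ (2 * Real.pi ^ 2 * D), lt_min hγ (by positivity), fun k => ?_⟩
  rcases le_total (k : ℕ) N with h | h
  · have := mul_le_mul_of_nonneg_right (min_le_left γ (2 * Real.pi ^ 2 * D)) (sq_nonneg (k : ℝ))
    linarith [hk k h]
  · have := mul_le_mul_of_nonneg_right (min_le_right γ (2 * Real.pi ^ 2 * D)) (sq_nonneg (k : ℝ))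
    linarith [hlarge k h]

/-- The linear dissipation is finite for modes of finite weighted square sum. -/
theorem summable_modeRate_mul (D : ℝ) {K : ℝ} (hvK : ∀ k, |v k| ≤ K) {b : ℤ → ℂ}
    (hF : Summable fun k : ℕ+ => (k : ℝ) * ‖b k‖ ^ 2) :
    Summable fun k : ℕ+ => modeRate v D k * (‖b k‖ ^ 2 / (k : ℝ)) := by
  refine Summable.of_norm_bounded (hF.mul_left (4 * Real.pi * (Real.pi * |D| + K))) fun k => ?_
  have hk : (1 : ℝ) ≤ k := by exact_mod_cast k.pos
  have hK : 0 ≤ K := (abs_nonneg _).trans (hvK 0)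
  have e : modeRate v D k * (‖b k‖ ^ 2 / (k : ℝ))
      = 4 * Real.pi * (-(Real.pi * D * k) + v k) * ‖b k‖ ^ 2 := by
    simp only [modeRate, Int.cast_natCast]
    field_simp
  have h1 : |-(Real.pi * D * k) + v k| ≤ (Real.pi * |D| + K) * k := by
    refine (abs_add_le _ _).trans ?_
    rw [abs_neg, abs_mul, abs_mul, abs_of_pos Real.pi_pos, abs_of_pos (by linarith : (0 : ℝ) < k)]
    have := hvK k
    nlinarith
  rw [e, Real.norm_eq_abs, abs_mul, abs_mul, abs_of_nonneg (sq_nonneg ‖b k‖),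
    abs_of_pos (by positivity : 0 < 4 * Real.pi)]
  calc _ ≤ 4 * Real.pi * ((Real.pi * |D| + K) * k) * ‖b k‖ ^ 2 := by gcongr
    _ = _ := by ring

/-- Dissipation at small energy, when all modes are linearly stable: the diffusion absorbs the
cubic term. -/
theorem dissipation_of_small {b : ℤ → ℂ} {γ r K : ℝ} (hγ : 0 < γ)
    (hrate : ∀ k : ℕ+, modeRate v D k ≤ -(γ * (k : ℝ) ^ 2))
    (hW : Summable fun k : ℕ+ => (k : ℝ) * |v k|) (hvK : ∀ k, |v k| ≤ K)
    (hF : Summable fun k : ℕ+ => (k : ℝ) * ‖b k‖ ^ 2)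
    (hS : HasSum (fun x : ℕ+ × ℕ+ => cubicTerm b x * v (x.1 + x.2)) (cubicForm v b))
    (hr : 8 * Real.pi * (√r * ∑' k : ℕ+, (k : ℝ) * |v k|) ≤ γ)
    (hpos : 0 < modeEnergy b) (hle : modeEnergy b ≤ r) :
    2 * (∑' k : ℕ+, modeRate v D k * (‖b k‖ ^ 2 / (k : ℝ))) + 8 * Real.pi * cubicForm v b
      < -(γ / 2 * modeEnergy b) := by
  have hG := summable_sq_of_summable_mul_sq hF
  have hE := summable_sq_div_of_summable_sq hG
  have hk1 : ∀ k : ℕ+, (1 : ℝ) ≤ k := fun k => by exact_mod_cast k.pos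
  set W := ∑' k : ℕ+, (k : ℝ) * |v k| with hWdef
  set F := ∑' k : ℕ+, (k : ℝ) * ‖b k‖ ^ 2 with hFdef
  have hW0 : 0 ≤ W := tsum_nonneg fun k => by positivity
  have hGF : ∑' k : ℕ+, ‖b k‖ ^ 2 ≤ F :=
    hG.tsum_le_tsum (fun k => le_mul_of_one_le_left (sq_nonneg _) (hk1 k)) hF
  have hEG : modeEnergy b ≤ ∑' k : ℕ+, ‖b k‖ ^ 2 :=
    hE.tsum_le_tsum (fun k => div_le_self (sq_nonneg _) (hk1 k)) hG
  have h1 : ∑' k : ℕ+, modeRate v D k * (‖b k‖ ^ 2 / (k : ℝ)) ≤ -γ * F := by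
    rw [hFdef, ← tsum_mul_left]
    refine (summable_modeRate_mul D hvK hF).tsum_le_tsum (fun k => ?_) (hF.mul_left _)
    have hk := hk1 k
    calc _ ≤ -(γ * (k : ℝ) ^ 2) * (‖b k‖ ^ 2 / (k : ℝ)) :=
          mul_le_mul_of_nonneg_right (hrate k) (by positivity)
      _ = _ := by field_simp
  have h2 : cubicForm v b ≤ √r * W * F := by
    refine (le_abs_self _).trans ((abs_cubic_le_of_summable hS hW hE hG).trans ?_)
    rw [mul_assoc]
    exact mul_le_mul (Real.sqrt_le_sqrt hle) (mul_le_mul_of_nonneg_left hGF hW0)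
      (mul_nonneg hW0 (tsum_nonneg fun k => by positivity)) (Real.sqrt_nonneg _)
  have hF0 : 0 ≤ F := hpos.le.trans (hEG.trans hGF)
  have h3 := mul_le_mul_of_nonneg_left h2 (by positivity : 0 ≤ 8 * Real.pi)
  have h4 := mul_le_mul_of_nonneg_right hr hF0
  have h5 := mul_le_mul_of_nonneg_left (hEG.trans hGF) hγ.le
  have h6 := mul_pos hγ hpos
  linarith

/-- Dissipation below the threshold energy at which the sharp cubic bound balances the spectral
gap. -/
theorem dissipation_of_bdd {b : ℤ → ℂ} {c r R : ℝ} (hR : 0 ≤ R)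
    (hb : ∀ k : ℕ+, (k : ℝ) ^ 2 * ((k : ℝ) ^ 2 - 1) / 6 * v k ^ 2 ≤ R ^ 2)
    (hrate : ∀ k : ℕ+, modeRate v D k ≤ -c)
    (hs : Summable fun k : ℕ+ => modeRate v D k * (‖b k‖ ^ 2 / (k : ℝ)))
    (hE : Summable fun k : ℕ+ => ‖b k‖ ^ 2 / (k : ℝ))
    (hS : HasSum (fun x : ℕ+ × ℕ+ => cubicTerm b x * v (x.1 + x.2)) (cubicForm v b))
    (hr : 4 * Real.pi * R * √r < c)
    (hpos : 0 < modeEnergy b) (hle : modeEnergy b ≤ r) :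
    2 * (∑' k : ℕ+, modeRate v D k * (‖b k‖ ^ 2 / (k : ℝ))) + 8 * Real.pi * cubicForm v b
      < -((c - 4 * Real.pi * R * √r) * modeEnergy b) := by
  have h1 := abs_cubic_le_of_bdd hR hS hb hE
  have h2 : ∑' k : ℕ+, modeRate v D k * (‖b k‖ ^ 2 / (k : ℝ)) ≤ -c * modeEnergy b := by
    rw [modeEnergy, ← tsum_mul_left]
    exact hs.tsum_le_tsum (fun k => mul_le_mul_of_nonneg_right (hrate k) (by positivity))
      (hE.mul_left _)
  have h3 : cubicForm v b ≤ R * √r * modeEnergy b := by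
    refine (le_abs_self _).trans (h1.trans ?_)
    exact mul_le_mul_of_nonneg_right (mul_le_mul_of_nonneg_left (Real.sqrt_le_sqrt hle) hR) hpos.le
  have h4 := mul_le_mul_of_nonneg_left h3 (by positivity : 0 ≤ 8 * Real.pi)
  have h5 : 0 < (c - 4 * Real.pi * R * √r) * modeEnergy b := mul_pos (by linarith) hpos
  nlinarith

end Decay

/-! ### Parabolic smoothing -/

section Smoothing

variable {v : ℤ → ℝ} {D : ℝ} {a : ℝ → ℤ → ℂ}

theorem one_le_abs_intCast {k : ℤ} (hk : k ≠ 0) : (1 : ℝ) ≤ |(k : ℝ)| := by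
  have := Int.one_le_abs hk
  exact_mod_cast this

theorem exists_pnat_abs_eq {k : ℤ} (hk : k ≠ 0) :
    ∃ p : ℕ+, |(k : ℝ)| = p ∧ (k = p ∨ k = -p) := by
  refine ⟨⟨k.natAbs, Int.natAbs_pos.2 hk⟩, ?_, Int.natAbs_eq k⟩
  rw [PNat.mk_coe, Nat.cast_natAbs, Int.cast_abs]

theorem abs_sub_intCast_le {k l : ℤ} (hk : k ≠ 0) (hl : l ≠ 0) :
    |((k - l : ℤ) : ℝ)| ≤ 2 * (|(k : ℝ)| * |(l : ℝ)|) := by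
  have h1 := one_le_abs_intCast hk
  have h2 := one_le_abs_intCast hl
  push_cast
  refine (abs_sub _ _).trans ?_
  nlinarith

/-- Each mode is controlled by the energy, at the cost of a factor `√|k|`. -/
theorem IsModeFlow.norm_le_of_modeEnergy_le (h : IsModeFlow v D a) {r κ t : ℝ} (ht : 0 < t)
    (hE : modeEnergy (a t) ≤ r * Real.exp (-(κ * t))) (k : ℤ) (hk : k ≠ 0) :
    ‖a t k‖ ≤ √r * √|(k : ℝ)| * Real.exp (-(κ / 2 * t)) := by
  have hs := summable_sq_div_of_summable_sq
    (summable_sq_of_summable_mul_sq (h.summable_mul_sq ht))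
  have hp : ∀ k : ℕ+, ‖a t k‖ ≤ √r * √(k : ℝ) * Real.exp (-(κ / 2 * t)) := by
    intro k
    have hk : (1 : ℝ) ≤ k := by exact_mod_cast k.pos
    have h1 : ‖a t k‖ ^ 2 / (k : ℝ) ≤ r * Real.exp (-(κ * t)) :=
      (hs.le_tsum k fun j _ => by positivity).trans hE
    have hr : 0 ≤ r := by
      have h0 : 0 ≤ r * Real.exp (-(κ * t)) := le_trans (by positivity) h1
      exact nonneg_of_mul_nonneg_left h0 (Real.exp_pos _)
    rw [div_le_iff₀ (by linarith)] at h1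
    refine abs_le_of_sq_le_sq' ?_ (by positivity) |>.2
    rw [mul_pow, mul_pow, Real.sq_sqrt hr, Real.sq_sqrt (by linarith), ← Real.exp_nat_mul]
    refine h1.trans_eq ?_
    rw [show ((2 : ℕ) : ℝ) * -(κ / 2 * t) = -(κ * t) by push_cast; ring]
    ring
  obtain ⟨p, hpk, rfl | rfl⟩ := exists_pnat_abs_eq hk
  · rw [hpk]; exact hp p
  · rw [hpk, h.conj, RCLike.norm_conj]; exact hp p

/-- The weighted decay of the modes is inherited by the nonlinear term, without loss. -/
theorem norm_tsum_ite_le {b : ℤ → ℂ} {C : ℝ} {m : ℕ} (hC : 0 ≤ C) (hv0 : v 0 = 0)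
    (hW : Summable fun l : ℤ => |(l : ℝ)| * |v l|)
    (hb : ∀ k : ℤ, k ≠ 0 → |(k : ℝ)| ^ m * ‖b k‖ ≤ C * √|(k : ℝ)|) {k : ℤ} (hk : k ≠ 0) :
    |(k : ℝ)| ^ m * ‖∑' l : ℤ, if l = k then 0 else (v l : ℂ) * b l * b (k - l)‖
      ≤ 2 ^ (m + 1) * C ^ 2 * (∑' l : ℤ, |(l : ℝ)| * |v l|) * √|(k : ℝ)| := by
  have hk1 := one_le_abs_intCast hk
  have hkm : 0 < |(k : ℝ)| ^ m := by positivity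
  have hterm : ∀ l : ℤ, ‖if l = k then 0 else (v l : ℂ) * b l * b (k - l)‖
      ≤ 2 ^ (m + 1) * C ^ 2 * √|(k : ℝ)| / |(k : ℝ)| ^ m * (|(l : ℝ)| * |v l|) := by
    intro l
    have hR : 0 ≤ 2 ^ (m + 1) * C ^ 2 * √|(k : ℝ)| / |(k : ℝ)| ^ m * (|(l : ℝ)| * |v l|) := by
      positivity
    split_ifs with hlk
    · simpa using hR
    rcases eq_or_ne l 0 with rfl | hl
    · simp [hv0]
    have hkl : k - l ≠ 0 := fun h => hlk (by omega)
    have hl1 := one_le_abs_intCast hl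
    have hkl1 := one_le_abs_intCast hkl
    have h1 := hb l hl
    have h2 := hb (k - l) hkl
    have h3 := abs_sub_intCast_le hk hl
    -- `|k| ≤ 2 |l| |k - l|` distributes the weight, `|k - l| ≤ 2 |k| |l|` the square roots
    have h4 : |(k : ℝ)| ≤ 2 * (|(l : ℝ)| * |((k - l : ℤ) : ℝ)|) := by
      have h5 := abs_add_le (l : ℝ) ((k - l : ℤ) : ℝ)
      rw [show (l : ℝ) + ((k - l : ℤ) : ℝ) = k by push_cast; ring] at h5
      nlinarith
    have h6 : |(k : ℝ)| ^ m ≤ 2 ^ m * (|(l : ℝ)| ^ m * |((k - l : ℤ) : ℝ)| ^ m) := by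
      rw [← mul_pow, ← mul_pow]; exact pow_le_pow_left₀ (abs_nonneg _) h4 m
    have h7 : √|(l : ℝ)| * √|((k - l : ℤ) : ℝ)| ≤ 2 * |(l : ℝ)| * √|(k : ℝ)| := by
      have h8 : √|((k - l : ℤ) : ℝ)| ≤ 2 * (√|(k : ℝ)| * √|(l : ℝ)|) := by
        refine (Real.sqrt_le_sqrt h3).trans ?_
        rw [Real.sqrt_mul zero_le_two, Real.sqrt_mul (abs_nonneg _)]
        refine mul_le_mul_of_nonneg_right ?_ (by positivity)
        rw [Real.sqrt_le_left zero_le_two]; norm_num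
      calc _ ≤ √|(l : ℝ)| * (2 * (√|(k : ℝ)| * √|(l : ℝ)|)) := by gcongr
        _ = 2 * (√|(l : ℝ)| * √|(l : ℝ)|) * √|(k : ℝ)| := by ring
        _ = _ := by rw [Real.mul_self_sqrt (abs_nonneg _)]
    rw [norm_mul, norm_mul, Complex.norm_real, Real.norm_eq_abs, div_mul_eq_mul_div,
      le_div_iff₀ hkm]
    calc |v l| * ‖b l‖ * ‖b (k - l)‖ * |(k : ℝ)| ^ m
        ≤ |v l| * ‖b l‖ * ‖b (k - l)‖ * (2 ^ m * (|(l : ℝ)| ^ m * |((k - l : ℤ) : ℝ)| ^ m)) := by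
          gcongr
      _ = |v l| * 2 ^ m * ((|(l : ℝ)| ^ m * ‖b l‖) * (|((k - l : ℤ) : ℝ)| ^ m * ‖b (k - l)‖)) := by
          ring
      _ ≤ |v l| * 2 ^ m * ((C * √|(l : ℝ)|) * (C * √|((k - l : ℤ) : ℝ)|)) := by gcongr
      _ = |v l| * 2 ^ m * C ^ 2 * (√|(l : ℝ)| * √|((k - l : ℤ) : ℝ)|) := by ring
      _ ≤ |v l| * 2 ^ m * C ^ 2 * (2 * |(l : ℝ)| * √|(k : ℝ)|) := by gcongr
      _ = _ := by ring
  have h9 := tsum_of_norm_bounded (hW.mul_left _).hasSum hterm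
  rw [tsum_mul_left] at h9
  calc _ ≤ |(k : ℝ)| ^ m * (2 ^ (m + 1) * C ^ 2 * √|(k : ℝ)| / |(k : ℝ)| ^ m
        * ∑' l : ℤ, |(l : ℝ)| * |v l|) := mul_le_mul_of_nonneg_left h9 hkm.le
    _ = _ := by field_simp

/-- The mode equations with the linear part separated off. -/
theorem IsModeFlow.hasDerivAt_mode (h : IsModeFlow v D a) {K : ℝ} (hvK : ∀ k, |v k| ≤ K) {t : ℝ}
    (ht : 0 < t) (k : ℤ) :
    HasDerivAt (fun s => a s k) (modeRate v D k * a t k + 4 * Real.pi * k *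
      ∑' l : ℤ, if l = k then 0 else (v l : ℂ) * a t l * a t (k - l)) t := by
  refine (h.equation t ht k).congr_deriv ?_
  obtain ⟨B, α, hB, hα, hα0, hαB, -, hb⟩ := h.exists_majorant (t₂ := t) ht
  have hb' := hb t ⟨le_rfl, le_rfl⟩
  have hK : 0 ≤ K := (abs_nonneg _).trans (hvK 0)
  have hs : Summable fun l : ℤ => (v l : ℂ) * a t l * a t (k - l) := by
    refine Summable.of_norm_bounded (hα.mul_left (K * (1 + B))) fun l => ?_
    rw [norm_mul, norm_mul, Complex.norm_real, Real.norm_eq_abs]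
    have := hα0 l
    calc _ ≤ K * α l * (1 + B) := by
          gcongr
          · exact hvK _
          · exact hb' _
          · exact (hb' _).trans (hαB _)
      _ = _ := by ring
  rw [hs.tsum_eq_add_tsum_ite k, sub_self, h.mass t ht.le]
  simp only [modeRate]
  push_cast
  ring

/-- Parabolic smoothing: exponential decay of the energy implies that all moments of the modes
decay, at the same rate. Each application of the Duhamel formula gains one power of `k`. -/
theorem IsModeFlow.exists_pow_mul_norm_le (h : IsModeFlow v D a) {K : ℝ} (hvK : ∀ k, |v k| ≤ K)
    (hv0 : v 0 = 0) (hW : Summable fun l : ℤ => |(l : ℝ)| * |v l|) {γ c : ℝ} (hγ : 0 < γ)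
    (hc : 0 ≤ c) (hcγ : 2 * c ≤ γ)
    (hrate : ∀ k : ℤ, k ≠ 0 → modeRate v D k ≤ -(γ * (k : ℝ) ^ 2)) {C₀ : ℝ} (hC₀ : 0 ≤ C₀)
    (hbase : ∀ t, 0 < t → ∀ k : ℤ, k ≠ 0 → ‖a t k‖ ≤ C₀ * √|(k : ℝ)| * Real.exp (-(c * t)))
    (m : ℕ) : ∀ t₀ : ℝ, 0 < t₀ → ∃ C, 0 ≤ C ∧ ∀ t, t₀ ≤ t → ∀ k : ℤ, k ≠ 0 →
      |(k : ℝ)| ^ m * ‖a t k‖ ≤ C * √|(k : ℝ)| * Real.exp (-(c * t)) := by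
  induction m with
  | zero =>
    intro t₀ h0
    refine ⟨C₀, hC₀, fun t ht k hk => ?_⟩
    rw [pow_zero, one_mul]
    exact hbase t (h0.trans_le ht) k hk
  | succ m ih =>
    intro t₀ h0
    obtain ⟨C, hC, hind⟩ := ih (t₀ / 2) (half_pos h0)
    set W := ∑' l : ℤ, |(l : ℝ)| * |v l| with hWdef
    have hW0 : 0 ≤ W := tsum_nonneg fun l => by positivity
    set A : ℝ := 2 ^ (m + 1) * C ^ 2 * W with hA
    have hA0 : 0 ≤ A := by positivity
    refine ⟨4 * C / (γ * t₀) + 8 * Real.pi * A / γ, by positivity, fun t ht k hk => ?_⟩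
    have hk1 := one_le_abs_intCast hk
    set t₁ := t₀ / 2 with ht₁
    have ht₁0 : 0 < t₁ := half_pos h0
    set X : ℝ := |(k : ℝ)| with hX
    have hX2 : (k : ℝ) ^ 2 = X ^ 2 := (sq_abs _).symm
    set lam : ℝ := -modeRate v D k with hlam
    have hlamk : γ * X ^ 2 ≤ lam := by have := hrate k hk; rw [hX2] at this; linarith
    have hgap : γ * X ^ 2 / 2 ≤ lam - c := by
      have : γ ≤ γ * X ^ 2 := le_mul_of_one_le_right hγ.le (by nlinarith)
      linarith
    have hgap0 : 0 < lam - c := lt_of_lt_of_le (by positivity) hgap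
    set N : ℝ → ℂ := fun s => ∑' l : ℤ, if l = k then 0 else (v l : ℂ) * a s l * a s (k - l)
      with hN
    have hNb : ∀ s, t₁ ≤ s → X ^ m * ‖N s‖ ≤ A * √X * Real.exp (-(c * s)) := by
      intro s hs
      have h1 := norm_tsum_ite_le (b := a s) (C := C * Real.exp (-(c * s))) (m := m) (v := v)
        (by positivity) hv0 hW
        (fun j hj => (hind s hs j hj).trans_eq (by ring)) hk
      have hexp : Real.exp (-(c * s)) ≤ 1 := by
        rw [Real.exp_le_one_iff]
        have : 0 ≤ c * s := mul_nonneg hc (ht₁0.le.trans hs)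
        linarith
      calc _ ≤ _ := h1
        _ = A * √X * Real.exp (-(c * s)) * Real.exp (-(c * s)) := by rw [hA]; ring
        _ ≤ A * √X * Real.exp (-(c * s)) * 1 := by gcongr
        _ = _ := mul_one _
    -- variation of constants: `w` removes the linear decay rate `lam`
    set w : ℝ → ℂ := fun s => ((X ^ m * Real.exp (lam * s) : ℝ) : ℂ) * a s k with hw
    set w' : ℝ → ℂ := fun s => ((X ^ m * Real.exp (lam * s) : ℝ) : ℂ) * (4 * Real.pi * k * N s)
      with hw'
    have hwd : ∀ s, t₁ ≤ s → HasDerivAt w (w' s) s := by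
      intro s hs
      have d0 : HasDerivAt (fun s : ℝ => X ^ m * Real.exp (lam * s))
          (X ^ m * (Real.exp (lam * s) * lam)) s := by
        have := (((hasDerivAt_id s).const_mul lam).exp).const_mul (X ^ m)
        simpa using this
      have d1 := d0.ofReal_comp.mul (h.hasDerivAt_mode hvK (ht₁0.trans_le hs) k)
      refine d1.congr_deriv ?_
      simp only [hw', hlam, hN]
      push_cast
      ring
    set Q : ℝ := 4 * Real.pi * A * X * √X / (lam - c) with hQ
    have hQ0 : 0 ≤ Q := by positivity
    have hwle : ‖w t‖ ≤ ‖w t₁‖ + Q * Real.exp ((lam - c) * t) := by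
      have hBd : ∀ s, HasDerivAt (fun s => ‖w t₁‖ + Q * Real.exp ((lam - c) * s))
          (Q * (Real.exp ((lam - c) * s) * (lam - c))) s := by
        intro s
        have := ((((hasDerivAt_id s).const_mul (lam - c)).exp).const_mul Q).const_add ‖w t₁‖
        simpa using this
      refine image_norm_le_of_norm_deriv_right_le_deriv_boundary (a := t₁) (b := t) (f := w)
        (f' := w') (fun s hs => (hwd s hs.1).continuousAt.continuousWithinAt)
        (fun s hs => (hwd s hs.1).hasDerivWithinAt) ?_ hBd (fun s hs => ?_) ⟨by linarith, le_rfl⟩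
      · have := mul_nonneg hQ0 (Real.exp_pos ((lam - c) * t₁)).le
        linarith
      · have h1 := hNb s hs.1
        simp only [hw']
        rw [norm_mul, norm_mul, norm_mul, norm_mul, Complex.norm_real, Complex.norm_real,
          Complex.norm_intCast, Complex.norm_ofNat, Real.norm_of_nonneg (by positivity),
          Real.norm_of_nonneg Real.pi_pos.le]
        calc X ^ m * Real.exp (lam * s) * (4 * Real.pi * X * ‖N s‖)
            = 4 * Real.pi * X * Real.exp (lam * s) * (X ^ m * ‖N s‖) := by ring
          _ ≤ 4 * Real.pi * X * Real.exp (lam * s) * (A * √X * Real.exp (-(c * s))) := by gcongr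
          _ = 4 * Real.pi * A * X * √X * (Real.exp (lam * s) * Real.exp (-(c * s))) := by ring
          _ = 4 * Real.pi * A * X * √X * Real.exp ((lam - c) * s) := by
              rw [← Real.exp_add]; congr 2; ring
          _ = _ := by rw [hQ]; field_simp
    have hnw : ∀ s, ‖w s‖ = Real.exp (lam * s) * (X ^ m * ‖a s k‖) := by
      intro s
      simp only [hw]
      rw [norm_mul, Complex.norm_real, Real.norm_of_nonneg (by positivity)]; ring
    rw [hnw, hnw] at hwle
    have hmain : X ^ m * ‖a t k‖
        ≤ Real.exp (-(lam * (t - t₁))) * (X ^ m * ‖a t₁ k‖) + Q * Real.exp (-(c * t)) := by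
      have h1 := mul_le_mul_of_nonneg_left hwle (Real.exp_pos (-(lam * t))).le
      calc X ^ m * ‖a t k‖ = Real.exp (-(lam * t)) * (Real.exp (lam * t) * (X ^ m * ‖a t k‖)) := by
            rw [← mul_assoc, ← Real.exp_add]; simp
        _ ≤ _ := h1
        _ = (Real.exp (-(lam * t)) * Real.exp (lam * t₁)) * (X ^ m * ‖a t₁ k‖)
            + Q * (Real.exp (-(lam * t)) * Real.exp ((lam - c) * t)) := by ring
        _ = _ := by
            rw [← Real.exp_add, ← Real.exp_add]
            congr 3 <;> ring
    have hfirst : X * (Real.exp (-(lam * (t - t₁))) * (X ^ m * ‖a t₁ k‖))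
        ≤ 4 * C / (γ * t₀) * √X * Real.exp (-(c * t)) := by
      have h1 := hind t₁ le_rfl k hk
      have hy : γ * X ^ 2 / 2 * (t₀ / 2) ≤ (lam - c) * (t - t₁) :=
        mul_le_mul hgap (by linarith) (by positivity) hgap0.le
      have hy0 : 0 < γ * X ^ 2 / 2 * (t₀ / 2) := by positivity
      have h2 : X * Real.exp (-((lam - c) * (t - t₁))) ≤ 4 / (γ * t₀) := by
        rw [Real.exp_neg, ← div_eq_mul_inv, div_le_iff₀ (Real.exp_pos _)]
        have h3 := Real.add_one_le_exp ((lam - c) * (t - t₁))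
        calc X ≤ X ^ 2 := by nlinarith
          _ = 4 / (γ * t₀) * (γ * X ^ 2 / 2 * (t₀ / 2)) := by field_simp; norm_num
          _ ≤ 4 / (γ * t₀) * Real.exp ((lam - c) * (t - t₁)) := by
              refine mul_le_mul_of_nonneg_left ?_ (by positivity)
              linarith
      calc _ ≤ X * (Real.exp (-(lam * (t - t₁))) * (C * √X * Real.exp (-(c * t₁)))) := by gcongr
        _ = C * √X * X * (Real.exp (-(lam * (t - t₁))) * Real.exp (-(c * t₁))) := by ring
        _ = C * √X * X * (Real.exp (-((lam - c) * (t - t₁))) * Real.exp (-(c * t))) := by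
            rw [← Real.exp_add, ← Real.exp_add]; congr 2; ring
        _ = C * √X * (X * Real.exp (-((lam - c) * (t - t₁)))) * Real.exp (-(c * t)) := by ring
        _ ≤ C * √X * (4 / (γ * t₀)) * Real.exp (-(c * t)) := by gcongr
        _ = _ := by ring
    have hsecond : X * Q ≤ 8 * Real.pi * A / γ * √X := by
      rw [hQ, ← mul_div_assoc, div_le_iff₀ hgap0]
      calc X * (4 * Real.pi * A * X * √X) = 8 * Real.pi * A / γ * √X * (γ * X ^ 2 / 2) := by
            field_simp; ring
        _ ≤ _ := mul_le_mul_of_nonneg_left hgap (by positivity)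
    calc X ^ (m + 1) * ‖a t k‖ = X * (X ^ m * ‖a t k‖) := by ring
      _ ≤ X * (Real.exp (-(lam * (t - t₁))) * (X ^ m * ‖a t₁ k‖) + Q * Real.exp (-(c * t))) := by
          gcongr
      _ = X * (Real.exp (-(lam * (t - t₁))) * (X ^ m * ‖a t₁ k‖))
          + X * Q * Real.exp (-(c * t)) := by ring
      _ ≤ 4 * C / (γ * t₀) * √X * Real.exp (-(c * t))
          + 8 * Real.pi * A / γ * √X * Real.exp (-(c * t)) := by gcongr
      _ = _ := by ring

end Smoothing

/-! ### From the modes back to the function -/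

section Reconstruction

theorem circDeriv_fourier (n : ℕ) (k : ℤ) (b : ℂ) :
    circDeriv n (fun θ => b * fourier k θ)
      = fun θ => b * (2 * Real.pi * Complex.I * k) ^ n * fourier k θ := by
  induction n generalizing b with
  | zero => simp [circDeriv_zero]
  | succ n ih =>
    have h1 : circDeriv 1 (fun θ : Circ => b * (fourier k θ : ℂ))
        = fun θ => b * (2 * Real.pi * Complex.I * k) * fourier k θ := by
      refine (circContDiff_one_of_hasDerivAt ?_ fun y => ?_).2
      · exact continuous_const.mul (ContinuousMap.continuous _)
      · refine ((hasDerivAt_fourier 1 k y).const_mul b).congr_deriv ?_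
        push_cast; ring
    rw [circDeriv_succ, h1, ih]
    funext θ; ring

/-- A function with rapidly decreasing Fourier coefficients is smooth. -/
theorem circContDiff_of_summable {g : Circ → ℂ} (hg : Continuous g)
    (hs : ∀ n : ℕ, Summable fun k : ℤ => |(k : ℝ)| ^ n * ‖fourierCoeff g k‖) :
    CircContDiff ⊤ g := by
  have h0 : Summable fun k : ℤ => ‖fourierCoeff g k‖ := by simpa using hs 0
  have e : (fun x : ℝ => g (x : Circ))
      = fun x : ℝ => ∑' k : ℤ, fourierCoeff g k * fourier k (x : Circ) := by
    funext x; exact ((hasSum_fourier_of_summable hg h0 x).tsum_eq).symm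
  unfold CircContDiff
  rw [e]
  refine contDiff_tsum
    (v := fun n (k : ℤ) => (2 * Real.pi) ^ n * (|(k : ℝ)| ^ n * ‖fourierCoeff g k‖))
    (fun k => contDiff_const.mul (circContDiff_fourier ⊤ k)) (fun n _ => (hs n).mul_left _)
    fun n k x _ => ?_
  rw [norm_iteratedFDeriv_eq_norm_iteratedDeriv]
  have h1 := circDeriv_coe n (fun θ : Circ => fourierCoeff g k * (fourier k θ : ℂ)) x
  rw [← h1, circDeriv_fourier, norm_mul, norm_mul, norm_pow, norm_mul, norm_mul, norm_mul,
    fourier_apply, Circle.norm_coe, Complex.norm_I, Complex.norm_real, Complex.norm_intCast,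
    Complex.norm_ofNat, Real.norm_of_nonneg Real.pi_pos.le, mul_pow, mul_one, mul_one]
  exact le_of_eq (by ring)

theorem fourierCoeff_circDeriv_pow {g : Circ → ℂ} {n : ℕ} (hg : CircContDiff n g) (k : ℤ) :
    fourierCoeff (circDeriv n g) k = (2 * Real.pi * Complex.I * k) ^ n * fourierCoeff g k := by
  induction n generalizing g with
  | zero => simp [circDeriv_zero]
  | succ n ih =>
    rw [circDeriv_succ, ih hg.circDeriv_one, fourierCoeff_circDeriv (hg.of_le (by simp))]
    ring

/-- Summing the Fourier series of the `n`-th derivative bounds it uniformly. -/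
theorem norm_circDeriv_le_tsum {g : Circ → ℂ} {n : ℕ} (hg : CircContDiff n g) {u : ℤ → ℝ}
    (hu : Summable u) (hle : ∀ k : ℤ, (2 * Real.pi * |(k : ℝ)|) ^ n * ‖fourierCoeff g k‖ ≤ u k)
    (θ : Circ) : ‖circDeriv n g θ‖ ≤ ∑' k, u k := by
  have hn : ∀ k, ‖fourierCoeff (circDeriv n g) k‖ ≤ u k := by
    intro k
    rw [fourierCoeff_circDeriv_pow hg, norm_mul, norm_pow, norm_mul, norm_mul, norm_mul,
      Complex.norm_I, Complex.norm_real, Complex.norm_intCast, Complex.norm_ofNat,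
      Real.norm_of_nonneg Real.pi_pos.le, mul_one]
    exact hle k
  have hs : Summable fun k => ‖fourierCoeff (circDeriv n g) k‖ :=
    Summable.of_nonneg_of_le (fun _ => norm_nonneg _) hn hu
  rw [← (hasSum_fourier_of_summable (circDeriv_continuous hg) hs θ).tsum_eq]
  refine tsum_of_norm_bounded hu.hasSum fun k => ?_
  rw [norm_mul, fourier_apply, Circle.norm_coe, mul_one]
  exact hn k

variable {V : Circ → ℝ} {D : ℝ} {f : ℝ → Circ → ℝ}

theorem fourierCoeff_toC_sub_one {g : Circ → ℝ} (hg : Continuous g) (k : ℤ) :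
    fourierCoeff (toC fun ψ => g ψ - 1) k = fourierCoeff (toC g) k - if k = 0 then 1 else 0 := by
  have e : (toC fun ψ => g ψ - 1) = toC g + (-1 : ℂ) • ⇑(fourier (T := 1) 0) := by
    funext θ; simp [toC, sub_eq_add_neg]
  have h1 : Integrable (toC g) (AddCircle.haarAddCircle (T := 1)) := by
    rw [haarAddCircle_eq_volume]
    exact integrable_of_continuous (Complex.continuous_ofReal.comp hg)
  have h2 : Integrable ((-1 : ℂ) • ⇑(fourier (T := 1) 0)) (AddCircle.haarAddCircle (T := 1)) := by
    rw [haarAddCircle_eq_volume]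
    exact integrable_of_continuous ((ContinuousMap.continuous _).const_smul _)
  rw [e, fourierCoeff.add h1 h2, Pi.add_apply, fourierCoeff.const_smul, fourierCoeff_fourier,
    Pi.single_apply]
  split_ifs <;> simp [sub_eq_add_neg]

/-- Exponential decay of the energy of a solution implies convergence to `1`, together with all
derivatives. -/
theorem IsSolution.convergesToOne (hV : Integrable V) (hodd : ∀ θ : Circ, V (-θ) = -V θ)
    (hf : IsSolution V D f) (hmass : ∫ θ : Circ, f 0 θ = 1)
    (hW : Summable fun l : ℕ+ => (l : ℝ) * |sineCoeff V ((l : ℕ) : ℤ)|) {K : ℝ}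
    (hvK : ∀ k, |sineCoeff V k| ≤ K) {γ : ℝ} (hγ : 0 < γ)
    (hrate : ∀ k : ℕ+, modeRate (sineCoeff V) D k ≤ -(γ * (k : ℝ) ^ 2)) {r κ : ℝ} (hκ : 0 < κ)
    (hE : ∀ t, 0 < t → modeEnergy (fourierCoeff (toC (f t))) ≤ r * Real.exp (-(κ * t))) :
    ConvergesToOne f := by
  have h := hf.isModeFlow hV hodd hmass
  have hWZ : Summable fun l : ℤ => |(l : ℝ)| * |sineCoeff V l| := by
    have h1 : Summable fun n : ℕ => (n : ℝ) * |sineCoeff V (n : ℤ)| := by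
      refine (summable_nat_add_iff 1).1 ?_
      exact (Equiv.pnatEquivNat.symm.summable_iff.2 hW).congr fun n => by simp
    refine Summable.of_nat_of_neg ?_ ?_
    · simpa using h1
    · simpa [sineCoeff_neg] using h1
  have hrateZ : ∀ k : ℤ, k ≠ 0 → modeRate (sineCoeff V) D k ≤ -(γ * (k : ℝ) ^ 2) := by
    intro k hk
    obtain ⟨p, hpk, hk'⟩ := exists_pnat_abs_eq hk
    rw [← sq_abs, hpk]
    rcases hk' with rfl | rfl
    · exact hrate p
    · rw [modeRate_neg (sineCoeff_neg V)]; exact hrate p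
  set c := min (κ / 2) (γ / 2) with hc
  have hc0 : 0 < c := lt_min (by linarith) (by linarith)
  have hbase : ∀ t, 0 < t → ∀ k : ℤ, k ≠ 0 →
      ‖fourierCoeff (toC (f t)) k‖ ≤ √r * √|(k : ℝ)| * Real.exp (-(c * t)) := by
    intro t ht k hk
    refine (h.norm_le_of_modeEnergy_le ht (hE t ht) k hk).trans ?_
    refine mul_le_mul_of_nonneg_left (Real.exp_le_exp.2 (neg_le_neg ?_)) (by positivity)
    exact mul_le_mul_of_nonneg_right (min_le_left _ _) ht.le
  have hall := h.exists_pow_mul_norm_le hvK (sineCoeff_zero V) hWZ hγ hc0.le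
    (by have := min_le_right (κ / 2) (γ / 2); linarith) hrateZ (Real.sqrt_nonneg r) hbase
  have hdec : ∀ (n : ℕ) (t₀ : ℝ), 0 < t₀ → ∃ C, 0 ≤ C ∧ ∀ t, t₀ ≤ t → ∀ k : ℤ, k ≠ 0 →
      |(k : ℝ)| ^ n * ‖fourierCoeff (toC (f t)) k‖
        ≤ C * Real.exp (-(c * t)) * (1 / (k : ℝ) ^ 2) := by
    intro n t₀ h0
    -- one moment absorbs `√|k|`, two more give summability over `k`
    obtain ⟨C, hC, hb⟩ := hall (n + 3) t₀ h0
    refine ⟨C, hC, fun t ht k hk => ?_⟩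
    have hk1 := one_le_abs_intCast hk
    have h1 := hb t ht k hk
    have h2 : √|(k : ℝ)| ≤ |(k : ℝ)| := by
      rw [Real.sqrt_le_left (abs_nonneg _)]; nlinarith
    have hk2 : 0 < (k : ℝ) ^ 2 := by positivity
    rw [mul_one_div, le_div_iff₀ hk2, ← sq_abs (k : ℝ)]
    have hX : 0 < |(k : ℝ)| := by linarith
    refine le_of_mul_le_mul_left ?_ hX
    calc |(k : ℝ)| * (|(k : ℝ)| ^ n * ‖fourierCoeff (toC (f t)) k‖ * |(k : ℝ)| ^ 2)
        = |(k : ℝ)| ^ (n + 3) * ‖fourierCoeff (toC (f t)) k‖ := by ring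
      _ ≤ _ := h1
      _ ≤ C * |(k : ℝ)| * Real.exp (-(c * t)) := by gcongr
      _ = _ := by ring
  have hsmooth : ∀ t : ℝ, 0 < t → CircContDiff ⊤ (f t) := by
    intro t ht
    have hcont : Continuous (f t) := (hf.contDiff t ht).continuous
    have h1 : CircContDiff ⊤ (toC (f t)) := by
      refine circContDiff_of_summable (Complex.continuous_ofReal.comp hcont) fun n => ?_
      obtain ⟨C, hC, hb⟩ := hdec n t ht
      refine Summable.of_norm_bounded_eventually
        (summable_inv_int_sq.mul_left (C * Real.exp (-(c * t)))) ?_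
      rw [Filter.eventually_cofinite]
      refine (Set.finite_singleton (0 : ℤ)).subset fun k hk => ?_
      by_contra hk0
      refine hk ?_
      rw [Real.norm_of_nonneg (by positivity)]
      exact hb t le_rfl k hk0
    exact Complex.reCLM.contDiff.comp h1
  refine ⟨hsmooth, c, hc0, fun n t₀ h0 => ?_⟩
  obtain ⟨C, hC, hb⟩ := hdec n t₀ h0
  refine ⟨(2 * Real.pi) ^ n * C * ∑' k : ℤ, 1 / (k : ℝ) ^ 2, fun t ht θ => ?_⟩
  have ht0 : 0 < t := h0.trans_le ht
  have hcont : Continuous (f t) := (hf.contDiff t ht0).continuous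
  have hg : CircContDiff ⊤ (fun ψ => f t ψ - 1) := ContDiff.sub (hsmooth t ht0) contDiff_const
  have hgn : CircContDiff n (fun ψ => f t ψ - 1) := hg.of_le le_top
  have h1 := norm_circDeriv_le_tsum (circContDiff_toC hgn)
    (summable_inv_int_sq.mul_left ((2 * Real.pi) ^ n * C * Real.exp (-(c * t)))) (fun k => by
      rw [fourierCoeff_toC_sub_one hcont]
      split_ifs with hk
      · rw [hk, hf.fourierCoeff_zero hV hodd hmass ht0.le]; simp
      · rw [sub_zero, mul_pow]
        have := mul_le_mul_of_nonneg_left (hb t ht k hk) (by positivity : 0 ≤ (2 * Real.pi) ^ n)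
        calc _ = (2 * Real.pi) ^ n * (|(k : ℝ)| ^ n * ‖fourierCoeff (toC (f t)) k‖) := by ring
          _ ≤ _ := this
          _ = _ := by ring) θ
  rw [circDeriv_toC hgn, toC, Complex.norm_real, Real.norm_eq_abs, tsum_mul_left] at h1
  refine h1.trans_eq ?_
  ring

end Reconstruction

/-! ### Stability of the constant solution -/

section Stability

variable {V : Circ → ℝ} {D : ℝ}

theorem abs_sineCoeff_le_tsum
    (hW : Summable fun l : ℕ+ => (l : ℝ) * |sineCoeff V ((l : ℕ) : ℤ)|) (k : ℤ) :
    |sineCoeff V k| ≤ ∑' l : ℕ+, (l : ℝ) * |sineCoeff V ((l : ℕ) : ℤ)| := by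
  have hp : ∀ p : ℕ+, |sineCoeff V p| ≤ ∑' l : ℕ+, (l : ℝ) * |sineCoeff V ((l : ℕ) : ℤ)| := fun p =>
    (le_mul_of_one_le_left (abs_nonneg _) (by exact_mod_cast p.pos)).trans
      (hW.le_tsum p fun l _ => by positivity)
  rcases eq_or_ne k 0 with rfl | hk
  · rw [sineCoeff_zero, abs_zero]; exact tsum_nonneg fun l => by positivity
  · obtain ⟨p, -, rfl | rfl⟩ := exists_pnat_abs_eq hk
    · exact hp p
    · rw [sineCoeff_neg, abs_neg]; exact hp p

/-- The stability threshold is chosen so small that the diffusive dissipation absorbs the cubic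
term on the whole energy sublevel set, which is then invariant. -/
theorem oneIsLocallyStable (hV : Integrable V) (hodd : ∀ θ : Circ, V (-θ) = -V θ) (hD : 0 < D)
    (hW : Summable fun l : ℕ+ => (l : ℝ) * |sineCoeff V ((l : ℕ) : ℤ)|)
    (hneg : ∀ k : ℕ+, eigenval V D ((k : ℕ) : ℤ) < 0) : OneIsLocallyStable V D := by
  intro η hη
  have hvK := abs_sineCoeff_le_tsum hW
  set W := ∑' l : ℕ+, (l : ℝ) * |sineCoeff V ((l : ℕ) : ℤ)| with hWdef
  have hW0 : 0 ≤ W := (abs_nonneg _).trans (hvK 0)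
  obtain ⟨γ, hγ, hrate⟩ := exists_modeRate_le (v := sineCoeff V) hD hvK hneg
  set δ := min (γ / (8 * Real.pi * (W + 1))) (η / 2) with hδ
  have hδ0 : 0 < δ := lt_min (by positivity) (by linarith)
  have hδη : δ < η := (min_le_right _ _).trans_lt (by linarith)
  have hr : 8 * Real.pi * (√(δ ^ 2) * W) ≤ γ := by
    rw [Real.sqrt_sq hδ0.le]
    have h1 : δ ≤ γ / (8 * Real.pi * (W + 1)) := min_le_left _ _
    rw [le_div_iff₀ (by positivity)] at h1
    have : 0 ≤ 8 * Real.pi * δ := by positivity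
    linarith
  refine ⟨δ, hδ0, fun f hf hmass hfin hlt => ?_⟩
  have h := hf.isModeFlow hV hodd hmass
  have hE0 : modeEnergy (fourierCoeff (toC (f 0))) < δ ^ 2 := (Real.sqrt_lt' hδ0).1 hlt
  have hdecay : ∀ t, 0 < t →
      modeEnergy (fourierCoeff (toC (f t))) ≤ δ ^ 2 * Real.exp (-(γ / 2 * t)) := by
    intro t ht
    refine h.modeEnergy_le (sineCoeff_neg V) hvK hW (fun k => (hneg k).le) hfin hE0 (by linarith)
      (fun s hs hpos hle => ?_) ht
    exact dissipation_of_small hγ hrate hW hvK (h.summable_mul_sq hs)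
      (h.hasDerivAt_modeEnergy (sineCoeff_neg V) hvK hs).1 hr hpos hle
  refine ⟨fun t ht => ?_, hf.convergesToOne hV hodd hmass hW hvK hγ hrate (half_pos hγ) hdecay⟩
  rcases ht.eq_or_lt with rfl | ht
  · exact ⟨hfin, hlt.trans hδη⟩
  · refine ⟨summable_sq_div_of_summable_sq
      (summable_sq_of_summable_mul_sq (h.summable_mul_sq ht)), lt_of_le_of_lt ?_ hδη⟩
    refine Real.sqrt_le_iff.2 ⟨hδ0.le, (hdecay t ht).trans ?_⟩
    refine mul_le_of_le_one_right (sq_nonneg _) (Real.exp_le_one_iff.2 ?_)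
    have : 0 ≤ γ / 2 * t := by positivity
    linarith

/-- Without diffusion the growth rates accumulate at `0`, so a spectral gap forces `D > 0`. -/
theorem pos_of_spectral_gap (hD : 0 ≤ D)
    (hW : Summable fun l : ℕ+ => (l : ℝ) * |sineCoeff V ((l : ℕ) : ℤ)|) {c : ℝ} (hc : 0 < c)
    (hgap : ∀ k : ℕ+, c ≤ -eigenval V D ((k : ℕ) : ℤ)) : 0 < D := by
  refine lt_of_le_of_ne hD fun h0 => ?_
  have hc' : 0 < c / (4 * Real.pi) := by positivity
  obtain ⟨k, hk⟩ := (hW.tendsto_cofinite_zero.eventually_lt_const hc').exists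
  have h1 := hgap k
  rw [eigenval, ← h0, Int.cast_natCast] at h1
  rw [lt_div_iff₀ (by positivity)] at hk
  have h2 := mul_le_mul_of_nonneg_left (neg_abs_le (sineCoeff V ((k : ℕ) : ℤ)))
    (by positivity : 0 ≤ 4 * Real.pi * (k : ℝ))
  linarith

/-- Below the threshold `inf (-c_k) / (4 π ρ)` the spectral gap beats the sharp cubic bound. There
is room for a slightly larger norm `s` that still satisfies the strict inequality; the energy level
`s²` is the barrier in the comparison argument. -/
theorem convergesToOne_of_modeNorm_lt (hV : Integrable V) (hodd : ∀ θ : Circ, V (-θ) = -V θ)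
    (hD : 0 ≤ D) (hW : Summable fun l : ℕ+ => (l : ℝ) * |sineCoeff V ((l : ℕ) : ℤ)|)
    (hρ : BddAbove (range (rhoTerm V))) {f : ℝ → Circ → ℝ} (hf : IsSolution V D f)
    (hmass : ∫ θ : Circ, f 0 θ = 1) (hfin : HasFiniteModeNorm (f 0))
    (hlt : 4 * Real.pi * rho V * modeNorm (f 0) < ⨅ k : ℕ+, -eigenval V D ((k : ℕ) : ℤ)) :
    ConvergesToOne f := by
  have hvK := abs_sineCoeff_le_tsum hW
  have hρ0 : 0 ≤ rho V := Real.sqrt_nonneg _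
  have hn0 : 0 ≤ modeNorm (f 0) := Real.sqrt_nonneg _
  set c := ⨅ k : ℕ+, -eigenval V D ((k : ℕ) : ℤ) with hc
  have hc0 : 0 < c := lt_of_le_of_lt (by positivity) hlt
  have hbdd : BddBelow (range fun k : ℕ+ => -eigenval V D ((k : ℕ) : ℤ)) := by
    -- otherwise the infimum has the default value `0`
    by_contra hb
    exact hc0.ne' (Real.iInf_of_not_bddBelow hb)
  have hgap : ∀ k : ℕ+, c ≤ -eigenval V D ((k : ℕ) : ℤ) := fun k => ciInf_le hbdd k
  have hDpos := pos_of_spectral_gap hD hW hc0 hgap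
  have hneg : ∀ k : ℕ+, modeRate (sineCoeff V) D k < 0 := fun k => by
    have := hgap k
    change eigenval V D ((k : ℕ) : ℤ) < 0
    linarith
  obtain ⟨γ, hγ, hrate⟩ := exists_modeRate_le hDpos hvK hneg
  obtain ⟨s, hs, hsn⟩ : ∃ s, 4 * Real.pi * rho V * s < c ∧ modeNorm (f 0) < s := by
    have h1 : Tendsto (fun s : ℝ => 4 * Real.pi * rho V * s) (𝓝[>] modeNorm (f 0))
        (𝓝 (4 * Real.pi * rho V * modeNorm (f 0))) :=
      (tendsto_const_nhds.mul tendsto_id).mono_left nhdsWithin_le_nhds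
    exact ((h1.eventually_lt_const hlt).and self_mem_nhdsWithin).exists
  have hs0 : 0 < s := hn0.trans_lt hsn
  have hrs : 4 * Real.pi * rho V * √(s ^ 2) < c := by rwa [Real.sqrt_sq hs0.le]
  have hsup : ∀ k : ℕ+, (k : ℝ) ^ 2 * ((k : ℝ) ^ 2 - 1) / 6 * sineCoeff V k ^ 2 ≤ rho V ^ 2 := by
    have h0 : 0 ≤ ⨆ l : ℕ+, rhoTerm V l := (by simp [rhoTerm] : 0 = rhoTerm V 1).le.trans
      (le_ciSup hρ 1)
    intro k
    rw [rho, Real.sq_sqrt h0]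
    exact le_ciSup hρ k
  have h := hf.isModeFlow hV hodd hmass
  refine hf.convergesToOne hV hodd hmass hW hvK hγ hrate (r := s ^ 2)
    (κ := c - 4 * Real.pi * rho V * √(s ^ 2)) (by linarith) fun t ht => ?_
  refine h.modeEnergy_le (sineCoeff_neg V) hvK hW (fun k => (hneg k).le) hfin
    ((Real.sqrt_lt' hs0).1 hsn) (by linarith) (fun u hu hpos hle => ?_) ht
  have hF := h.summable_mul_sq hu
  refine dissipation_of_bdd hρ0 hsup (fun k => ?_) (summable_modeRate_mul D hvK hF)
    (summable_sq_div_of_summable_sq (summable_sq_of_summable_mul_sq hF))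
    (h.hasDerivAt_modeEnergy (sineCoeff_neg V) hvK hu).1 hrs hpos hle
  have := hgap k
  change eigenval V D ((k : ℕ) : ℤ) ≤ -c
  linarith

end Stability

end CircleTransport


open CircleTransport in
theorem theorem3p1 (V : Circ → ℝ) (D : ℝ) (hD : 0 ≤ D)
    (hV : Integrable V) (hodd : ∀ θ : Circ, V (-θ) = -V θ) :
    -- the constant `1` is a stationary solution
    IsStationarySolution V D (fun _ => 1) ∧
    -- `linearizedRhs V D 1` is the derivative at `1` of the right-hand side ...
    (∀ h : Circ → ℂ, CircContDiff 2 h → ∀ θ : Circ,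
      HasDerivAt (fun s : ℂ => rhs V D (fun ψ => 1 + s * h ψ) θ)
        (linearizedRhs V D (fun _ => 1) h θ) 0) ∧
    -- ... and its eigenvalues are exactly the `c_k`, `k ∈ ℤ`
    (∀ μ : ℂ,
      (∃ h : Circ → ℂ, CircContDiff 2 h ∧ h ≠ 0 ∧
        ∀ θ : Circ, linearizedRhs V D (fun _ => 1) h θ = μ * h θ) ↔
      ∃ k : ℤ, μ = (eigenval V D k : ℂ)) ∧
    -- sufficient condition for `Σ l |v_l| < ∞` and `ρ < ∞`
    (CircContDiff 1 V → PiecewiseC2 V →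
      Summable (fun l : ℕ+ => (l : ℝ) * |sineCoeff V ((l : ℕ) : ℤ)|) ∧
      BddAbove (range (rhoTerm V))) ∧
    -- stability, under the assumption `Σ l |v_l| < ∞`
    (Summable (fun l : ℕ+ => (l : ℝ) * |sineCoeff V ((l : ℕ) : ℤ)|) →
      (0 < D → (∀ k : ℕ+, eigenval V D ((k : ℕ) : ℤ) < 0) → OneIsLocallyStable V D) ∧
      (BddAbove (range (rhoTerm V)) →
        ∀ f : ℝ → Circ → ℝ, IsSolution V D f → ∫ θ : Circ, f 0 θ = 1 →
          HasFiniteModeNorm (f 0) →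
          4 * Real.pi * rho V * modeNorm (f 0) < ⨅ k : ℕ+, -eigenval V D ((k : ℕ) : ℤ) →
          ConvergesToOne f)) :=
  ⟨isStationarySolution_one hodd, fun _ hh θ => hasDerivAt_rhs_one_add_mul hV hodd hh θ,
    eigenvalues_linearizedRhs_one hV hodd,
    fun hV1 hp => summable_and_bddAbove_of_piecewiseC2 hV1 hp hodd,
    fun hW => ⟨fun hDpos hneg => oneIsLocallyStable hV hodd hDpos hW hneg,
      fun hρ _ hf hmass hfin hlt =>
        convergesToOne_of_modeNorm_lt hV hodd hD hW hρ hf hmass hfin hlt⟩⟩
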